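/- **Setting.** Work over $\mathbb{C}(q)$, let $\iota=\sqrt{-1}\in\mathbb C$, and put $[n]=\frac{q^n-q^{-n}}{q-q^{-1}}$ and $[\mu;n]=\frac{q^n\mu-q^{-n}\mu^{-1}}{q-q^{-1}}$ for $n\in\mathbb{Z}$, $\mu\in\mathbb{C}(q)^*$. Consider the oriented chain of vertices $\bar 1\xrightarrow{\;1\;}\bar\diamondsuit\xrightarrow{\;0\;}\diamondsuit\xrightarrow{\,-1\,}1$ with edges labelled $1,0,-1$. Let $U_q(\mathfrak{gl}_4)$ be the $\mathbb{C}(q)$-algebra generated by $E_i,F_i$ ($i$ an edge) and pairwise commuting invertible $D_j$ ($j$ a vertex) such that $D_jE_iD_j^{-1}=q^{\delta_{s(i),j}-\delta_{t(i),j}}E_i$ and $D_jF_iD_j^{-1}=q^{\delta_{t(i),j}-\delta_{s(i),j}}F_i$, where $s(i),t(i)$ are the source and target of $i$; $[E_i,F_{i'}]=\delta_{ii'}\frac{K_i-K_i^{-1}}{q-q^{-1}}$ with $K_i=D_{s(i)}D_{t(i)}^{-1}$; and, both for the $E$'s and for the $F$'s, $E_iE_{i'}=E_{i'}E_i$ if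 $i,i'$ are not adjacent and $E_i^2E_{i'}-[2]E_iE_{i'}E_i+E_{i'}E_i^2=0$ if they are adjacent. Let $U_q'\subset U_q(\mathfrak{gl}_4)$ be the quantum symmetric pair coideal subalgebra generated by $$B_{\pm1}=F_{\pm1}+E_{\mp1}K_{\pm1}^{-1},\quad B_0=F_0+q^{-1}E_0K_0^{-1},\quad \hat D_\diamondsuit^{\pm1}=(D_\diamondsuit D_{\bar\diamondsuit})^{\pm1},\quad \hat D_1^{\pm1}=(D_1D_{\bar1})^{\pm1}.$$ Write $[a,b]_p=ab-p\,ba$ and $X=[B_0,B_1]_{q^{-1}}$, $Y=[B_0,B_{-1}]_{q^{-1}}$, $Z=[B_1,Y]_{q^{-1}}$. For $\kappa_\diamondsuit,\kappa_1\in\mathbb{Z}$ and $\beta,\zeta\in\mathbb{C}(q)$ the Verma module $\mathbb{M}(\kappa_\diamondsuit,\kappa_1,\beta,\zeta)$ is the $U_q'$-module induced from the one-dimensional module of the subalgebra generated by $B_1,X,\hat D_\diamondsuit^{\pm1},\hat D_1^{\pm1},B_0,Z$ on which $B_1,X$ act by $0$ and $\hat D_\diamondsuit,\hat D_1,B_0,Z$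 act by $q^{\kappa_\diamondsuit},q^{\kappa_1},\beta,\zeta$. For $\mu\in\mathbb{C}(q)^*$ the Verma module $\mathbb{M}(\kappa_\diamondsuit,\kappa_1,[\mu;0],\zeta)$ is called good if $\mu\neq\pm q^l\iota$ for all $l\in\mathbb{Z}$. **Corollary (BGG resolutions).** Let $\kappa_\diamondsuit,\kappa_1\in\mathbb{Z}$, $\kappa=\kappa_\diamondsuit-\kappa_1$, $\mu\in\mathbb{C}(q)^*$, $\zeta\in\mathbb{C}(q)$. Assume that $M=\mathbb{M}(\kappa_\diamondsuit,\kappa_1,[\mu;0],\zeta)$ is good and that its highest weight is dominant, i.e. $$\zeta=[\mu;\kappa-2i]-q^{-\kappa}[\mu;0]\quad\text{for some }i\in\mathbb{Z}\text{ with }0\le i\le\kappa .$$ Then $M$ has a unique irreducible quotient $L$, it is finite-dimensional, and there is an exact sequence of $U_q'$-modules $$0\to M_3\to M_1\oplus M_2\to M\to L\to 0,$$ whose last map is the quotient map, where $$\begin{aligned} M_1&=\mathbb{M}(\kappa_\diamondsuit-i-1,\;\kappa_1+i+1,\;[\mu;-(i+1)],\;\zeta_1'),&\zeta_1'&=\mu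 q[\kappa-i]+\mu^{-1}q^{2i+1-\kappa}[i+2],\\ M_2&=\mathbb{M}(\kappa_1+i-1,\;\kappa_\diamondsuit-i+1,\;[\mu;\kappa-i+1],\;\zeta_2'),&\zeta_2'&=-\mu q^{\kappa-2i+1}[\kappa-i+2]-\mu^{-1}q[i],\\ M_3&=\mathbb{M}(\kappa_1-2,\;\kappa_\diamondsuit+2,\;[\mu;\kappa-2i],\;\zeta_3'),&\zeta_3'&=q^{\kappa+2}\bigl(\mu^{-1}q^{i-\kappa}[i+2]-\mu q^{-i}[\kappa-i+2]\bigr). \end{aligned}$$ -/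

import Mathlib

noncomputable section

namespace QSP

/-! ### Ground field and quantum integers -/

/-- The ground field `ℂ(q)`. -/
abbrev Kq : Type := RatFunc ℂ

/-- The indeterminate `q`. -/
def q : Kq := RatFunc.X

/-- The square root `ι` of `-1` in `ℂ ⊆ ℂ(q)`. -/
def iota : Kq := RatFunc.C Complex.I

/-- `[μ;n] = (μ qⁿ - μ⁻¹ q⁻ⁿ) / (q - q⁻¹)`, used for `μ ≠ 0`. -/
def qbr (μ : Kq) (n : ℤ) : Kq := (q ^ n * μ - q ^ (-n) * μ⁻¹) / (q - q⁻¹)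

/-- The quantum integer `[n] = (qⁿ - q⁻ⁿ) / (q - q⁻¹)`. -/
def qint (n : ℤ) : Kq := (q ^ n - q ^ (-n)) / (q - q⁻¹)

/-! ### The quantum group `U_q(𝔤𝔩₄)`

It is attached to the linearly oriented graph with vertices `-1, -◇, ◇, 1` (in this order) and
with edges `1 : -1 → -◇`, `0 : -◇ → ◇`, `-1 : ◇ → 1`. -/

/-- The vertices `-1, -◇, ◇, 1`. -/
inductive Vertex : Type
  | negOne | negDia | dia | one
  deriving DecidableEq

/-- The edges, labelled by `-1, 0, 1`. -/
inductive Edge : Type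
  | neg | zero | pos
  deriving DecidableEq

/-- The source of an edge. -/
def Edge.source : Edge → Vertex
  | .pos => .negOne
  | .zero => .negDia
  | .neg => .dia

/-- The target of an edge. -/
def Edge.target : Edge → Vertex
  | .pos => .negDia
  | .zero => .dia
  | .neg => .one

/-- Two distinct edges are adjacent if they share a vertex. -/
def Edge.Adjacent (i j : Edge) : Prop := i.target = j.source ∨ j.target = i.source

/-- The symbols `E_i`, `F_i`, `D_j`, `D_j⁻¹`. -/
inductive Gen : Type
  | E (i : Edge) | F (i : Edge) | D (j : Vertex) | Dinv (j : Vertex)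

/-- `E_i` in the free algebra. -/
abbrev preE (i : Edge) : FreeAlgebra Kq Gen := FreeAlgebra.ι Kq (Gen.E i)
/-- `F_i` in the free algebra. -/
abbrev preF (i : Edge) : FreeAlgebra Kq Gen := FreeAlgebra.ι Kq (Gen.F i)
/-- `D_j` in the free algebra. -/
abbrev preD (j : Vertex) : FreeAlgebra Kq Gen := FreeAlgebra.ι Kq (Gen.D j)
/-- `D_j⁻¹` in the free algebra. -/
abbrev preDinv (j : Vertex) : FreeAlgebra Kq Gen := FreeAlgebra.ι Kq (Gen.Dinv j)

/-- The exponent `δ_{source i, j} - δ_{target i, j}`. -/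
def wt (i : Edge) (j : Vertex) : ℤ :=
  (if i.source = j then 1 else 0) - (if i.target = j then 1 else 0)

/-- The defining relations of `U_q(𝔤𝔩₄)`; here `K_i = D_{source i} D_{target i}⁻¹`. -/
inductive Rel : FreeAlgebra Kq Gen → FreeAlgebra Kq Gen → Prop
  | D_Dinv (j : Vertex) : Rel (preD j * preDinv j) 1
  | Dinv_D (j : Vertex) : Rel (preDinv j * preD j) 1
  | D_comm (j k : Vertex) : Rel (preD j * preD k) (preD k * preD j)
  | D_E (j : Vertex) (i : Edge) : Rel (preD j * preE i * preDinv j) (q ^ wt i j • preE i)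
  | D_F (j : Vertex) (i : Edge) : Rel (preD j * preF i * preDinv j) (q ^ (-wt i j) • preF i)
  | E_F_same (i : Edge) :
      Rel (preE i * preF i - preF i * preE i)
        ((q - q⁻¹)⁻¹ • (preD i.source * preDinv i.target - preD i.target * preDinv i.source))
  | E_F_ne (i j : Edge) (h : i ≠ j) : Rel (preE i * preF j - preF j * preE i) 0
  | E_comm (i j : Edge) (h : ¬ i.Adjacent j) : Rel (preE i * preE j) (preE j * preE i)
  | F_comm (i j : Edge) (h : ¬ i.Adjacent j) : Rel (preF i * preF j) (preF j * preF i)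
  | E_serre (i j : Edge) (h : i.Adjacent j) :
      Rel (preE i * preE i * preE j - qint 2 • (preE i * preE j * preE i)
        + preE j * preE i * preE i) 0
  | F_serre (i j : Edge) (h : i.Adjacent j) :
      Rel (preF i * preF i * preF j - qint 2 • (preF i * preF j * preF i)
        + preF j * preF i * preF i) 0

/-- The quantum group `U_q(𝔤𝔩₄)` over `ℂ(q)`. -/
def Uq : Type := RingQuot Rel

instance : Ring Uq := inferInstanceAs (Ring (RingQuot Rel))
instance : Algebra Kq Uq := inferInstanceAs (Algebra Kq (RingQuot Rel))

namespace Uq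

/-- The image of a generator in `U_q(𝔤𝔩₄)`. -/
def gen (g : Gen) : Uq := RingQuot.mkAlgHom Kq Rel (FreeAlgebra.ι Kq g)

/-- The generator `E_i`. -/
def E (i : Edge) : Uq := gen (.E i)
/-- The generator `F_i`. -/
def F (i : Edge) : Uq := gen (.F i)
/-- The generator `D_j`. -/
def D (j : Vertex) : Uq := gen (.D j)
/-- The generator `D_j⁻¹`. -/
def Dinv (j : Vertex) : Uq := gen (.Dinv j)

/-- `K_i⁻¹`, where `K_i = D_{source i} D_{target i}⁻¹`. -/
def Kinv (i : Edge) : Uq := D i.target * Dinv i.source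

/-- `B_1 = F_1 + E_{-1} K_1⁻¹`. -/
def BPos : Uq := F .pos + E .neg * Kinv .pos
/-- `B_{-1} = F_{-1} + E_1 K_{-1}⁻¹`. -/
def BNeg : Uq := F .neg + E .pos * Kinv .neg
/-- `B_0 = F_0 + q⁻¹ E_0 K_0⁻¹`. -/
def BZero : Uq := F .zero + q⁻¹ • (E .zero * Kinv .zero)
/-- `D̂_◇ = D_◇ D_{-◇}`. -/
def DhatDia : Uq := D .dia * D .negDia
/-- The inverse of `D̂_◇`. -/
def DhatDiaInv : Uq := Dinv .negDia * Dinv .dia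
/-- `D̂_1 = D_1 D_{-1}`. -/
def DhatOne : Uq := D .one * D .negOne
/-- The inverse of `D̂_1`. -/
def DhatOneInv : Uq := Dinv .negOne * Dinv .one

end Uq

/-! ### The quantum symmetric pair coideal subalgebra `U_q' = U_q'(𝔤𝔩₂ × 𝔤𝔩₂)` -/

/-- The subalgebra `U_q'` of `U_q(𝔤𝔩₄)`. -/
def Uq' : Subalgebra Kq Uq :=
  Algebra.adjoin Kq
    {Uq.BPos, Uq.BNeg, Uq.BZero, Uq.DhatDia, Uq.DhatDiaInv, Uq.DhatOne, Uq.DhatOneInv}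

namespace Uq'

/-- `B_1` as an element of `U_q'`. -/
def B1 : Uq' := ⟨Uq.BPos, Algebra.subset_adjoin (by simp)⟩
/-- `B_{-1}` as an element of `U_q'`. -/
def Bm1 : Uq' := ⟨Uq.BNeg, Algebra.subset_adjoin (by simp)⟩
/-- `B_0` as an element of `U_q'`. -/
def B0 : Uq' := ⟨Uq.BZero, Algebra.subset_adjoin (by simp)⟩
/-- `D̂_◇` as an element of `U_q'`. -/
def Ddia : Uq' := ⟨Uq.DhatDia, Algebra.subset_adjoin (by simp)⟩
/-- `D̂_1` as an element of `U_q'`. -/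
def D1 : Uq' := ⟨Uq.DhatOne, Algebra.subset_adjoin (by simp)⟩

/-- The commutator `[a,b]_p = ab - p ba`. -/
def comm (p : Kq) (a b : Uq') : Uq' := a * b - p • (b * a)

/-- `X = [B_0, B_1]_{q⁻¹}`. -/
def X : Uq' := comm q⁻¹ B0 B1
/-- `Y = [B_0, B_{-1}]_{q⁻¹}`. -/
def Y : Uq' := comm q⁻¹ B0 Bm1
/-- `Z = [B_1, Y]_{q⁻¹}`. -/
def Z : Uq' := comm q⁻¹ B1 Y

end Uq'

/-! ### Verma modules -/

open Uq' in
/-- The left ideal of `U_q'` generated by `B_1`, `X`, `D̂_◇ - q^{κ_◇}`, `D̂_1 - q^{κ_1}`, `B_0 - β`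
and `Z - ζ`. These six elements generate, as a left ideal, the kernel of the character
of the subalgebra `U_+' U_0' = ⟨B_1, X, D̂_◇^{±1}, D̂_1^{±1}, B_0, Z⟩` that sends `B_1, X` to `0` and
`D̂_◇, D̂_1, B_0, Z` to `q^{κ_◇}, q^{κ_1}, β, ζ`. -/
def vermaIdeal (kd k1 : ℤ) (β ζ : Kq) : Submodule Uq' Uq' :=
  Submodule.span Uq'
    {B1, X, Ddia - algebraMap Kq Uq' (q ^ kd), D1 - algebraMap Kq Uq' (q ^ k1),
      B0 - algebraMap Kq Uq' β, Z - algebraMap Kq Uq' ζ}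

/-- The Verma module `𝕄(κ_◇, κ_1, β, ζ)` of `U_q'`: the module induced from the
one-dimensional module `ℂ(q)_{(κ_◇, κ_1, β, ζ)}` of the subalgebra `U_+' U_0'`. For a ring `U`, a
subring `S` and a left ideal `J` of `S` one has `U ⊗_S (S / J) = U / U J`, which for the kernel `J`
of the character is the quotient of `U_q'` by the left ideal `vermaIdeal`. -/
abbrev Verma (kd k1 : ℤ) (β ζ : Kq) : Type := Uq' ⧸ vermaIdeal kd k1 β ζ

/-- The Verma module `𝕄(κ_◇, κ_1, [μ;0], ζ)` is good if `μ ≠ ± q^l ι` for every integer `l`. -/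
def IsGood (μ : Kq) : Prop := ∀ l : ℤ, μ ≠ q ^ l * iota ∧ μ ≠ -(q ^ l * iota)

/-- `ζ'_{1,j} = μ q [κ-j] + μ⁻¹ q^{2j+1-κ} [j+2]`. -/
def zeta1 (κ : ℤ) (μ : Kq) (j : ℤ) : Kq :=
  μ * q * qint (κ - j) + μ⁻¹ * q ^ (2 * j + 1 - κ) * qint (j + 2)

/-- `ζ'_{2,j} = - μ q^{2j+1-κ} [j+2] - μ⁻¹ q [κ-j]`. -/
def zeta2 (κ : ℤ) (μ : Kq) (j : ℤ) : Kq :=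
  -(μ * q ^ (2 * j + 1 - κ) * qint (j + 2)) - μ⁻¹ * q * qint (κ - j)

/-- `ζ'_{3,j} = q^{κ+2} (μ⁻¹ q^{j-κ} [j+2] - μ q^{-j} [κ-j+2])`. -/
def zeta3 (κ : ℤ) (μ : Kq) (j : ℤ) : Kq :=
  q ^ (κ + 2) * (μ⁻¹ * q ^ (j - κ) * qint (j + 2) - μ * q ^ (-j) * qint (κ - j + 2))

end QSP

end

noncomputable section

namespace QSP

/-! ### The indeterminate and quantum integers -/

/-! Put `s = i` and `t = κ - i`. The Serre-type relations between $B_0$ and $B_{-1}$ say that if $w$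
is a $B_0$-eigenvector of eigenvalue $[x]$, then $B_{-1}w$ is annihilated by
$(B_0-[qx])(B_0-[q^{-1}x])$. Splitting $B_{-1}w$ accordingly gives two commuting raising operators.
Starting from a highest weight vector they produce a grid $v_{m,n}$ of joint eigenvectors of $B_0$,
$\hat D_\diamondsuit$ and $\hat D_1$, with $B_0$-eigenvalue $[\mu q^{n-m}]$. Goodness makes every
$x+x^{-1}$ invertible, so $B_{-1}v_{m,n}$ is a combination of $v_{m+1,n}$ and $v_{m,n+1}$, both with
nonzero coefficient, and it makes $B_0$ and $\hat D_\diamondsuit$ separate the grid points. The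
vector $B_1v_{m,n}$ is then forced to be a combination of $v_{m-1,n}$ and $v_{m,n-1}$, with explicit
coefficients `gam` and `del` (`c_vv`).

The Verma module is the Fock space with basis $v_{m,n}$ (`exists_vermaEquiv`). The hard point is
that the formulas really define a representation, since $U_q'$ is given as a subalgebra and not by a
presentation. So actual modules are built. The coideal property lets one tensor $U_q'$-modules with
the natural representation of $U_q(\mathfrak{gl}_4)$. From the counit one obtains characters with
$B_0=[\mu]$ for $\mu=q^n$, then for all $\mu$ by interpolation (`charGen_eq_zero`), and from these
highest weight vectors for all $s,t\in\mathbb N$ (`hasHW`). In such a module the $v_{m,n}$ with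
$m\le s$, $n\le t$ stay visible, so a relation of $U_q'$ has no matrix coefficients into this box.
The coefficients are Laurent polynomials in $q^s,q^t$, so they vanish for all integers $s,t$
(`fockRep_eq_zero`).

The resolution is now combinatorics. The coefficient `gam` vanishes only at $m=0$ and $m=s+1$, and
`del` only at $n=0$ and $n=t+1$. Hence a submodule with a vector having a component in the box $m\le
s$, $n\le t$ is everything, and the span of the grid points outside the box is the largest proper
submodule. It is the sum of the quadrants $m\ge s+1$ and $n\ge t+1$, which meet in the quadrant
where both inequalities hold. Each quadrant is the Fock space of its corner vector (`fockMod_isHW`),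
with $s$ replaced by $-s-2$, or $t$ by $-t-2$, or both. These are $M_1$, $M_2$ and $M_3$
(`IsFock.resolution`). -/

theorem q_ne_zero : q ≠ 0 := RatFunc.X_ne_zero

theorem q_pow_ne_one {n : ℕ} (hn : n ≠ 0) : q ^ n ≠ 1 := by
  intro h
  have h' : algebraMap (Polynomial ℂ) (RatFunc ℂ) (Polynomial.X ^ n) =
      algebraMap (Polynomial ℂ) (RatFunc ℂ) 1 := by
    rw [map_pow, RatFunc.algebraMap_X, map_one]; exact h
  have := congrArg Polynomial.natDegree (RatFunc.algebraMap_injective ℂ h')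
  simp at this
  exact hn this

theorem q_zpow_eq_one {n : ℤ} (h : q ^ n = 1) : n = 0 := by
  by_contra hn
  apply q_pow_ne_one (Int.natAbs_ne_zero.mpr hn)
  rcases Int.natAbs_eq n with h' | h'
  · rw [h', zpow_natCast] at h; exact h
  · rw [h', zpow_neg, zpow_natCast, inv_eq_one] at h; exact h

theorem q_zpow_injective : Function.Injective fun n : ℤ => q ^ n := by
  intro m n h
  have : q ^ (m - n) = 1 := by
    rw [zpow_sub₀ q_ne_zero]; simp only at h; rw [h]
    exact div_self (zpow_ne_zero _ q_ne_zero)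
  have := q_zpow_eq_one this
  omega

theorem q_sub_inv_ne_zero : q - q⁻¹ ≠ 0 := by
  intro h
  have h0 := q_ne_zero
  apply q_pow_ne_one (n := 2) (by norm_num)
  field_simp at h
  linear_combination h

theorem q_sq_sub_one_ne_zero : q ^ 2 - 1 ≠ 0 := by
  intro h
  exact q_pow_ne_one (n := 2) (by norm_num) (by linear_combination h)

theorem qint_two : qint 2 = q + q⁻¹ := by
  have h0 := q_ne_zero
  have h1 := q_sub_inv_ne_zero
  have h2 := q_sq_sub_one_ne_zero
  unfold qint
  rw [div_eq_iff h1, zpow_neg]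
  field_simp
  norm_cast
  ring

/-! ### Commutation relations in `U_q(𝔤𝔩₄)` -/

namespace Uq

/-- The universal property of `U_q(𝔤𝔩₄)`. -/
def lift {A : Type*} [Ring A] [Algebra Kq A] (f : FreeAlgebra Kq Gen →ₐ[Kq] A)
    (h : ∀ ⦃x y⦄, Rel x y → f x = f y) : Uq →ₐ[Kq] A :=
  RingQuot.liftAlgHom Kq ⟨f, h⟩

theorem lift_gen {A : Type*} [Ring A] [Algebra Kq A] (f : FreeAlgebra Kq Gen →ₐ[Kq] A)
    (h : ∀ ⦃x y⦄, Rel x y → f x = f y) (g : Gen) :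
    lift f h (gen g) = f (FreeAlgebra.ι Kq g) :=
  RingQuot.liftAlgHom_mkAlgHom_apply Kq f h _

/-- The projection from the free algebra. -/
def proj : FreeAlgebra Kq Gen →ₐ[Kq] Uq := RingQuot.mkAlgHom Kq Rel

theorem proj_rel {x y : FreeAlgebra Kq Gen} (h : Rel x y) : proj x = proj y :=
  RingQuot.mkAlgHom_rel Kq h

theorem proj_E (i : Edge) : proj (FreeAlgebra.ι Kq (.E i)) = E i := rfl
theorem proj_F (i : Edge) : proj (FreeAlgebra.ι Kq (.F i)) = F i := rfl
theorem proj_D (j : Vertex) : proj (FreeAlgebra.ι Kq (.D j)) = D j := rfl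
theorem proj_Dinv (j : Vertex) : proj (FreeAlgebra.ι Kq (.Dinv j)) = Dinv j := rfl

theorem D_mul_Dinv (j : Vertex) : D j * Dinv j = 1 := by
  simpa [proj_E, proj_F, proj_D, proj_Dinv] using proj_rel (Rel.D_Dinv j)

theorem Dinv_mul_D (j : Vertex) : Dinv j * D j = 1 := by
  simpa [proj_E, proj_F, proj_D, proj_Dinv] using proj_rel (Rel.Dinv_D j)

theorem D_commute (j k : Vertex) : Commute (D j) (D k) := by
  simpa [proj_E, proj_F, proj_D, proj_Dinv, commute_iff_eq] using proj_rel (Rel.D_comm j k)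

/-- `D_j` as a unit. -/
def Dunit (j : Vertex) : Uqˣ := ⟨D j, Dinv j, D_mul_Dinv j, Dinv_mul_D j⟩

theorem D_commute_Dinv (j k : Vertex) : Commute (D j) (Dinv k) :=
  Commute.units_inv_right (u := Dunit k) (D_commute j k)

theorem Dinv_commute (j k : Vertex) : Commute (Dinv j) (Dinv k) :=
  Commute.units_inv_left (u := Dunit j) (D_commute_Dinv j k)

theorem D_mul_E (j : Vertex) (i : Edge) : D j * E i = q ^ wt i j • (E i * D j) := by
  have h : D j * E i * Dinv j = q ^ wt i j • E i := by
    simpa [proj_E, proj_F, proj_D, proj_Dinv] using proj_rel (Rel.D_E j i)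
  rw [← smul_mul_assoc, ← h, mul_assoc, Dinv_mul_D, mul_one]

theorem D_mul_F (j : Vertex) (i : Edge) : D j * F i = q ^ (-wt i j) • (F i * D j) := by
  have h : D j * F i * Dinv j = q ^ (-wt i j) • F i := by
    simpa [proj_E, proj_F, proj_D, proj_Dinv] using proj_rel (Rel.D_F j i)
  rw [← smul_mul_assoc, ← h, mul_assoc, Dinv_mul_D, mul_one]

theorem inv_mul_of_mul {A : Type*} [Ring A] [Algebra Kq A] {d d' x : A} {n : ℤ}
    (h₁ : d * d' = 1) (h₂ : d' * d = 1) (h : d * x = q ^ n • (x * d)) :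
    d' * x = q ^ (-n) • (x * d') := by
  have h3 : d' * (d * x) * d' = x * d' := by rw [← mul_assoc, h₂, one_mul]
  rw [h, mul_smul_comm, smul_mul_assoc, mul_assoc, mul_assoc, h₁, mul_one] at h3
  rw [← h3, smul_smul, ← zpow_add₀ q_ne_zero]
  simp

theorem Dinv_mul_E (j : Vertex) (i : Edge) : Dinv j * E i = q ^ (-wt i j) • (E i * Dinv j) :=
  inv_mul_of_mul (D_mul_Dinv j) (Dinv_mul_D j) (D_mul_E j i)

theorem Dinv_mul_F (j : Vertex) (i : Edge) : Dinv j * F i = q ^ wt i j • (F i * Dinv j) := by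
  simpa using inv_mul_of_mul (D_mul_Dinv j) (Dinv_mul_D j) (D_mul_F j i)

/-- `K_i = D_{source i} D_{target i}⁻¹`. -/
def K (i : Edge) : Uq := D i.source * Dinv i.target

/-- The Cartan matrix. -/
def cartan (i j : Edge) : ℤ := wt j i.source - wt j i.target

theorem cartan_symm (i j : Edge) : cartan i j = cartan j i := by
  cases i <;> cases j <;> simp [cartan, wt, Edge.source, Edge.target]

theorem cartan_self (i : Edge) : cartan i i = 2 := by
  cases i <;> simp [cartan, wt, Edge.source, Edge.target]

theorem cartan_adjacent {i j : Edge} (h : i.Adjacent j) : cartan i j = -1 := by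
  cases i <;> cases j <;> simp_all [cartan, wt, Edge.source, Edge.target, Edge.Adjacent]

theorem cartan_ne {i j : Edge} (hne : i ≠ j) (h : ¬ i.Adjacent j) : cartan i j = 0 := by
  cases i <;> cases j <;> simp_all [cartan, wt, Edge.source, Edge.target, Edge.Adjacent]

theorem Adjacent.symm {i j : Edge} (h : i.Adjacent j) : j.Adjacent i := Or.symm h

theorem mul_weight {A : Type*} [Ring A] [Algebra Kq A] {d d' x : A} {m n : ℤ}
    (h : d * x = q ^ m • (x * d)) (h' : d' * x = q ^ n • (x * d')) :
    d * d' * x = q ^ (m + n) • (x * (d * d')) := by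
  rw [mul_assoc, h', mul_smul_comm, ← mul_assoc, h, smul_mul_assoc, smul_smul, mul_assoc,
    zpow_add₀ q_ne_zero, mul_comm]

theorem K_mul_E (i j : Edge) : K i * E j = q ^ cartan i j • (E j * K i) :=
  mul_weight (D_mul_E _ _) (Dinv_mul_E _ _)

theorem K_mul_F (i j : Edge) : K i * F j = q ^ (-cartan i j) • (F j * K i) := by
  rw [show -cartan i j = -wt j i.source + wt j i.target by unfold cartan; ring]
  exact mul_weight (D_mul_F _ _) (Dinv_mul_F _ _)

theorem Kinv_mul_E (i j : Edge) : Kinv i * E j = q ^ (-cartan i j) • (E j * Kinv i) := by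
  rw [show -cartan i j = wt j i.target + -wt j i.source by unfold cartan; ring]
  exact mul_weight (D_mul_E _ _) (Dinv_mul_E _ _)

theorem Kinv_mul_F (i j : Edge) : Kinv i * F j = q ^ cartan i j • (F j * Kinv i) := by
  rw [show cartan i j = -wt j i.target + wt j i.source by unfold cartan; ring]
  exact mul_weight (D_mul_F _ _) (Dinv_mul_F _ _)

theorem D_commute_K (j : Vertex) (i : Edge) : Commute (D j) (K i) :=
  (D_commute _ _).mul_right (D_commute_Dinv _ _)

theorem D_commute_Kinv (j : Vertex) (i : Edge) : Commute (D j) (Kinv i) :=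
  (D_commute _ _).mul_right (D_commute_Dinv _ _)

theorem Dinv_commute_Kinv (j : Vertex) (i : Edge) : Commute (Dinv j) (Kinv i) :=
  (D_commute_Dinv _ _).symm.mul_right (Dinv_commute _ _)

theorem K_commute (i j : Edge) : Commute (K i) (K j) :=
  (D_commute_K _ _).mul_left ((D_commute_Dinv _ _).symm.mul_right (Dinv_commute _ _))

theorem Kinv_commute (i j : Edge) : Commute (Kinv i) (Kinv j) :=
  (D_commute_Kinv _ _).mul_left (Dinv_commute_Kinv _ _)

theorem K_mul_Kinv (i : Edge) : K i * Kinv i = 1 := by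
  unfold K Kinv
  rw [mul_assoc, ← mul_assoc (Dinv i.target), Dinv_mul_D, one_mul, D_mul_Dinv]

theorem E_mul_F_same (i : Edge) :
    E i * F i - F i * E i = (q - q⁻¹)⁻¹ • (K i - Kinv i) := by
  simpa [proj_E, proj_F, proj_D, proj_Dinv, K, Kinv] using proj_rel (Rel.E_F_same i)

theorem E_commute_F {i j : Edge} (h : i ≠ j) : Commute (E i) (F j) := by
  have := proj_rel (Rel.E_F_ne i j h)
  simp only [map_sub, map_mul, proj_E, proj_F, map_zero] at this
  exact sub_eq_zero.mp this

theorem E_commute {i j : Edge} (h : ¬ i.Adjacent j) : Commute (E i) (E j) := by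
  simpa [proj_E, proj_F, proj_D, proj_Dinv, commute_iff_eq] using proj_rel (Rel.E_comm i j h)

theorem F_commute {i j : Edge} (h : ¬ i.Adjacent j) : Commute (F i) (F j) := by
  simpa [proj_E, proj_F, proj_D, proj_Dinv, commute_iff_eq] using proj_rel (Rel.F_comm i j h)

theorem E_serre {i j : Edge} (h : i.Adjacent j) :
    E i * (E i * E j) - (q + q⁻¹) • (E i * (E j * E i)) + E j * (E i * E i) = 0 := by
  have := proj_rel (Rel.E_serre i j h)
  simpa [proj_E, proj_F, proj_D, proj_Dinv, mul_assoc, qint_two] using this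

theorem F_serre {i j : Edge} (h : i.Adjacent j) :
    F i * (F i * F j) - (q + q⁻¹) • (F i * (F j * F i)) + F j * (F i * F i) = 0 := by
  have := proj_rel (Rel.F_serre i j h)
  simpa [proj_E, proj_F, proj_D, proj_Dinv, mul_assoc, qint_two] using this

end Uq

/-! ### The coproduct -/

section Coproduct

/-- Quantum Serre relations for sums of two pairs which commute up to powers of `q`. -/
theorem serre_add {K A : Type*} [Field K] [Ring A] [Algebra K A] {q : K} (h0 : q ≠ 0)
    {a a' b b' k k' : A} (hkk : k' * k = k * k')
    (hba : b * a = a * b) (hba' : b * a' = a' * b) (hb'a : b' * a = a * b')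
    (hbk : b * k = k * b) (hbk' : b * k' = k' * b) (hb'k : b' * k = k * b')
    (hka : k * a = q ^ (2 : ℤ) • (a * k)) (hka' : k * a' = q ^ (-1 : ℤ) • (a' * k))
    (hk'a : k' * a = q ^ (-1 : ℤ) • (a * k'))
    (ha : a * (a * a') - (q + q⁻¹) • (a * (a' * a)) + a' * (a * a) = 0)
    (hb : b * (b * b') - (q + q⁻¹) • (b * (b' * b)) + b' * (b * b) = 0) :
    (a + k * b) * ((a + k * b) * (a' + k' * b'))
      - (q + q⁻¹) • ((a + k * b) * ((a' + k' * b') * (a + k * b)))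
      + (a' + k' * b') * ((a + k * b) * (a + k * b)) = 0 := by
  have L : ∀ {x y z : A}, x * y = z → ∀ w, x * (y * w) = z * w := fun h w => by
    rw [← mul_assoc, h]
  -- In normal order (`a`'s, then `k`'s, then `b`'s) the pure `b` part carries the prefix `k * k *
  -- k'`, and the mixed terms cancel by identities in `q`.
  have hb' := congrArg (fun z => k * (k * (k' * z))) hb
  simp only [mul_add, add_mul, mul_sub, mul_smul_comm, smul_mul_assoc, mul_assoc, mul_zero,
    smul_add, smul_smul,
    L hkk, hba, L hba, hba', L hba', hb'a, L hb'a, L hbk, L hbk', L hb'k,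
    L hka, L hka', L hk'a] at hb' ⊢
  linear_combination (norm := skip) ha + hb'
  match_scalars <;> (try simp only [zpow_neg, zpow_ofNat]) <;> field_simp <;> ring

variable {A : Type*} [Ring A] [Algebra Kq A]

/-- The values on generators of the coproduct `E_i ↦ E_i ⊗ 1 + K_i ⊗ E_i`,
`F_i ↦ F_i ⊗ K_i⁻¹ + 1 ⊗ F_i`, `D_j ↦ D_j ⊗ D_j`, composed with `φ ⊗ ψ`. -/
def coprodGen (φ ψ : Uq →ₐ[Kq] A) : Gen → A
  | .E i => φ (Uq.E i) + φ (Uq.K i) * ψ (Uq.E i)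
  | .F i => φ (Uq.F i) * ψ (Uq.Kinv i) + ψ (Uq.F i)
  | .D j => φ (Uq.D j) * ψ (Uq.D j)
  | .Dinv j => φ (Uq.Dinv j) * ψ (Uq.Dinv j)

theorem commute_cross {φ ψ : Uq →ₐ[Kq] A} (hc : ∀ x y, ψ y * φ x = φ x * ψ y) (x y z w : Uq) :
    (φ x * ψ y) * (φ z * ψ w) = φ (x * z) * ψ (y * w) := by
  rw [map_mul, map_mul, mul_assoc, ← mul_assoc (ψ y), hc]
  simp only [mul_assoc]

theorem coprod_D_mul_E {φ ψ : Uq →ₐ[Kq] A} (hc : ∀ x y, ψ y * φ x = φ x * ψ y)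
    (j : Vertex) (i : Edge) :
    φ (Uq.D j) * ψ (Uq.D j) * (φ (Uq.E i) + φ (Uq.K i) * ψ (Uq.E i)) =
      q ^ wt i j • ((φ (Uq.E i) + φ (Uq.K i) * ψ (Uq.E i)) * (φ (Uq.D j) * ψ (Uq.D j))) := by
  have h1 := commute_cross hc (Uq.D j) (Uq.D j) (Uq.E i) 1
  have h2 := commute_cross hc (Uq.E i) 1 (Uq.D j) (Uq.D j)
  simp only [map_one, mul_one, one_mul] at h1 h2
  rw [mul_add, add_mul, h1, h2, commute_cross hc, commute_cross hc, Uq.D_mul_E,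
    (Uq.D_commute_K j i).eq, map_smul, map_smul, smul_mul_assoc, mul_smul_comm, smul_add]

theorem coprod_D_mul_F {φ ψ : Uq →ₐ[Kq] A} (hc : ∀ x y, ψ y * φ x = φ x * ψ y)
    (j : Vertex) (i : Edge) :
    φ (Uq.D j) * ψ (Uq.D j) * (φ (Uq.F i) * ψ (Uq.Kinv i) + ψ (Uq.F i)) =
      q ^ (-wt i j) •
        ((φ (Uq.F i) * ψ (Uq.Kinv i) + ψ (Uq.F i)) * (φ (Uq.D j) * ψ (Uq.D j))) := by
  have h1 := commute_cross hc (Uq.D j) (Uq.D j) 1 (Uq.F i)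
  have h2 := commute_cross hc 1 (Uq.F i) (Uq.D j) (Uq.D j)
  simp only [map_one, mul_one, one_mul] at h1 h2
  rw [mul_add, add_mul, h1, h2, commute_cross hc, commute_cross hc, Uq.D_mul_F,
    (Uq.D_commute_Kinv j i).eq, map_smul, map_smul, smul_mul_assoc, mul_smul_comm, smul_add]

/-- The mixed terms $K_iF_j\otimes E_iK_j^{-1}$ and $F_jK_i\otimes K_j^{-1}E_i$ pick up the same
power of $q$ because the Cartan matrix is symmetric, so they cancel in the commutator. -/
theorem coprod_E_F {φ ψ : Uq →ₐ[Kq] A} (hc : ∀ x y, ψ y * φ x = φ x * ψ y) (i j : Edge) :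
    (φ (Uq.E i) + φ (Uq.K i) * ψ (Uq.E i)) * (φ (Uq.F j) * ψ (Uq.Kinv j) + ψ (Uq.F j)) -
      (φ (Uq.F j) * ψ (Uq.Kinv j) + ψ (Uq.F j)) * (φ (Uq.E i) + φ (Uq.K i) * ψ (Uq.E i)) =
    φ (Uq.E i * Uq.F j - Uq.F j * Uq.E i) * ψ (Uq.Kinv j) +
      φ (Uq.K i) * ψ (Uq.E i * Uq.F j - Uq.F j * Uq.E i) := by
  have h1 := commute_cross hc (Uq.E i) 1 (Uq.F j) (Uq.Kinv j)
  have h2 := commute_cross hc (Uq.F j) (Uq.Kinv j) (Uq.E i) 1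
  have h3 := commute_cross hc (Uq.K i) (Uq.E i) 1 (Uq.F j)
  have h4 := commute_cross hc 1 (Uq.F j) (Uq.K i) (Uq.E i)
  simp only [map_one, mul_one, one_mul] at h1 h2 h3 h4
  have h5 : φ (Uq.K i * Uq.F j) * ψ (Uq.E i * Uq.Kinv j) =
      φ (Uq.F j * Uq.K i) * ψ (Uq.Kinv j * Uq.E i) := by
    rw [Uq.K_mul_F, Uq.Kinv_mul_E, Uq.cartan_symm j i, map_smul, map_smul, smul_mul_assoc,
      mul_smul_comm]
  simp only [mul_add, add_mul, h1, h2, h3, h4, commute_cross hc, h5, hc, map_sub, sub_mul, mul_sub]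
  abel

theorem coprod_E_serre {φ ψ : Uq →ₐ[Kq] A} (hc : ∀ x y, ψ y * φ x = φ x * ψ y) {i j : Edge}
    (h : i.Adjacent j) :
    let e := fun i => φ (Uq.E i) + φ (Uq.K i) * ψ (Uq.E i)
    e i * (e i * e j) - (q + q⁻¹) • (e i * (e j * e i)) + e j * (e i * e i) = 0 := by
  intro e
  have hφ := congrArg φ (Uq.E_serre h)
  have hψ := congrArg ψ (Uq.E_serre h)
  simp only [map_add, map_sub, map_mul, map_smul, map_zero] at hφ hψ
  refine serre_add q_ne_zero ?_ (hc _ _) (hc _ _) (hc _ _) (hc _ _) (hc _ _) (hc _ _)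
    ?_ ?_ ?_ hφ hψ
  · rw [← map_mul, ← map_mul, (Uq.K_commute j i).eq]
  · rw [← map_mul, ← map_mul, Uq.K_mul_E, Uq.cartan_self, map_smul]
  · rw [← map_mul, ← map_mul, Uq.K_mul_E, Uq.cartan_adjacent h, map_smul]
  · rw [← map_mul, ← map_mul, Uq.K_mul_E, Uq.cartan_symm, Uq.cartan_adjacent h, map_smul]

/-- Exchanging the two tensor factors brings $\Delta(F_i)$ to the shape of $\Delta(E_i)$, so
`serre_add` applies with `φ` and `ψ` swapped. -/
theorem coprod_F_serre {φ ψ : Uq →ₐ[Kq] A} (hc : ∀ x y, ψ y * φ x = φ x * ψ y) {i j : Edge}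
    (h : i.Adjacent j) :
    let e := fun i => φ (Uq.F i) * ψ (Uq.Kinv i) + ψ (Uq.F i)
    e i * (e i * e j) - (q + q⁻¹) • (e i * (e j * e i)) + e j * (e i * e i) = 0 := by
  intro e
  have he : ∀ i, e i = ψ (Uq.F i) + ψ (Uq.Kinv i) * φ (Uq.F i) := fun i => by
    rw [hc, add_comm]
  have hφ := congrArg φ (Uq.F_serre h)
  have hψ := congrArg ψ (Uq.F_serre h)
  simp only [map_add, map_sub, map_mul, map_smul, map_zero] at hφ hψ
  simp only [he]
  refine serre_add q_ne_zero ?_ (hc _ _).symm (hc _ _).symm (hc _ _).symm (hc _ _).symm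
    (hc _ _).symm (hc _ _).symm ?_ ?_ ?_ hψ hφ
  · rw [← map_mul, ← map_mul, (Uq.Kinv_commute j i).eq]
  · rw [← map_mul, ← map_mul, Uq.Kinv_mul_F, Uq.cartan_self, map_smul]
  · rw [← map_mul, ← map_mul, Uq.Kinv_mul_F, Uq.cartan_adjacent h, map_smul]
  · rw [← map_mul, ← map_mul, Uq.Kinv_mul_F, Uq.cartan_symm, Uq.cartan_adjacent h, map_smul]

theorem coprodGen_rel {φ ψ : Uq →ₐ[Kq] A} (hc : ∀ x y, ψ y * φ x = φ x * ψ y) ⦃x y⦄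
    (h : Rel x y) : FreeAlgebra.lift Kq (coprodGen φ ψ) x =
      FreeAlgebra.lift Kq (coprodGen φ ψ) y := by
  have hD : ∀ j, φ (Uq.D j) * ψ (Uq.D j) * (φ (Uq.Dinv j) * ψ (Uq.Dinv j)) = 1 := fun j => by
    rw [commute_cross hc, Uq.D_mul_Dinv, map_one, map_one, mul_one]
  cases h with
  | D_Dinv j => simpa [coprodGen] using hD j
  | Dinv_D j =>
    simp only [map_mul, FreeAlgebra.lift_ι_apply, coprodGen, commute_cross hc, Uq.Dinv_mul_D,
      map_one, mul_one]
  | D_comm j k =>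
    simp only [map_mul, FreeAlgebra.lift_ι_apply, coprodGen]
    rw [commute_cross hc, (Uq.D_commute j k).eq, ← commute_cross hc]
  | D_E j i =>
    simp only [map_mul, map_smul, FreeAlgebra.lift_ι_apply, coprodGen]
    rw [coprod_D_mul_E hc, smul_mul_assoc, mul_assoc, hD, mul_one]
  | D_F j i =>
    simp only [map_mul, map_smul, FreeAlgebra.lift_ι_apply, coprodGen]
    rw [coprod_D_mul_F hc, smul_mul_assoc, mul_assoc, hD, mul_one]
  | E_F_same i =>
    simp only [map_mul, map_sub, map_smul, FreeAlgebra.lift_ι_apply, coprodGen]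
    rw [coprod_E_F hc, Uq.E_mul_F_same, commute_cross hc, commute_cross hc]
    change _ = (q - q⁻¹)⁻¹ • (φ (Uq.K i) * ψ (Uq.K i) - φ (Uq.Kinv i) * ψ (Uq.Kinv i))
    simp only [map_smul, map_sub, smul_mul_assoc, mul_smul_comm, sub_mul, mul_sub, smul_sub]
    abel
  | E_F_ne i j hij =>
    simp only [map_mul, map_sub, map_zero, FreeAlgebra.lift_ι_apply, coprodGen]
    rw [coprod_E_F hc, (Uq.E_commute_F hij).eq]
    simp
  | E_comm i j hij =>
    simp only [map_mul, FreeAlgebra.lift_ι_apply, coprodGen]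
    by_cases hne : i = j
    · rw [hne]
    have hc' := Uq.cartan_ne hne hij
    have hc'' := Uq.cartan_symm j i
    have h1 := commute_cross hc (Uq.E i) 1 (Uq.K j) (Uq.E j)
    have h2 := commute_cross hc (Uq.E j) 1 (Uq.K i) (Uq.E i)
    have h3 := commute_cross hc (Uq.K i) (Uq.E i) (Uq.E j) 1
    have h4 := commute_cross hc (Uq.K j) (Uq.E j) (Uq.E i) 1
    simp only [map_one, mul_one, one_mul] at h1 h2 h3 h4
    simp only [mul_add, add_mul, h1, h2, h3, h4, commute_cross hc, ← map_mul,
      (Uq.E_commute hij).eq, Uq.K_mul_E, hc', hc'', zpow_zero, one_smul, (Uq.K_commute i j).eq]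
    abel
  | F_comm i j hij =>
    simp only [map_mul, FreeAlgebra.lift_ι_apply, coprodGen]
    by_cases hne : i = j
    · rw [hne]
    have hc' := Uq.cartan_ne hne hij
    have hc'' := Uq.cartan_symm j i
    have h1 := commute_cross hc (Uq.F i) (Uq.Kinv i) 1 (Uq.F j)
    have h2 := commute_cross hc (Uq.F j) (Uq.Kinv j) 1 (Uq.F i)
    have h3 := commute_cross hc 1 (Uq.F i) (Uq.F j) (Uq.Kinv j)
    have h4 := commute_cross hc 1 (Uq.F j) (Uq.F i) (Uq.Kinv i)
    simp only [map_one, mul_one, one_mul] at h1 h2 h3 h4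
    simp only [mul_add, add_mul, h1, h2, h3, h4, commute_cross hc, ← map_mul,
      (Uq.F_commute hij).eq, Uq.Kinv_mul_F, hc', hc'', zpow_zero, one_smul,
      (Uq.Kinv_commute i j).eq]
    abel
  | E_serre i j hij =>
    simpa [coprodGen, mul_assoc, qint_two] using coprod_E_serre hc hij
  | F_serre i j hij =>
    simpa [coprodGen, mul_assoc, qint_two] using coprod_F_serre hc hij

/-- The composite of the coproduct with `φ ⊗ ψ`, for `φ` and `ψ` with commuting images. -/
def coprod (φ ψ : Uq →ₐ[Kq] A) (hc : ∀ x y, ψ y * φ x = φ x * ψ y) : Uq →ₐ[Kq] A :=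
  Uq.lift _ (coprodGen_rel hc)

section

variable (φ ψ : Uq →ₐ[Kq] A) (hc : ∀ x y, ψ y * φ x = φ x * ψ y)

theorem coprod_E (i : Edge) :
    coprod φ ψ hc (Uq.E i) = φ (Uq.E i) + φ (Uq.K i) * ψ (Uq.E i) := by
  simp [coprod, Uq.E, Uq.lift_gen, coprodGen]

theorem coprod_F (i : Edge) :
    coprod φ ψ hc (Uq.F i) = φ (Uq.F i) * ψ (Uq.Kinv i) + ψ (Uq.F i) := by
  simp [coprod, Uq.F, Uq.lift_gen, coprodGen]

theorem coprod_D (j : Vertex) : coprod φ ψ hc (Uq.D j) = φ (Uq.D j) * ψ (Uq.D j) := by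
  simp [coprod, Uq.D, Uq.lift_gen, coprodGen]

theorem coprod_Dinv (j : Vertex) :
    coprod φ ψ hc (Uq.Dinv j) = φ (Uq.Dinv j) * ψ (Uq.Dinv j) := by
  simp [coprod, Uq.Dinv, Uq.lift_gen, coprodGen]

theorem coprod_E_Kinv (i j : Edge) :
    coprod φ ψ hc (Uq.E i * Uq.Kinv j) = φ (Uq.E i * Uq.Kinv j) * ψ (Uq.Kinv j) +
      φ (Uq.K i * Uq.Kinv j) * ψ (Uq.E i * Uq.Kinv j) := by
  have h : coprod φ ψ hc (Uq.Kinv j) = φ (Uq.Kinv j) * ψ (Uq.Kinv j) := by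
    rw [Uq.Kinv, map_mul, coprod_D, coprod_Dinv, commute_cross hc]
  have h1 := commute_cross hc (Uq.E i) 1 (Uq.Kinv j) (Uq.Kinv j)
  simp only [map_one, mul_one, one_mul] at h1
  rw [map_mul, h, coprod_E, add_mul, commute_cross hc, h1]

/-- This is the coideal property: the first tensor factors are $B$-type elements, $1$ and
$K_jK_i^{-1}$, and for the pairs `(i, j)` in question the last is a product of $\hat D$'s. -/
theorem coprod_B (i j : Edge) (c : Kq) :
    coprod φ ψ hc (Uq.F i + c • (Uq.E j * Uq.Kinv i)) =
      φ (Uq.F i + c • (Uq.E j * Uq.Kinv i)) * ψ (Uq.Kinv i) +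
      ψ (Uq.F i) + c • (φ (Uq.K j * Uq.Kinv i) * ψ (Uq.E j * Uq.Kinv i)) := by
  rw [map_add, map_smul, coprod_E_Kinv, coprod_F, map_add φ, map_smul φ, add_mul, smul_add,
    smul_mul_assoc]
  abel

end

end Coproduct

/-! ### Relations in the coideal subalgebra -/

section Abstract

variable {K A : Type*} [Field K] [Ring A] [Algebra K A]

/-- The quantum Serre expression `x² y - (q + q⁻¹) x y x + y x²`. -/
def serreExpr (q : K) (x y : A) : A :=
  x * (x * y) - (q + q⁻¹) • (x * (y * x)) + y * (x * x)

/-- Every word contains `a * k` twice and `a' * k'` once, and moving the `k`'s to the right costs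
the same scalar `r * s ^ 2` each time. -/
theorem serreExpr_twist {q r s : K} {a a' k k' : A} (hkk : k' * k = k * k')
    (hka : k * a = r • (a * k)) (hka' : k * a' = s • (a' * k)) (hk'a : k' * a = s • (a * k'))
    (h : serreExpr q a a' = 0) : serreExpr q (a * k) (a' * k') = 0 := by
  have L : ∀ {x y z : A}, x * y = z → ∀ w, x * (y * w) = z * w := fun h w => by
    rw [← mul_assoc, h]
  have h' := congrArg (fun z => z * (k * (k * k'))) h
  simp only [serreExpr, add_mul, sub_mul, mul_smul_comm, smul_mul_assoc,
    mul_assoc, zero_mul, smul_smul,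
    hkk, L hkk, L hka, L hka', L hk'a] at h' ⊢
  linear_combination (norm := skip) (r * s ^ 2) • h'
  match_scalars <;> ring

/-- Here `f + e` is modelled on $B_{-1}$ and `F + q⁻¹ • G` on $B_0$. After $q$-commuting, the mixed
words occur with coefficients such as $1+q^2-(q+q^{-1})q=0$, and only the two pure Serre expressions
survive. -/
theorem serreExpr_coideal {q : K} (h0 : q ≠ 0) {f e F G : A} (hef : e * f = q ^ 2 • (f * e))
    (heF : e * F = q⁻¹ • (F * e)) (hGf : G * f = q⁻¹ • (f * G))
    (hF : serreExpr q f F = 0) (hG : serreExpr q e G = 0) :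
    serreExpr q (f + e) (F + q⁻¹ • G) = 0 := by
  have L : ∀ {x y z : A}, x * y = z → ∀ w, x * (y * w) = z * w := fun h w => by
    rw [← mul_assoc, h]
  simp only [serreExpr, mul_add, add_mul, mul_smul_comm, smul_mul_assoc,
    mul_assoc, smul_add, smul_smul, hef, L hef, heF, L heF, hGf, L hGf] at hF hG ⊢
  linear_combination (norm := skip) hF + q⁻¹ • hG
  match_scalars <;> field_simp <;> ring

/-- The inhomogeneous right-hand side comes from the commutator term in `hGF`. Its `h` parts cancel
because `h` scales `f` and `e` by $q^{\mp2}$, and its constant part sums to exactly `f + e`. -/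
theorem serreExpr_coideal_zero {q : K} (h0 : q ≠ 0) (h2 : q ^ 2 - 1 ≠ 0)
    {f e F G h : A}
    (hGF : G * F = q ^ 2 • (F * G) + (q ^ 2 * (q - q⁻¹)⁻¹) • (1 - h))
    (hGf : G * f = q⁻¹ • (f * G)) (heF : e * F = q⁻¹ • (F * e))
    (hf : h * f = (q ^ 2)⁻¹ • (f * h)) (he : h * e = q ^ 2 • (e * h))
    (hF : serreExpr q F f = 0) (hG : serreExpr q G e = 0) :
    serreExpr q (F + q⁻¹ • G) (f + e) = f + e := by
  have L : ∀ {x y z : A}, x * y = z → ∀ w, x * (y * w) = z * w := fun h w => by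
    rw [← mul_assoc, h]
  simp only [serreExpr, mul_add, add_mul, mul_sub, sub_mul, mul_smul_comm, smul_mul_assoc,
    mul_assoc, smul_add, smul_sub, smul_smul, mul_one, one_mul,
    hGF, L hGF, hGf, L hGf, heF, L heF, hf, he] at hF hG ⊢
  linear_combination (norm := skip) hF + (q⁻¹ * q⁻¹) • hG
  match_scalars <;> field_simp <;> ring

end Abstract

namespace Uq

theorem serreExpr_E {i j : Edge} (h : i.Adjacent j) : serreExpr q (E i) (E j) = 0 := E_serre h

theorem serreExpr_F {i j : Edge} (h : i.Adjacent j) : serreExpr q (F i) (F j) = 0 := F_serre h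

theorem E_Kinv_mul_F {i j k : Edge} (h : i ≠ k) :
    E i * Kinv j * F k = q ^ cartan j k • (F k * (E i * Kinv j)) := by
  rw [mul_assoc, Kinv_mul_F, mul_smul_comm, ← mul_assoc, (E_commute_F h).eq, mul_assoc]

theorem serreExpr_E_Kinv {i j i' j' : Edge} (h : i.Adjacent j) (h1 : cartan i' j = -1)
    (h2 : cartan j' i = -1) : serreExpr q (E i * Kinv i') (E j * Kinv j') = 0 :=
  serreExpr_twist (r := q ^ (-cartan i' i)) (s := q) (Kinv_commute _ _) (Kinv_mul_E _ _)
    (by simpa [h1] using Kinv_mul_E i' j) (by simpa [h2] using Kinv_mul_E j' i) (serreExpr_E h)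

theorem serreExpr_BNeg_BZero : serreExpr q BNeg BZero = 0 := by
  have c1 : Edge.neg.Adjacent .zero := by simp [Edge.Adjacent, Edge.source, Edge.target]
  have c2 : Edge.pos.Adjacent .zero := by simp [Edge.Adjacent, Edge.source, Edge.target]
  refine serreExpr_coideal q_ne_zero ?_ ?_ ?_ (serreExpr_F c1)
    (serreExpr_E_Kinv c2 (cartan_adjacent c1) (cartan_adjacent (Adjacent.symm c2)))
  · simpa [cartan_self] using E_Kinv_mul_F (i := .pos) (j := .neg) (k := .neg) (by simp)
  · simpa [cartan_adjacent c1] using E_Kinv_mul_F (i := .pos) (j := .neg) (k := .zero) (by simp)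
  · simpa [cartan_adjacent (Adjacent.symm c1)] using
      E_Kinv_mul_F (i := .zero) (j := .zero) (k := .neg) (by simp)

theorem E_Kinv_mul_F_same (i : Edge) :
    E i * Kinv i * F i = q ^ 2 • (F i * (E i * Kinv i)) +
      (q ^ 2 * (q - q⁻¹)⁻¹) • (1 - Kinv i * Kinv i) := by
  have h : E i * F i = F i * E i + (q - q⁻¹)⁻¹ • (K i - Kinv i) := by
    rw [← E_mul_F_same]; abel
  rw [mul_assoc, Kinv_mul_F, cartan_self, mul_smul_comm, ← mul_assoc, h, add_mul, smul_mul_assoc,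
    sub_mul, K_mul_Kinv, smul_add, smul_smul, mul_assoc]
  rfl

theorem serreExpr_BZero {i j : Edge} (h1 : Edge.zero.Adjacent i) (h2 : Edge.zero.Adjacent j)
    (hi : i ≠ .zero) (hj : j ≠ .zero) :
    serreExpr q BZero (F i + E j * Kinv i) = F i + E j * Kinv i := by
  refine serreExpr_coideal_zero (h := Kinv .zero * Kinv .zero) q_ne_zero q_sq_sub_one_ne_zero
    (E_Kinv_mul_F_same _) ?_ ?_ ?_ ?_ (serreExpr_F h1)
    (serreExpr_E_Kinv h2 (cartan_adjacent h2) (cartan_adjacent (Adjacent.symm h1)))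
  · simpa [cartan_adjacent h1] using E_Kinv_mul_F (i := .zero) (j := .zero) (k := i) hi.symm
  · simpa [cartan_adjacent (Adjacent.symm h1)] using E_Kinv_mul_F (i := j) (j := i) (k := .zero) hj
  · have := mul_weight (Kinv_mul_F .zero i) (Kinv_mul_F .zero i)
    rw [cartan_adjacent h1] at this
    rw [this]; norm_num
  · have := mul_weight (Kinv_mul_E .zero j) (Kinv_mul_E .zero j)
    rw [cartan_adjacent h2] at this
    rw [← mul_assoc, this, smul_mul_assoc, mul_assoc,
      ((Kinv_commute .zero i).mul_left (Kinv_commute .zero i)).eq, ← mul_assoc]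
    norm_num

theorem serreExpr_BZero_BPos : serreExpr q BZero BPos = BPos :=
  serreExpr_BZero (by simp [Edge.Adjacent, Edge.source, Edge.target])
    (by simp [Edge.Adjacent, Edge.source, Edge.target]) (by simp) (by simp)

theorem serreExpr_BZero_BNeg : serreExpr q BZero BNeg = BNeg :=
  serreExpr_BZero (by simp [Edge.Adjacent, Edge.source, Edge.target])
    (by simp [Edge.Adjacent, Edge.source, Edge.target]) (by simp) (by simp)

theorem K_neg_mul_Kinv_pos : K .neg * Kinv .pos = DhatDia * DhatOneInv := by
  unfold K Kinv DhatDia DhatOneInv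
  rw [Commute.mul_mul_mul_comm (D_commute_Dinv _ _).symm, (Dinv_commute .negOne .one).eq]
  rfl

theorem K_pos_mul_Kinv_neg : K .pos * Kinv .neg = DhatOne * DhatDiaInv := by
  unfold K Kinv DhatOne DhatDiaInv
  rw [Commute.mul_mul_mul_comm (D_commute_Dinv _ _).symm, (D_commute .one .negOne).eq]
  rfl

/-- The edges $1$ and $-1$ are not adjacent, so the $FF$ and $EE$ contributions cancel. The two $EF$
commutators remain, and their $K_{-1}^{-1}K_1^{-1}$ terms cancel each other. -/
theorem BPos_mul_BNeg : BPos * BNeg - BNeg * BPos =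
    (q - q⁻¹)⁻¹ • (DhatDia * DhatOneInv - DhatOne * DhatDiaInv) := by
  have n1 : ¬ Edge.neg.Adjacent .pos := by simp [Edge.Adjacent, Edge.source, Edge.target]
  have n2 : ¬ Edge.pos.Adjacent .neg := by simp [Edge.Adjacent, Edge.source, Edge.target]
  have cz : cartan .neg .pos = 0 := cartan_ne (by simp) n1
  have cz' : cartan .pos .neg = 0 := cartan_ne (by simp) n2
  have h1 : E .neg * Kinv .pos * F .neg - F .neg * (E .neg * Kinv .pos) =
      (q - q⁻¹)⁻¹ • (K .neg - Kinv .neg) * Kinv .pos := by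
    rw [← E_mul_F_same, mul_assoc, Kinv_mul_F, cz', zpow_zero, one_smul, sub_mul]
    simp only [mul_assoc]
  have h2 : F .pos * (E .pos * Kinv .neg) - E .pos * Kinv .neg * F .pos =
      -((q - q⁻¹)⁻¹ • (K .pos - Kinv .pos) * Kinv .neg) := by
    rw [← E_mul_F_same, mul_assoc (E .pos), Kinv_mul_F, cz, zpow_zero, one_smul, sub_mul]
    simp only [mul_assoc]
    abel
  have h3 : E .neg * Kinv .pos * (E .pos * Kinv .neg) =
      q ^ (-2 : ℤ) • (E .neg * E .pos * (Kinv .pos * Kinv .neg)) := by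
    rw [mul_assoc, ← mul_assoc (Kinv .pos), Kinv_mul_E, cartan_self]
    simp only [smul_mul_assoc, mul_smul_comm, mul_assoc]
  have h4 : E .pos * Kinv .neg * (E .neg * Kinv .pos) =
      q ^ (-2 : ℤ) • (E .neg * E .pos * (Kinv .pos * Kinv .neg)) := by
    rw [mul_assoc, ← mul_assoc (Kinv .neg), Kinv_mul_E, cartan_self]
    simp only [smul_mul_assoc, mul_smul_comm, mul_assoc]
    rw [← mul_assoc (E .pos), (E_commute n2).eq, (Kinv_commute .neg .pos).eq, mul_assoc]
  have h5 := (F_commute n2).eq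
  rw [← K_neg_mul_Kinv_pos, ← K_pos_mul_Kinv_neg]
  calc BPos * BNeg - BNeg * BPos
      = (F .pos * F .neg - F .neg * F .pos) +
        (E .neg * Kinv .pos * (E .pos * Kinv .neg) - E .pos * Kinv .neg * (E .neg * Kinv .pos)) +
        (E .neg * Kinv .pos * F .neg - F .neg * (E .neg * Kinv .pos)) +
        (F .pos * (E .pos * Kinv .neg) - E .pos * Kinv .neg * F .pos) := by
          unfold BPos BNeg; noncomm_ring
    _ = _ := by
      rw [h1, h2, h3, h4, h5, smul_mul_assoc, smul_mul_assoc, ← smul_neg, sub_mul, sub_mul,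
        (Kinv_commute .neg .pos).eq, sub_self, sub_self, zero_add, zero_add, ← smul_add]
      congr 1
      abel

theorem mul_weight_add {A : Type*} [Ring A] [Algebra Kq A] {d x y : A} {c : Kq}
    (h : d * x = c • (x * d)) (h' : d * y = c • (y * d)) :
    d * (x + y) = c • ((x + y) * d) := by
  rw [mul_add, add_mul, h, h', smul_add]

theorem DD_mul_F (j k : Vertex) (i : Edge) :
    D j * D k * F i = q ^ (-wt i j + -wt i k) • (F i * (D j * D k)) :=
  mul_weight (D_mul_F _ _) (D_mul_F _ _)

theorem DD_mul_E_Kinv (j k : Vertex) (i l : Edge) :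
    D j * D k * (E i * Kinv l) = q ^ (wt i j + wt i k) • (E i * Kinv l * (D j * D k)) := by
  rw [← mul_assoc, mul_weight (D_mul_E _ _) (D_mul_E _ _), smul_mul_assoc, mul_assoc,
    ((D_commute_Kinv j l).mul_left (D_commute_Kinv k l)).eq, mul_assoc]

theorem DD_mul_B {j k : Vertex} {i l : Edge} (c : Kq) {n : ℤ} (h1 : -wt i j + -wt i k = n)
    (h2 : wt l j + wt l k = n) :
    D j * D k * (F i + c • (E l * Kinv i)) =
      q ^ n • ((F i + c • (E l * Kinv i)) * (D j * D k)) :=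
  mul_weight_add (h1 ▸ DD_mul_F j k i) (by
    rw [mul_smul_comm, DD_mul_E_Kinv, h2, smul_mul_assoc, smul_comm])

theorem DhatDia_mul_BNeg : DhatDia * BNeg = q⁻¹ • (BNeg * DhatDia) := by
  have := DD_mul_B (j := .dia) (k := .negDia) (i := .neg) (l := .pos) 1 (n := -1)
    (by simp [wt, Edge.source, Edge.target]) (by simp [wt, Edge.source, Edge.target])
  rwa [one_smul, zpow_neg_one] at this

theorem DhatDia_mul_BZero : DhatDia * BZero = BZero * DhatDia := by
  have := DD_mul_B (j := .dia) (k := .negDia) (i := .zero) (l := .zero) q⁻¹ (n := 0)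
    (by simp [wt, Edge.source, Edge.target]) (by simp [wt, Edge.source, Edge.target])
  rwa [zpow_zero, one_smul] at this

theorem DhatOne_mul_BNeg : DhatOne * BNeg = q • (BNeg * DhatOne) := by
  have := DD_mul_B (j := .one) (k := .negOne) (i := .neg) (l := .pos) 1 (n := 1)
    (by simp [wt, Edge.source, Edge.target]) (by simp [wt, Edge.source, Edge.target])
  rwa [one_smul, zpow_one] at this

theorem DhatOne_mul_BZero : DhatOne * BZero = BZero * DhatOne := by
  have := DD_mul_B (j := .one) (k := .negOne) (i := .zero) (l := .zero) q⁻¹ (n := 0)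
    (by simp [wt, Edge.source, Edge.target]) (by simp [wt, Edge.source, Edge.target])
  rwa [zpow_zero, one_smul] at this

theorem inv_mul_DD (j k : Vertex) : Dinv k * Dinv j * (D j * D k) = 1 := by
  rw [mul_assoc, ← mul_assoc (Dinv j), Dinv_mul_D, one_mul, Dinv_mul_D]

end Uq

/-! ### Relations inside $U_q'$ and homomorphisms out of it. -/

namespace Uq'

/-- The inverse of `D̂_◇`. -/
def DdiaInv : Uq' := ⟨Uq.DhatDiaInv, Algebra.subset_adjoin (by simp)⟩
/-- The inverse of `D̂_1`. -/
def D1Inv : Uq' := ⟨Uq.DhatOneInv, Algebra.subset_adjoin (by simp)⟩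

theorem serreExpr_Bm1_B0 : serreExpr q Bm1 B0 = 0 := Subtype.ext Uq.serreExpr_BNeg_BZero

theorem serreExpr_B0_B1 : serreExpr q B0 B1 = B1 := Subtype.ext Uq.serreExpr_BZero_BPos

theorem serreExpr_B0_Bm1 : serreExpr q B0 Bm1 = Bm1 := Subtype.ext Uq.serreExpr_BZero_BNeg

theorem B1_mul_Bm1 :
    B1 * Bm1 - Bm1 * B1 = (q - q⁻¹)⁻¹ • (Ddia * D1Inv - D1 * DdiaInv) :=
  Subtype.ext Uq.BPos_mul_BNeg

theorem Ddia_mul_Bm1 : Ddia * Bm1 = q⁻¹ • (Bm1 * Ddia) := Subtype.ext Uq.DhatDia_mul_BNeg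
theorem Ddia_mul_B0 : Ddia * B0 = B0 * Ddia := Subtype.ext Uq.DhatDia_mul_BZero
theorem D1_mul_Bm1 : D1 * Bm1 = q • (Bm1 * D1) := Subtype.ext Uq.DhatOne_mul_BNeg
theorem D1_mul_B0 : D1 * B0 = B0 * D1 := Subtype.ext Uq.DhatOne_mul_BZero
theorem DdiaInv_mul_Ddia : DdiaInv * Ddia = 1 := Subtype.ext (Uq.inv_mul_DD _ _)
theorem D1Inv_mul_D1 : D1Inv * D1 = 1 := Subtype.ext (Uq.inv_mul_DD _ _)

/-- Names for the generators of `U_q'`. -/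
inductive CGen : Type
  | B1 | Bm1 | B0 | Ddia | DdiaInv | D1 | D1Inv

/-- The generators of `U_q'`. -/
def cgen : CGen → Uq'
  | .B1 => B1
  | .Bm1 => Bm1
  | .B0 => B0
  | .Ddia => Ddia
  | .DdiaInv => DdiaInv
  | .D1 => D1
  | .D1Inv => D1Inv

/-- The projection from the free algebra on the generators. -/
def proj : FreeAlgebra Kq CGen →ₐ[Kq] Uq' := FreeAlgebra.lift Kq cgen

theorem proj_ι (g : CGen) : proj (FreeAlgebra.ι Kq g) = cgen g := FreeAlgebra.lift_ι_apply _ _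

theorem proj_surjective : Function.Surjective proj := by
  intro ⟨x, hx⟩
  have key : Uq' ≤ (proj.range).map Uq'.val := by
    refine Algebra.adjoin_le ?_
    have h : ∀ g, (cgen g : Uq) ∈ (proj.range).map Uq'.val := fun g =>
      ⟨cgen g, ⟨FreeAlgebra.ι Kq g, proj_ι g⟩, rfl⟩
    rintro y (rfl | rfl | rfl | rfl | rfl | rfl | rfl)
    exacts [h .B1, h .Bm1, h .B0, h .Ddia, h .DdiaInv, h .D1, h .D1Inv]
  obtain ⟨y, ⟨z, rfl⟩, hy⟩ := key hx
  exact ⟨z, Subtype.ext hy⟩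

/-- An algebra homomorphism from the free algebra which kills the relations of `U_q'` factors
through `U_q'`. -/
def descend {A : Type*} [Ring A] [Algebra Kq A] (f : FreeAlgebra Kq CGen →ₐ[Kq] A)
    (hf : ∀ x, proj x = 0 → f x = 0) : Uq' →ₐ[Kq] A :=
  (Ideal.Quotient.liftₐ (RingHom.ker proj) f hf).comp
    (Ideal.quotientKerAlgEquivOfSurjective proj_surjective).symm.toAlgHom

theorem descend_cgen {A : Type*} [Ring A] [Algebra Kq A] (f : FreeAlgebra Kq CGen →ₐ[Kq] A)
    (hf : ∀ x, proj x = 0 → f x = 0) (g : CGen) :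
    descend f hf (cgen g) = f (FreeAlgebra.ι Kq g) := by
  have h : (Ideal.quotientKerAlgEquivOfSurjective proj_surjective).symm (cgen g) =
      Ideal.Quotient.mk _ (FreeAlgebra.ι Kq g) := by
    rw [AlgEquiv.symm_apply_eq, ← proj_ι]
    rfl
  change Ideal.Quotient.liftₐ _ f hf
    ((Ideal.quotientKerAlgEquivOfSurjective proj_surjective).symm (cgen g)) = _
  rw [h]
  rfl

end Uq'

/-! ### Tensoring representations of `U_q'` with representations of `U_q(𝔤𝔩₄)` -/

section Coaction

variable {ι : Type} [Fintype ι] [DecidableEq ι]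

/-- The extension of scalars from `Kq` to `U_q` on matrices. -/
def scalarExt : Matrix ι ι Kq →ₐ[Kq] Matrix ι ι Uq := (Algebra.ofId Kq Uq).mapMatrix

theorem scalarExt_commute (ψ : Uq →ₐ[Kq] Matrix ι ι Kq) (x y : Uq) :
    (scalarExt.comp ψ) y * Matrix.scalarAlgHom ι Kq x =
      Matrix.scalarAlgHom ι Kq x * (scalarExt.comp ψ) y := by
  ext a b
  simp [scalarExt, Matrix.mul_diagonal, Matrix.diagonal_mul, Algebra.ofId_apply,
    Algebra.commutes]

/-- The composite of the coproduct and the representation `ψ` on the second factor. -/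
def coactionAmbient (ψ : Uq →ₐ[Kq] Matrix ι ι Kq) : Uq →ₐ[Kq] Matrix ι ι Uq :=
  coprod (Matrix.scalarAlgHom ι Kq) (scalarExt.comp ψ) (scalarExt_commute ψ)

/-- The matrix `x ⊗ Y`. -/
def pure {R : Type*} [Ring R] [Algebra Kq R] (x : R) (Y : Matrix ι ι Kq) : Matrix ι ι R :=
  Matrix.of fun a b => Y a b • x

theorem scalar_mul_scalarExt (x : Uq) (Y : Matrix ι ι Kq) :
    Matrix.scalarAlgHom ι Kq x * scalarExt Y = pure x Y := by
  ext a b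
  simp [scalarExt, Matrix.diagonal_mul, Algebra.ofId_apply, pure, Algebra.smul_def,
    Algebra.commutes]

theorem coactionAmbient_B (ψ : Uq →ₐ[Kq] Matrix ι ι Kq) (i j : Edge) (c : Kq) :
    coactionAmbient ψ (Uq.F i + c • (Uq.E j * Uq.Kinv i)) =
      pure (Uq.F i + c • (Uq.E j * Uq.Kinv i)) (ψ (Uq.Kinv i)) + pure 1 (ψ (Uq.F i)) +
        c • pure (Uq.K j * Uq.Kinv i) (ψ (Uq.E j * Uq.Kinv i)) := by
  rw [coactionAmbient, coprod_B, ← scalar_mul_scalarExt, ← scalar_mul_scalarExt,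
    ← scalar_mul_scalarExt, map_one, one_mul]
  rfl

theorem coactionAmbient_DD (ψ : Uq →ₐ[Kq] Matrix ι ι Kq) (j k : Vertex) :
    coactionAmbient ψ (Uq.D j * Uq.D k) = pure (Uq.D j * Uq.D k) (ψ (Uq.D j * Uq.D k)) := by
  rw [map_mul, coactionAmbient, coprod_D, coprod_D, commute_cross (scalarExt_commute ψ),
    ← scalar_mul_scalarExt]
  rfl

theorem coactionAmbient_DD_inv (ψ : Uq →ₐ[Kq] Matrix ι ι Kq) (j k : Vertex) :
    coactionAmbient ψ (Uq.Dinv j * Uq.Dinv k) =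
      pure (Uq.Dinv j * Uq.Dinv k) (ψ (Uq.Dinv j * Uq.Dinv k)) := by
  rw [map_mul, coactionAmbient, coprod_Dinv, coprod_Dinv, commute_cross (scalarExt_commute ψ),
    ← scalar_mul_scalarExt]
  rfl

theorem pure_mem (x : Uq') (Y : Matrix ι ι Kq) :
    pure (x : Uq) Y ∈ (Uq'.matrix : Subalgebra Kq (Matrix ι ι Uq)) :=
  fun a b => Uq'.smul_mem x.2 (Y a b)

theorem coactionAmbient_BPos (ψ : Uq →ₐ[Kq] Matrix ι ι Kq) :
    coactionAmbient ψ Uq.BPos = pure (Uq'.B1 : Uq) (ψ (Uq.Kinv .pos)) +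
      pure ((1 : Uq') : Uq) (ψ (Uq.F .pos)) +
      pure ((Uq'.Ddia * Uq'.D1Inv : Uq') : Uq) (ψ (Uq.E .neg * Uq.Kinv .pos)) := by
  have := coactionAmbient_B ψ .pos .neg 1
  rw [one_smul, one_smul, Uq.K_neg_mul_Kinv_pos] at this
  exact this

theorem coactionAmbient_BNeg (ψ : Uq →ₐ[Kq] Matrix ι ι Kq) :
    coactionAmbient ψ Uq.BNeg = pure (Uq'.Bm1 : Uq) (ψ (Uq.Kinv .neg)) +
      pure ((1 : Uq') : Uq) (ψ (Uq.F .neg)) +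
      pure ((Uq'.D1 * Uq'.DdiaInv : Uq') : Uq) (ψ (Uq.E .pos * Uq.Kinv .neg)) := by
  have := coactionAmbient_B ψ .neg .pos 1
  rw [one_smul, one_smul, Uq.K_pos_mul_Kinv_neg] at this
  exact this

theorem coactionAmbient_BZero (ψ : Uq →ₐ[Kq] Matrix ι ι Kq) :
    coactionAmbient ψ Uq.BZero = pure (Uq'.B0 : Uq) (ψ (Uq.Kinv .zero)) +
      pure ((1 : Uq') : Uq) (ψ Uq.BZero) := by
  have := coactionAmbient_B ψ .zero .zero q⁻¹
  rw [Uq.K_mul_Kinv] at this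
  refine this.trans ?_
  rw [add_assoc]
  congr 1
  ext a b
  simp [pure, Uq.BZero, add_smul, smul_smul]

/-- It suffices to look at generators, where the explicit formulas show every matrix entry to be a
scalar combination of elements of $U_q'$. This makes tensoring a $U_q'$-module with a $U_q$-module
possible. -/
theorem coactionAmbient_mem (ψ : Uq →ₐ[Kq] Matrix ι ι Kq) (x : Uq') :
    coactionAmbient ψ x ∈ (Uq'.matrix : Subalgebra Kq (Matrix ι ι Uq)) := by
  have key : Uq' ≤ (Uq'.matrix : Subalgebra Kq (Matrix ι ι Uq)).comap (coactionAmbient ψ) := by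
    refine Algebra.adjoin_le ?_
    rintro y (rfl | rfl | rfl | rfl | rfl | rfl | rfl) <;>
      simp only [Subalgebra.coe_comap, Set.mem_preimage, SetLike.mem_coe]
    · rw [coactionAmbient_BPos]
      exact add_mem (add_mem (pure_mem _ _) (pure_mem _ _)) (pure_mem _ _)
    · rw [coactionAmbient_BNeg]
      exact add_mem (add_mem (pure_mem _ _) (pure_mem _ _)) (pure_mem _ _)
    · rw [coactionAmbient_BZero]
      exact add_mem (pure_mem _ _) (pure_mem _ _)
    · rw [Uq.DhatDia, coactionAmbient_DD]
      exact pure_mem Uq'.Ddia _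
    · rw [Uq.DhatDiaInv, coactionAmbient_DD_inv]
      exact pure_mem Uq'.DdiaInv _
    · rw [Uq.DhatOne, coactionAmbient_DD]
      exact pure_mem Uq'.D1 _
    · rw [Uq.DhatOneInv, coactionAmbient_DD_inv]
      exact pure_mem Uq'.D1Inv _
  exact key x.2

/-- The coaction `U_q' → U_q' ⊗ U_q`, composed with the representation `ψ` of `U_q`. -/
def coaction (ψ : Uq →ₐ[Kq] Matrix ι ι Kq) : Uq' →ₐ[Kq] Matrix ι ι Uq' where
  toFun x := Matrix.of fun a b => ⟨coactionAmbient ψ x a b, coactionAmbient_mem ψ x a b⟩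
  map_one' := by
    ext a b
    by_cases h : a = b <;> simp [h, Matrix.one_apply]
  map_zero' := by ext a b; simp
  map_add' x y := by ext a b; simp
  map_mul' x y := by ext a b; simp [Matrix.mul_apply]
  commutes' r := by
    ext a b
    by_cases h : a = b <;> simp [h, Matrix.algebraMap_matrix_apply, AlgHom.commutes]

theorem coaction_B1 (ψ : Uq →ₐ[Kq] Matrix ι ι Kq) :
    coaction ψ Uq'.B1 = pure Uq'.B1 (ψ (Uq.Kinv .pos)) + pure 1 (ψ (Uq.F .pos)) +
      pure (Uq'.Ddia * Uq'.D1Inv) (ψ (Uq.E .neg * Uq.Kinv .pos)) := by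
  ext a b
  exact congrFun (congrFun (coactionAmbient_BPos ψ) a) b

theorem coaction_Bm1 (ψ : Uq →ₐ[Kq] Matrix ι ι Kq) :
    coaction ψ Uq'.Bm1 = pure Uq'.Bm1 (ψ (Uq.Kinv .neg)) + pure 1 (ψ (Uq.F .neg)) +
      pure (Uq'.D1 * Uq'.DdiaInv) (ψ (Uq.E .pos * Uq.Kinv .neg)) := by
  ext a b
  exact congrFun (congrFun (coactionAmbient_BNeg ψ) a) b

theorem coaction_B0 (ψ : Uq →ₐ[Kq] Matrix ι ι Kq) :
    coaction ψ Uq'.B0 = pure Uq'.B0 (ψ (Uq.Kinv .zero)) + pure 1 (ψ Uq.BZero) := by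
  ext a b
  exact congrFun (congrFun (coactionAmbient_BZero ψ) a) b

theorem coaction_Ddia (ψ : Uq →ₐ[Kq] Matrix ι ι Kq) :
    coaction ψ Uq'.Ddia = pure Uq'.Ddia (ψ Uq.DhatDia) := by
  ext a b
  exact congrFun (congrFun (coactionAmbient_DD ψ .dia .negDia) a) b

theorem coaction_D1 (ψ : Uq →ₐ[Kq] Matrix ι ι Kq) :
    coaction ψ Uq'.D1 = pure Uq'.D1 (ψ Uq.DhatOne) := by
  ext a b
  exact congrFun (congrFun (coactionAmbient_DD ψ .one .negOne) a) b

/-! ### Tensor products of $U_q'$-modules with matrix representations of $U_q$. -/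

variable {M : Type} [AddCommGroup M] [Module Kq M]

/-- The action of matrices over `U_q'` on vectors over a representation of `U_q'`. -/
def matrixAction (ρ : Uq' →ₐ[Kq] Module.End Kq M) :
    Matrix ι ι Uq' →ₐ[Kq] Module.End Kq (ι → M) :=
  (endVecAlgEquivMatrixEnd ι Kq Kq M).symm.toAlgHom.comp ρ.mapMatrix

theorem matrixAction_apply (ρ : Uq' →ₐ[Kq] Module.End Kq M) (X : Matrix ι ι Uq') (f : ι → M)
    (a : ι) : matrixAction ρ X f a = ∑ b, ρ (X a b) (f b) := rfl

theorem matrixAction_pure (ρ : Uq' →ₐ[Kq] Module.End Kq M) (x : Uq') (Y : Matrix ι ι Kq)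
    (f : ι → M) (a : ι) : matrixAction ρ (pure x Y) f a = ∑ b, Y a b • ρ x (f b) := by
  simp [matrixAction_apply, pure]

/-- The tensor product of a representation of `U_q'` with a representation of `U_q`. -/
def tensorRep (ρ : Uq' →ₐ[Kq] Module.End Kq M) (ψ : Uq →ₐ[Kq] Matrix ι ι Kq) :
    Uq' →ₐ[Kq] Module.End Kq (ι → M) :=
  (matrixAction ρ).comp (coaction ψ)

end Coaction

/-! ### One-dimensional representations and the natural representation of `U_q(𝔤𝔩₄)` -/

/-- The one-dimensional representation of `U_q` with `D_j ↦ p`. -/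
def twistGen (p : Kq) : Gen → Matrix Unit Unit Kq
  | .E _ => 0
  | .F _ => 0
  | .D _ => Matrix.of fun _ _ => p
  | .Dinv _ => Matrix.of fun _ _ => p⁻¹

theorem twistGen_rel {p : Kq} (hp : p ≠ 0) ⦃x y⦄ (h : Rel x y) :
    FreeAlgebra.lift Kq (twistGen p) x = FreeAlgebra.lift Kq (twistGen p) y := by
  cases h <;> ext a b <;> simp [twistGen, Matrix.mul_apply, hp]

/-- The one-dimensional representation of `U_q` with `D_j ↦ p`. -/
def twist {p : Kq} (hp : p ≠ 0) : Uq →ₐ[Kq] Matrix Unit Unit Kq := Uq.lift _ (twistGen_rel hp)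

/-- The basis vectors of the natural representation are indexed by the vertices. -/
instance : Fintype Vertex := ⟨{.negOne, .negDia, .dia, .one}, fun x => by cases x <;> simp⟩

theorem Vertex.sum_univ {N : Type*} [AddCommMonoid N] (f : Vertex → N) :
    ∑ j, f j = f .negOne + (f .negDia + (f .dia + f .one)) := by
  change ∑ j ∈ ({.negOne, .negDia, .dia, .one} : Finset Vertex), f j = _
  simp

/-- The natural representation of `U_q` on generators. -/
def natGen : Gen → Matrix Vertex Vertex Kq
  | .E i => Matrix.single i.source i.target 1
  | .F i => Matrix.single i.target i.source 1
  | .D j => Matrix.diagonal fun a => if a = j then q else 1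
  | .Dinv j => Matrix.diagonal fun a => if a = j then q⁻¹ else 1

theorem natGen_rel ⦃x y⦄ (h : Rel x y) :
    FreeAlgebra.lift Kq natGen x = FreeAlgebra.lift Kq natGen y := by
  have h0 := q_ne_zero
  have h1 : (q - q⁻¹)⁻¹ * (q⁻¹ - q) = -1 := by
    rw [← neg_sub q, mul_neg, inv_mul_cancel₀ q_sub_inv_ne_zero]
  cases h with
  | D_Dinv j =>
    simp only [map_mul, map_one, FreeAlgebra.lift_ι_apply, natGen, Matrix.diagonal_mul_diagonal]
    rw [← Matrix.diagonal_one]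
    congr 1
    funext a
    split_ifs <;> simp [h0]
  | Dinv_D j =>
    simp only [map_mul, map_one, FreeAlgebra.lift_ι_apply, natGen, Matrix.diagonal_mul_diagonal]
    rw [← Matrix.diagonal_one]
    congr 1
    funext a
    split_ifs <;> simp [h0]
  | D_comm j k =>
    simp only [map_mul, FreeAlgebra.lift_ι_apply, natGen, Matrix.diagonal_mul_diagonal, mul_comm]
  | D_E j i =>
    cases j <;> cases i <;> ext a b <;> cases a <;> cases b <;>
      simp [natGen, Matrix.mul_diagonal, Edge.source, Edge.target, wt]
  | D_F j i =>
    cases j <;> cases i <;> ext a b <;> cases a <;> cases b <;>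
      simp [natGen, Matrix.mul_diagonal, Edge.source, Edge.target, wt]
  | E_F_same i =>
    simp only [map_mul, map_sub, map_smul, FreeAlgebra.lift_ι_apply, natGen,
      Matrix.single_mul_single_same, Matrix.diagonal_mul_diagonal]
    cases i <;> ext a b <;> cases a <;> cases b <;>
      simp [Edge.source, Edge.target, h1, q_sub_inv_ne_zero]
  | E_F_ne i j hij =>
    simp only [map_mul, map_sub, map_zero, FreeAlgebra.lift_ι_apply, natGen]
    cases i <;> cases j <;>
      simp [Edge.source, Edge.target, Matrix.single_mul_single_of_ne] at hij ⊢
  | E_comm i j hij =>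
    simp only [map_mul, FreeAlgebra.lift_ι_apply, natGen]
    cases i <;> cases j <;>
      simp [Edge.source, Edge.target, Matrix.single_mul_single_of_ne, Edge.Adjacent] at hij ⊢
  | F_comm i j hij =>
    simp only [map_mul, FreeAlgebra.lift_ι_apply, natGen]
    cases i <;> cases j <;>
      simp [Edge.source, Edge.target, Matrix.single_mul_single_of_ne, Edge.Adjacent] at hij ⊢
  | E_serre i j hij =>
    simp only [map_mul, map_sub, map_add, map_smul, map_zero, FreeAlgebra.lift_ι_apply, natGen]
    cases i <;> cases j <;>
      simp [Edge.source, Edge.target, Matrix.single_mul_single_of_ne, Edge.Adjacent] at hij ⊢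
  | F_serre i j hij =>
    simp only [map_mul, map_sub, map_add, map_smul, map_zero, FreeAlgebra.lift_ι_apply, natGen]
    cases i <;> cases j <;>
      simp [Edge.source, Edge.target, Matrix.single_mul_single_of_ne, Edge.Adjacent] at hij ⊢

/-- The natural representation of `U_q`. -/
def natRep : Uq →ₐ[Kq] Matrix Vertex Vertex Kq := Uq.lift _ natGen_rel

theorem natRep_E (i : Edge) : natRep (Uq.E i) = Matrix.single i.source i.target 1 := by
  simp [natRep, Uq.E, Uq.lift_gen, natGen]

theorem natRep_F (i : Edge) : natRep (Uq.F i) = Matrix.single i.target i.source 1 := by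
  simp [natRep, Uq.F, Uq.lift_gen, natGen]

theorem natRep_D (j : Vertex) :
    natRep (Uq.D j) = Matrix.diagonal fun a => if a = j then q else 1 := by
  simp [natRep, Uq.D, Uq.lift_gen, natGen]

theorem natRep_Dinv (j : Vertex) :
    natRep (Uq.Dinv j) = Matrix.diagonal fun a => if a = j then q⁻¹ else 1 := by
  simp [natRep, Uq.Dinv, Uq.lift_gen, natGen]

/-- A vector with entries indexed by the vertices. -/
def vec4 {M : Type} (a b c d : M) : Vertex → M
  | .negOne => a
  | .negDia => b
  | .dia => c
  | .one => d

theorem vec4_zero {M : Type} [AddCommGroup M] : vec4 (0 : M) 0 0 0 = 0 := by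
  funext j; cases j <;> rfl

section

variable {M : Type} [AddCommGroup M] [Module Kq M] (ρ : Uq' →ₐ[Kq] Module.End Kq M)

theorem vec4_smul (r : Kq) (a b c d : M) :
    r • vec4 a b c d = vec4 (r • a) (r • b) (r • c) (r • d) := by
  funext j; cases j <;> rfl

/-- The tensor product of a representation of `U_q'` with the natural representation. -/
def natTensor : Uq' →ₐ[Kq] Module.End Kq (Vertex → M) := tensorRep ρ natRep

theorem natTensor_B1 (a b c d : M) : natTensor ρ Uq'.B1 (vec4 a b c d) =
    vec4 (q⁻¹ • ρ Uq'.B1 a) (q • ρ Uq'.B1 b + a)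
      (ρ Uq'.B1 c + ρ (Uq'.Ddia * Uq'.D1Inv) d) (ρ Uq'.B1 d) := by
  have h0 := q_ne_zero
  funext j
  simp only [natTensor, tensorRep, AlgHom.comp_apply, coaction_B1, map_add, LinearMap.add_apply,
    Pi.add_apply, matrixAction_pure, Uq.Kinv, map_mul natRep, natRep_E, natRep_F, natRep_D,
    natRep_Dinv, Vertex.sum_univ, Matrix.diagonal_mul_diagonal, Matrix.mul_diagonal]
  cases j <;> simp [vec4, Edge.source, Edge.target]

theorem natTensor_Bm1 (a b c d : M) : natTensor ρ Uq'.Bm1 (vec4 a b c d) =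
    vec4 (ρ Uq'.Bm1 a + ρ (Uq'.D1 * Uq'.DdiaInv) b) (ρ Uq'.Bm1 b)
      (q⁻¹ • ρ Uq'.Bm1 c) (q • ρ Uq'.Bm1 d + c) := by
  have h0 := q_ne_zero
  funext j
  simp only [natTensor, tensorRep, AlgHom.comp_apply, coaction_Bm1, map_add, LinearMap.add_apply,
    Pi.add_apply, matrixAction_pure, Uq.Kinv, map_mul natRep, natRep_E, natRep_F, natRep_D,
    natRep_Dinv, Vertex.sum_univ, Matrix.diagonal_mul_diagonal, Matrix.mul_diagonal]
  cases j <;> simp [vec4, Edge.source, Edge.target]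

theorem natTensor_B0 (a b c d : M) : natTensor ρ Uq'.B0 (vec4 a b c d) =
    vec4 (ρ Uq'.B0 a) (q⁻¹ • ρ Uq'.B0 b + c) (q • ρ Uq'.B0 c + b) (ρ Uq'.B0 d) := by
  have h0 := q_ne_zero
  funext j
  simp only [natTensor, tensorRep, AlgHom.comp_apply, coaction_B0, map_add, LinearMap.add_apply,
    Pi.add_apply, matrixAction_pure, Uq.BZero, Uq.Kinv, map_mul natRep, map_add natRep,
    map_smul natRep, natRep_E, natRep_F, natRep_D, Matrix.add_apply, Matrix.smul_apply,
    natRep_Dinv, Vertex.sum_univ, Matrix.diagonal_mul_diagonal, Matrix.mul_diagonal]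
  cases j <;>
    simp [vec4, Edge.source, Edge.target, h0]

theorem natTensor_Ddia (a b c d : M) : natTensor ρ Uq'.Ddia (vec4 a b c d) =
    vec4 (ρ Uq'.Ddia a) (q • ρ Uq'.Ddia b) (q • ρ Uq'.Ddia c) (ρ Uq'.Ddia d) := by
  funext j
  simp only [natTensor, tensorRep, AlgHom.comp_apply, coaction_Ddia, matrixAction_pure,
    Uq.DhatDia, map_mul natRep, natRep_D, Vertex.sum_univ, Matrix.diagonal_mul_diagonal]
  cases j <;> simp [vec4]

theorem natTensor_D1 (a b c d : M) : natTensor ρ Uq'.D1 (vec4 a b c d) =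
    vec4 (q • ρ Uq'.D1 a) (ρ Uq'.D1 b) (ρ Uq'.D1 c) (q • ρ Uq'.D1 d) := by
  funext j
  simp only [natTensor, tensorRep, AlgHom.comp_apply, coaction_D1, matrixAction_pure,
    Uq.DhatOne, map_mul natRep, natRep_D, Vertex.sum_univ, Matrix.diagonal_mul_diagonal]
  cases j <;> simp [vec4]

/-- The tensor product of a representation of `U_q'` with the one-dimensional representation
`D_j ↦ p` of `U_q`, on the same space. -/
def twistTensor {p : Kq} (hp : p ≠ 0) : Uq' →ₐ[Kq] Module.End Kq (Unit → M) :=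
  tensorRep ρ (twist hp)

theorem twist_E {p : Kq} (hp : p ≠ 0) (i : Edge) : twist hp (Uq.E i) = 0 := by
  simp [twist, Uq.E, Uq.lift_gen, twistGen]

theorem twist_F {p : Kq} (hp : p ≠ 0) (i : Edge) : twist hp (Uq.F i) = 0 := by
  simp [twist, Uq.F, Uq.lift_gen, twistGen]

theorem twist_D {p : Kq} (hp : p ≠ 0) (j : Vertex) :
    twist hp (Uq.D j) = Matrix.of fun _ _ => p := by
  simp [twist, Uq.D, Uq.lift_gen, twistGen]

theorem twist_Kinv {p : Kq} (hp : p ≠ 0) (i : Edge) : twist hp (Uq.Kinv i) = 1 := by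
  ext a b
  simp [twist, Uq.Kinv, Uq.D, Uq.Dinv, Uq.lift_gen, twistGen, Matrix.mul_apply, hp]

theorem twistTensor_B1 {p : Kq} (hp : p ≠ 0) (v : M) :
    twistTensor ρ hp Uq'.B1 (fun _ => v) = fun _ => ρ Uq'.B1 v := by
  funext j
  simp [twistTensor, tensorRep, coaction_B1, matrixAction_pure, twist_Kinv, twist_E, twist_F]

theorem twistTensor_Bm1 {p : Kq} (hp : p ≠ 0) (v : M) :
    twistTensor ρ hp Uq'.Bm1 (fun _ => v) = fun _ => ρ Uq'.Bm1 v := by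
  funext j
  simp [twistTensor, tensorRep, coaction_Bm1, matrixAction_pure, twist_Kinv, twist_E, twist_F]

theorem twistTensor_B0 {p : Kq} (hp : p ≠ 0) (v : M) :
    twistTensor ρ hp Uq'.B0 (fun _ => v) = fun _ => ρ Uq'.B0 v := by
  funext j
  simp [twistTensor, tensorRep, coaction_B0, matrixAction_pure, twist_Kinv, twist_E, twist_F,
    Uq.BZero]

theorem twistTensor_Ddia {p : Kq} (hp : p ≠ 0) (v : M) :
    twistTensor ρ hp Uq'.Ddia (fun _ => v) = fun _ => (p * p) • ρ Uq'.Ddia v := by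
  funext j
  simp [twistTensor, tensorRep, coaction_Ddia, matrixAction_pure, twist_D, Uq.DhatDia,
    Matrix.mul_apply]

theorem twistTensor_D1 {p : Kq} (hp : p ≠ 0) (v : M) :
    twistTensor ρ hp Uq'.D1 (fun _ => v) = fun _ => (p * p) • ρ Uq'.D1 v := by
  funext j
  simp [twistTensor, tensorRep, coaction_D1, matrixAction_pure, twist_D, Uq.DhatOne,
    Matrix.mul_apply]

end

/-! ### Brackets -/

/-- The bracket `[x] = (x - x⁻¹) / (q - q⁻¹)`. -/
def br {K : Type*} [Field K] (q x : K) : K := (x - x⁻¹) / (q - q⁻¹)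

theorem qbr_eq_br (μ : Kq) (n : ℤ) : qbr μ n = br q (q ^ n * μ) := by
  rw [qbr, br, mul_inv, zpow_neg]

theorem qint_eq_br (n : ℤ) : qint n = br q (q ^ n) := by
  rw [qint, br, zpow_neg]

section

variable {K : Type*} [Field K] {q x : K}

theorem br_mul_q (h0 : q ≠ 0) (h2 : q ^ 2 - 1 ≠ 0) (hx : x ≠ 0) :
    br q (q * x) = q⁻¹ * br q x + x := by
  have : q - q⁻¹ ≠ 0 := by
    intro h; apply h2; field_simp at h; linear_combination h
  unfold br
  rw [div_eq_iff this, add_mul, mul_assoc, div_mul_cancel₀ _ this]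
  field_simp
  ring

theorem br_mul_q' (h0 : q ≠ 0) (h2 : q ^ 2 - 1 ≠ 0) (hx : x ≠ 0) :
    br q (q * x) = q * br q x + x⁻¹ := by
  have : q - q⁻¹ ≠ 0 := by
    intro h; apply h2; field_simp at h; linear_combination h
  unfold br
  rw [div_eq_iff this, add_mul, mul_assoc, div_mul_cancel₀ _ this]
  field_simp
  ring

/-- The fibres of $x\mapsto[x]$ are the pairs $\{x,-x^{-1}\}$. The second factor is where goodness
enters whenever eigenvalues of $B_0$ are compared. -/
theorem br_inj (h0 : q ≠ 0) (h2 : q ^ 2 - 1 ≠ 0) {y : K} (hx : x ≠ 0) (hy : y ≠ 0)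
    (h : br q x = br q y) : (x - y) * (x * y + 1) = 0 := by
  have : q - q⁻¹ ≠ 0 := by
    intro h; apply h2; field_simp at h; linear_combination h
  unfold br at h
  rw [div_left_inj' this] at h
  field_simp at h
  linear_combination h

end

theorem vec4_congr {M : Type} {a b c d a' b' c' d' : M} (ha : a = a') (hb : b = b') (hc : c = c')
    (hd : d = d') : vec4 a b c d = vec4 a' b' c' d' := by
  rw [ha, hb, hc, hd]

theorem vec4_sub {M : Type} [AddCommGroup M] (a b c d a' b' c' d' : M) :
    vec4 a b c d - vec4 a' b' c' d' = vec4 (a - a') (b - b') (c - c') (d - d') := by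
  funext j; cases j <;> rfl

/-! ### Characters of `U_q'` -/

/-- There is a vector spanning a one-dimensional submodule of some representation of `U_q'`, on
which `B_0` acts by `[μ]`, `D̂_◇` and `D̂_1` act by `c` and `B_{±1}` by `0`. -/
def HasCharacter (μ c : Kq) : Prop :=
  ∃ (M : Type) (_ : AddCommGroup M) (_ : Module Kq M) (ρ : Uq' →ₐ[Kq] Module.End Kq M) (v : M),
    v ≠ 0 ∧ ρ Uq'.B1 v = 0 ∧ ρ Uq'.Bm1 v = 0 ∧ ρ Uq'.B0 v = br q μ • v ∧
      ρ Uq'.Ddia v = c • v ∧ ρ Uq'.D1 v = c • v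

section

variable {M : Type} [AddCommGroup M] [Module Kq M] {ρ : Uq' →ₐ[Kq] Module.End Kq M}

theorem inv_eigen {x y : Uq'} (h : y * x = 1) {v : M} {c : Kq} (hc : c ≠ 0)
    (hv : ρ x v = c • v) : ρ y v = c⁻¹ • v := by
  have := congrArg (fun z => ρ z v) h
  simp only [map_mul, map_one, Module.End.mul_apply, Module.End.one_apply, hv, map_smul] at this
  rw [← this, smul_smul, inv_mul_cancel₀ hc, one_smul, this]

end

/-- This is the counit restricted to $U_q'$. -/
theorem hasCharacter_one : HasCharacter 1 1 := by
  let f : Gen → Kq := fun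
    | .E _ => 0
    | .F _ => 0
    | .D _ => 1
    | .Dinv _ => 1
  have hf : ∀ ⦃x y⦄, Rel x y → FreeAlgebra.lift Kq f x = FreeAlgebra.lift Kq f y := by
    intro x y h
    cases h <;> simp [f]
  let φ : Uq' →ₐ[Kq] Module.End Kq Kq :=
    (Algebra.lsmul Kq Kq Kq).comp ((Uq.lift _ hf).comp Uq'.val)
  refine ⟨Kq, inferInstance, inferInstance, φ, 1, one_ne_zero, ?_, ?_, ?_, ?_, ?_⟩ <;>
    simp [φ, Uq'.B1, Uq'.Bm1, Uq'.B0, Uq'.Ddia, Uq'.D1, Uq.BPos, Uq.BNeg, Uq.BZero, Uq.DhatDia,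
      Uq.DhatOne, Uq.E, Uq.F, Uq.D, Uq.lift_gen, f, br]

theorem HasCharacter.twist {μ c p : Kq} (h : HasCharacter μ c) (hp : p ≠ 0) :
    HasCharacter μ (p * p * c) := by
  obtain ⟨M, _, _, ρ, v, hv, h1, h2, h3, h4, h5⟩ := h
  refine ⟨Unit → M, inferInstance, inferInstance, twistTensor ρ hp, fun _ => v,
    fun h => hv (congrFun h ()), ?_, ?_, ?_, ?_, ?_⟩
  · rw [twistTensor_B1, h1]; rfl
  · rw [twistTensor_Bm1, h2]; rfl
  · rw [twistTensor_B0, h3]; rfl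
  · rw [twistTensor_Ddia, h4, smul_smul]; rfl
  · rw [twistTensor_D1, h5, smul_smul]; rfl

/-- Tensoring twice with the natural representation recovers a character: the first tensor product
contains a plane exchanged by $B_{\pm1}$, and the second contains a vector in which these exchanges
cancel. -/
theorem HasCharacter.step {μ c : Kq} (h : HasCharacter μ c) (hμ : μ ≠ 0) (hc : c ≠ 0) :
    HasCharacter (q * μ) (q * c) := by
  have h0 := q_ne_zero
  have e1 := br_mul_q h0 q_sq_sub_one_ne_zero hμ
  have e2 := br_mul_q' h0 q_sq_sub_one_ne_zero hμ
  obtain ⟨M, _, _, ρ, v, hv, h1, h2, h3, h4, h5⟩ := h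
  have hqc : q * c ≠ 0 := mul_ne_zero h0 hc
  have h4' := inv_eigen Uq'.DdiaInv_mul_Ddia hc h4
  have h5' := inv_eigen Uq'.D1Inv_mul_D1 hc h5
  -- These span a stable plane: $B_1$ sends `b` to `a`, $B_{-1}$ sends `a` to `b`, and $B_0$ acts on
  -- them by $[q\mu]$ and $[\mu]$.
  set a := vec4 0 v (μ • v) 0 with ha
  set b := vec4 v 0 0 (μ • v) with hb
  have a1 : natTensor ρ Uq'.B1 a = 0 := by
    rw [ha, natTensor_B1]; simp [h1, vec4_zero]
  have b1 : natTensor ρ Uq'.B1 b = a := by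
    rw [hb, natTensor_B1]; simp [h1, h4, h5', smul_smul, hc, ha]
  have a2 : natTensor ρ Uq'.Bm1 a = b := by
    rw [ha, natTensor_Bm1]; simp [h2, h4', h5, smul_smul, hc, hb]
  have b2 : natTensor ρ Uq'.Bm1 b = 0 := by
    rw [hb, natTensor_Bm1]; simp [h2, vec4_zero]
  have a3 : natTensor ρ Uq'.B0 a = br q (q * μ) • a := by
    rw [ha, natTensor_B0, vec4_smul]
    simp only [map_zero, smul_zero, h3, map_smul, smul_smul, ← add_smul]
    refine vec4_congr rfl (by rw [e1]) ?_ rfl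
    nth_rw 2 [← one_smul Kq v]
    rw [← add_smul, e2]
    congr 1
    field_simp
  have b3 : natTensor ρ Uq'.B0 b = br q μ • b := by
    rw [hb, natTensor_B0, vec4_smul]
    simp [h3, smul_smul, mul_comm]
  have a4 : natTensor ρ Uq'.Ddia a = (q * c) • a := by
    rw [ha, natTensor_Ddia, vec4_smul]
    simp [h4, smul_smul, mul_comm, mul_left_comm]
  have b4 : natTensor ρ Uq'.Ddia b = c • b := by
    rw [hb, natTensor_Ddia, vec4_smul]
    simp [h4, smul_smul, mul_comm]
  have a5 : natTensor ρ Uq'.D1 a = c • a := by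
    rw [ha, natTensor_D1, vec4_smul]
    simp [h5, smul_smul, mul_comm]
  have b5 : natTensor ρ Uq'.D1 b = (q * c) • b := by
    rw [hb, natTensor_D1, vec4_smul]
    simp [h5, smul_smul, mul_comm, mul_left_comm]
  have a5' := inv_eigen Uq'.D1Inv_mul_D1 hc a5
  have b4' := inv_eigen Uq'.DdiaInv_mul_Ddia hc b4
  clear_value a b
  -- The four coefficients are chosen so that both $B_1$ and $B_{-1}$ kill the vector; $B_0$ then
  -- acts by $[q\mu]$.
  refine ⟨Vertex → Vertex → M, inferInstance, inferInstance, natTensor (natTensor ρ),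
    vec4 a (-q⁻¹ • b) (-(μ * q⁻¹) • b) ((μ * (q⁻¹ * q⁻¹)) • a), ?_, ?_, ?_, ?_, ?_, ?_⟩
  · intro h
    have h' : a = 0 := congrFun h .negOne
    rw [ha] at h'
    exact hv (congrFun h' .negDia)
  · rw [natTensor_B1]
    simp only [map_smul, a1, b1, map_mul, Module.End.mul_apply, a5', a4, smul_smul, smul_zero]
    refine (vec4_congr rfl ?_ ?_ rfl).trans vec4_zero
    · rw [mul_neg, mul_inv_cancel₀ h0, neg_one_smul, neg_add_cancel]
    · rw [← add_smul]
      convert zero_smul Kq a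
      field_simp
      ring
  · rw [natTensor_Bm1]
    simp only [map_smul, a2, b2, map_mul, Module.End.mul_apply, b5, b4', smul_smul, smul_zero]
    refine (vec4_congr ?_ rfl rfl ?_).trans vec4_zero
    · nth_rw 1 [← one_smul Kq b]
      rw [← add_smul]
      convert zero_smul Kq b
      field_simp
      ring
    · rw [← add_smul]
      convert zero_smul Kq b
      field_simp
      ring
  · rw [natTensor_B0, vec4_smul]
    simp only [map_smul, a3, b3, smul_smul, ← add_smul]
    refine vec4_congr rfl ?_ ?_ ?_ <;> congr 1
    · rw [e1]; ring
    · rw [e2]; field_simp; ring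
    · ring
  · rw [natTensor_Ddia, vec4_smul]
    simp only [map_smul, a4, b4, smul_smul]
    refine vec4_congr ?_ ?_ ?_ ?_ <;> congr 1 <;> ring
  · rw [natTensor_D1, vec4_smul]
    simp only [map_smul, a5, b5, smul_smul]
    refine vec4_congr ?_ ?_ ?_ ?_ <;> congr 1 <;> ring

theorem hasCharacter_pow (n : ℕ) : HasCharacter (q ^ n) (q ^ n) := by
  induction n with
  | zero => simpa using hasCharacter_one
  | succ n ih =>
    rw [pow_succ']
    exact ih.step (pow_ne_zero _ q_ne_zero) (pow_ne_zero _ q_ne_zero)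

/-- Twisting by $D_j\mapsto p$ rescales both $\hat D$'s by $p^2$, so only even exponents can be
normalised to $1$ in this way. -/
theorem hasCharacter_even (n : ℕ) : HasCharacter (q ^ (2 * n)) 1 := by
  have h := (hasCharacter_pow (2 * n)).twist (p := (q ^ n)⁻¹)
    (inv_ne_zero (pow_ne_zero _ q_ne_zero))
  have h0 : q ^ n ≠ 0 := pow_ne_zero _ q_ne_zero
  convert h using 1
  rw [two_mul, pow_add]
  field_simp

/-- The universal family of characters of `U_q'` with `D̂_◇` and `D̂_1` acting by `1`. -/
def charGen : Uq'.CGen → Polynomial Kq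
  | .B1 => 0
  | .Bm1 => 0
  | .B0 => Polynomial.X
  | .Ddia => 1
  | .DdiaInv => 1
  | .D1 => 1
  | .D1Inv => 1

/-- On a vector spanning a character, an element of the free algebra acts by evaluating one
polynomial, independent of the module, at the eigenvalue of $B_0$. Relations of $U_q'$ thereby
become vanishing conditions on polynomials. -/
theorem charGen_eval {M : Type} [AddCommGroup M] [Module Kq M]
    {ρ : Uq' →ₐ[Kq] Module.End Kq M} {v : M} {β : Kq} (h1 : ρ Uq'.B1 v = 0)
    (h2 : ρ Uq'.Bm1 v = 0) (h3 : ρ Uq'.B0 v = β • v) (h4 : ρ Uq'.Ddia v = (1 : Kq) • v)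
    (h5 : ρ Uq'.D1 v = (1 : Kq) • v) (x : FreeAlgebra Kq Uq'.CGen) :
    ρ (Uq'.proj x) v = (FreeAlgebra.lift Kq charGen x).eval β • v := by
  have h4' := inv_eigen Uq'.DdiaInv_mul_Ddia one_ne_zero h4
  have h5' := inv_eigen Uq'.D1Inv_mul_D1 one_ne_zero h5
  induction x using FreeAlgebra.induction with
  | grade0 r => simp [AlgHom.commutes, Module.algebraMap_end_apply]
  | grade1 g =>
    rw [Uq'.proj_ι]
    cases g <;> simp [charGen, Uq'.cgen, h1, h2, h3, h4, h5, h4', h5']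
  | mul x y hx hy => simp [hx, hy, smul_smul, mul_comm]
  | add x y hx hy => simp [hx, hy, add_smul]

/-- The polynomial attached to a relation has the infinitely many roots $[q^{2n}]$, because
characters with these $B_0$-eigenvalues exist. Hence $B_0$ may take any value in a character. -/
theorem charGen_eq_zero (x : FreeAlgebra Kq Uq'.CGen) (hx : Uq'.proj x = 0) :
    FreeAlgebra.lift Kq charGen x = 0 := by
  apply Polynomial.eq_zero_of_infinite_isRoot
  refine Set.infinite_of_injective_forall_mem (f := fun n : ℕ => br q (q ^ (2 * n))) ?_ ?_
  · intro m n h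
    have h0 := q_ne_zero
    rcases mul_eq_zero.mp (br_inj h0 q_sq_sub_one_ne_zero (pow_ne_zero _ h0) (pow_ne_zero _ h0) h)
      with h | h
    · have : (2 * m : ℤ) = (2 * n : ℤ) := by
        apply q_zpow_injective
        simp only
        exact_mod_cast sub_eq_zero.mp h
      omega
    · exfalso
      have h' : q ^ (2 * m + 2 * n) = -1 := by rw [pow_add]; linear_combination h
      -- The other branch of `br_inj` would make a power of $q$ equal to $-1$; squaring forces the
      -- exponent to be zero, hence $1=-1$.
      have h2 : q ^ (2 * (2 * m + 2 * n)) = 1 := by rw [mul_comm, pow_mul, h']; norm_num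
      have h3 : 2 * (2 * m + 2 * n) = 0 := by
        by_contra hne
        exact q_pow_ne_one hne h2
      have h4 : 2 * m + 2 * n = 0 := by omega
      rw [h4, pow_zero] at h'
      have : (1 : Kq) + 1 = 0 := by linear_combination h'
      norm_num at this
  · intro n
    obtain ⟨M, _, _, ρ, v, hv, h1, h2, h3, h4, h5⟩ := hasCharacter_even n
    have := charGen_eval h1 h2 h3 h4 h5 x
    rw [hx, map_zero, LinearMap.zero_apply, eq_comm, smul_eq_zero] at this
    exact this.resolve_right hv

theorem hasCharacter_trivial_weight (μ : Kq) : HasCharacter μ 1 := by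
  let φ : Uq' →ₐ[Kq] Module.End Kq Kq := (Algebra.lsmul Kq Kq Kq).comp
    ((Polynomial.aeval (br q μ)).comp
      (Uq'.descend (FreeAlgebra.lift Kq charGen) charGen_eq_zero))
  have h : ∀ g, φ (Uq'.cgen g) 1 = (charGen g).eval (br q μ) := fun g => by
    simp [φ, Uq'.descend_cgen, Polynomial.coe_aeval_eq_eval]
  refine ⟨Kq, inferInstance, inferInstance, φ, 1, one_ne_zero, ?_, ?_, ?_, ?_, ?_⟩
  · exact (h .B1).trans (by simp [charGen])
  · exact (h .Bm1).trans (by simp [charGen])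
  · exact (h .B0).trans (by simp [charGen])
  · exact (h .Ddia).trans (by simp [charGen])
  · exact (h .D1).trans (by simp [charGen])

/-- Twists reach only even `k`. For odd `k` one application of `HasCharacter.step`, started at
$q^{-1}\mu$, corrects the parity. -/
theorem hasCharacter (μ : Kq) (hμ : μ ≠ 0) (k : ℤ) : HasCharacter μ (q ^ k) := by
  have h0 := q_ne_zero
  obtain ⟨j, rfl | rfl⟩ := Int.even_or_odd' k
  · have := (hasCharacter_trivial_weight μ).twist (zpow_ne_zero j h0)
    rwa [mul_one, ← zpow_add₀ h0, ← two_mul] at this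
  · have := (hasCharacter_trivial_weight (q⁻¹ * μ)).twist (zpow_ne_zero j h0)
    rw [mul_one, ← zpow_add₀ h0, ← two_mul] at this
    have := this.step (mul_ne_zero (inv_ne_zero h0) hμ) (zpow_ne_zero _ h0)
    rwa [mul_inv_cancel_left₀ h0, ← zpow_one_add₀ h0, add_comm] at this

/-! ### Highest weight vectors -/

/-- The value of `ζ` for the highest weight with parameters `s`, `t` and `μ`. -/
def zetaST (s t : ℤ) (μ : Kq) : Kq := br q (q ^ (t - s) * μ) - q ^ (-s - t) * br q μ

/-- `v` is a highest weight vector with `κ_1 = k1`, `κ_◇ = k1 + s + t`, `B_0` acting by `[μ]` and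
`Z` acting by `zetaST s t μ`. -/
structure IsHW {M : Type} [AddCommGroup M] [Module Kq M] (ρ : Uq' →ₐ[Kq] Module.End Kq M)
    (v : M) (k1 s t : ℤ) (μ : Kq) : Prop where
  B1 : ρ Uq'.B1 v = 0
  B0 : ρ Uq'.B0 v = br q μ • v
  Ddia : ρ Uq'.Ddia v = q ^ (k1 + s + t) • v
  D1 : ρ Uq'.D1 v = q ^ k1 • v
  Z : ρ Uq'.Z v = zetaST s t μ • v

section

variable {M : Type} [AddCommGroup M] [Module Kq M] {ρ : Uq' →ₐ[Kq] Module.End Kq M}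

theorem B1_Bm1_apply {w : M} {a b : ℤ} (h1 : ρ Uq'.Ddia w = q ^ a • w)
    (h2 : ρ Uq'.D1 w = q ^ b • w) :
    ρ Uq'.B1 (ρ Uq'.Bm1 w) = ρ Uq'.Bm1 (ρ Uq'.B1 w) + br q (q ^ (a - b)) • w := by
  have h0 := q_ne_zero
  have h1' := inv_eigen Uq'.DdiaInv_mul_Ddia (zpow_ne_zero a h0) h1
  have h2' := inv_eigen Uq'.D1Inv_mul_D1 (zpow_ne_zero b h0) h2
  have := congrArg (fun z => ρ z w) Uq'.B1_mul_Bm1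
  simp only [map_sub, map_mul, map_smul, LinearMap.sub_apply, Module.End.mul_apply,
    LinearMap.smul_apply, h1, h2, h1', h2', smul_smul, ← sub_smul] at this
  rw [← sub_eq_iff_eq_add', this]
  congr 1
  rw [br, zpow_sub₀ h0]
  field_simp

theorem Y_apply {w : M} {c : Kq} (h : ρ Uq'.B0 w = c • w) :
    ρ Uq'.Y w = ρ Uq'.B0 (ρ Uq'.Bm1 w) - (q⁻¹ * c) • ρ Uq'.Bm1 w := by
  simp [Uq'.Y, Uq'.comm, h, smul_smul]

theorem Z_apply {w : M} (h : ρ Uq'.B1 w = 0) : ρ Uq'.Z w = ρ Uq'.B1 (ρ Uq'.Y w) := by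
  simp [Uq'.Z, Uq'.comm, h]

theorem IsHW.B1_Bm1 {v : M} {k1 s t : ℤ} {μ : Kq} (h : IsHW ρ v k1 s t μ) :
    ρ Uq'.B1 (ρ Uq'.Bm1 v) = br q (q ^ (s + t)) • v := by
  rw [B1_Bm1_apply h.Ddia h.D1, h.B1, map_zero, zero_add]
  congr 4
  ring

theorem IsHW.B1_B0_Bm1 {v : M} {k1 s t : ℤ} {μ : Kq} (h : IsHW ρ v k1 s t μ) :
    ρ Uq'.B1 (ρ Uq'.B0 (ρ Uq'.Bm1 v)) =
      (zetaST s t μ + q⁻¹ * br q μ * br q (q ^ (s + t))) • v := by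
  have := h.Z
  rw [Z_apply h.B1, Y_apply h.B0, map_sub, map_smul, h.B1_Bm1, smul_smul,
    sub_eq_iff_eq_add] at this
  rw [this, add_smul]

/-- On the middle two components $B_0$ acts by a $2\times2$ matrix; `h1` and `h2` say that `(1, y)`
is an eigenvector of it. The remaining two hypotheses record how $\hat D_\diamondsuit$ and $Z$
change. -/
theorem IsHW.tensor {v : M} {k1 s t s' t' : ℤ} {μ μ' y : Kq} (h : IsHW ρ v k1 s t μ)
    (h1 : q⁻¹ * br q μ + y = br q μ') (h2 : q * y * br q μ + 1 = y * br q μ')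
    (hst : s' + t' = s + t + 1)
    (hz : zetaST s' t' μ' = zetaST s t μ + q ^ (-s - t) * (br q μ - q⁻¹ * br q μ')) :
    IsHW (natTensor ρ) (vec4 0 v (y • v) 0) k1 s' t' μ' := by
  have h0 := q_ne_zero
  have B1' : natTensor ρ Uq'.B1 (vec4 0 v (y • v) 0) = 0 := by
    rw [natTensor_B1]; simp [h.B1, vec4_zero]
  have B0' : natTensor ρ Uq'.B0 (vec4 0 v (y • v) 0) = br q μ' • vec4 0 v (y • v) 0 := by
    rw [natTensor_B0, vec4_smul]
    simp only [h.B0, map_zero, smul_zero, map_smul, smul_smul, ← add_smul, h1]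
    congr 1
    nth_rw 2 [← one_smul Kq v]
    rw [← add_smul, ← h2.trans (mul_comm _ _)]
    congr 1
    ring
  refine ⟨B1', B0', ?_, ?_, ?_⟩
  · rw [natTensor_Ddia, vec4_smul]
    simp only [h.Ddia, map_zero, smul_zero, map_smul, smul_smul]
    rw [show k1 + s' + t' = 1 + (k1 + s + t) by rw [add_assoc, hst]; ring, zpow_one_add₀ h0]
    congr 2
    ring
  · rw [natTensor_D1, vec4_smul]
    simp only [h.D1, map_zero, smul_zero, map_smul, smul_smul, mul_comm]
  · have hi := inv_eigen Uq'.DdiaInv_mul_Ddia (zpow_ne_zero _ h0) h.Ddia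
    have hi' := inv_eigen Uq'.D1Inv_mul_D1 (zpow_ne_zero _ h0) h.D1
    have hqi : q * q⁻¹ = 1 := mul_inv_cancel₀ h0
    have e3 : (q ^ (k1 + s + t))⁻¹ * q ^ k1 = q ^ (-s - t) := by
      rw [← zpow_neg, ← zpow_add₀ h0]
      congr 1
      ring
    have e4 : (q ^ k1)⁻¹ * q ^ (k1 + s + t) = q ^ (s + t) := by
      rw [← zpow_neg, ← zpow_add₀ h0]
      congr 1
      ring
    have e5 : br q (q ^ (s + t)) * (q - q⁻¹) = q ^ (s + t) - q ^ (-s - t) := by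
      rw [br, div_mul_cancel₀ _ q_sub_inv_ne_zero, ← zpow_neg]
      congr 2
      ring
    rw [Z_apply B1', Y_apply B0', natTensor_Bm1, natTensor_B0, vec4_smul, vec4_sub,
      natTensor_B1, vec4_smul]
    simp only [h.B1, h.B0, h.B1_Bm1, h.B1_B0_Bm1, hi, hi', h.D1, h.Ddia, map_zero, smul_zero, map_smul,
      smul_smul, zero_add, map_add, map_sub, map_mul, Module.End.mul_apply,
      ← add_smul, ← sub_smul, hz]
    refine vec4_congr rfl ?_ ?_ rfl
    · congr 1
      linear_combination (zetaST s t μ + (q⁻¹ * br q μ + y - br q μ') * br q (q ^ (s + t))) * hqi +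
        br q (q ^ (s + t)) * h1 + (br q μ - q⁻¹ * br q μ') * e3
    · congr 1
      linear_combination (y * (zetaST s t μ + q⁻¹ * br q μ * br q (q ^ (s + t))) +
        -(y * br q μ' * br q (q ^ (s + t)))) * hqi +
        br q (q ^ (s + t)) * h2 + (y * br q μ - q⁻¹ * br q μ' * y) * (e4 - e5)

end

/-- There is a highest weight vector with the given parameters. -/
def HasHW (k1 s t : ℤ) (μ : Kq) : Prop :=
  ∃ (M : Type) (_ : AddCommGroup M) (_ : Module Kq M) (ρ : Uq' →ₐ[Kq] Module.End Kq M) (v : M),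
    v ≠ 0 ∧ IsHW ρ v k1 s t μ

theorem hasHW_zero (k1 : ℤ) {μ : Kq} (hμ : μ ≠ 0) : HasHW k1 0 0 μ := by
  obtain ⟨M, _, _, ρ, v, hv, h1, h2, h3, h4, h5⟩ := hasCharacter μ hμ k1
  refine ⟨M, _, _, ρ, v, hv, h1, h3, by simpa using h4, h5, ?_⟩
  rw [Z_apply h1, Y_apply h3, h2]
  simp [zetaST]

theorem HasHW.succ_left {k1 s t : ℤ} {μ : Kq} (hμ : μ ≠ 0) (h : HasHW k1 s t μ) :
    HasHW k1 (s + 1) t (q * μ) := by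
  obtain ⟨M, _, _, ρ, v, hv, h⟩ := h
  have h0 := q_ne_zero
  have e1 := br_mul_q h0 q_sq_sub_one_ne_zero hμ
  have e2 := br_mul_q' h0 q_sq_sub_one_ne_zero hμ
  refine ⟨_, _, _, _, _, fun h => hv (congrFun h .negDia),
    h.tensor (y := μ) e1.symm ?_ (by ring) ?_⟩
  · rw [e2]; field_simp
  · rw [zetaST, zetaST, show q ^ (t - (s + 1)) * (q * μ) = q ^ (t - s) * μ by
      rw [← mul_assoc, ← zpow_add_one₀ h0]; ring_nf,
      show q ^ (-(s + 1) - t) = q ^ (-s - t) * q⁻¹ by rw [← zpow_sub_one₀ h0]; ring_nf]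
    ring

/-- This uses the other eigenvector of the $2\times2$ matrix: with $x=q\mu$ the slope is $-x^{-1}$
and the eigenvalue is $[q^{-1}x]$, whereas `HasHW.succ_left` uses slope $\mu$ and eigenvalue
$[q\mu]$. -/
theorem HasHW.succ_right {k1 s t : ℤ} {μ : Kq} (hμ : μ ≠ 0) (h : HasHW k1 s t (q * μ)) :
    HasHW k1 s (t + 1) μ := by
  obtain ⟨M, _, _, ρ, v, hv, h⟩ := h
  have h0 := q_ne_zero
  have e1 := br_mul_q h0 q_sq_sub_one_ne_zero hμ
  have e2 := br_mul_q' h0 q_sq_sub_one_ne_zero hμ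
  refine ⟨_, _, _, _, _, fun h => hv (congrFun h .negDia),
    h.tensor (y := -(q⁻¹ * μ⁻¹)) ?_ ?_ (by ring) ?_⟩
  · rw [e2]; field_simp; ring
  · rw [e1]; field_simp; ring
  · rw [zetaST, zetaST, show q ^ (t + 1 - s) * μ = q ^ (t - s) * (q * μ) by
      rw [← mul_assoc, ← zpow_add_one₀ h0]; ring_nf,
      show q ^ (-s - (t + 1)) = q ^ (-s - t) * q⁻¹ by rw [← zpow_sub_one₀ h0]; ring_nf]
    ring

/-- Steps in `s` multiply $\mu$ by $q$ and steps in `t` divide it by $q$. Since characters exist for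
every nonzero $\mu$, the starting value can be shifted to arrive at the prescribed one. -/
theorem hasHW (k1 : ℤ) (s t : ℕ) {μ : Kq} (hμ : μ ≠ 0) : HasHW k1 s t μ := by
  have h0 := q_ne_zero
  induction s generalizing μ with
  | zero =>
    induction t generalizing μ with
    | zero => exact hasHW_zero k1 hμ
    | succ t ih => exact_mod_cast (ih (mul_ne_zero h0 hμ)).succ_right hμ
  | succ s ih =>
    have := (ih (mul_ne_zero (inv_ne_zero h0) hμ)).succ_left (mul_ne_zero (inv_ne_zero h0) hμ)
    rw [mul_inv_cancel_left₀ h0] at this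
    exact_mod_cast this

/-! ### Ladder operators

We study three operators `T`, `b`, `c` (playing the roles of `B_0`, `B_{-1}`, `B_1`) subject to the
relations between them that hold in `U_q'`. -/

section Ladder

variable {K : Type*} [Field K] {M : Type*} [AddCommGroup M] [Module K M]

/-- The symmetric bracket `{x} = x + x⁻¹`. -/
def cu (x : K) : K := x + x⁻¹

/-- `x_{m,n} = μ q^{n-m}`. -/
def xx (q μ : K) (m n : ℕ) : K := μ * q ^ n / q ^ m

/-- The coefficient of `B_1` in the first direction, where `A = q^m`. -/
def gam (q S T μ A : K) : K :=
  br q A * br q (q * S / A) * cu (μ / A) * cu (q * T * μ / A)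

/-- The coefficient of `B_1` in the second direction, where `B = q^n`. -/
def del (q S T μ B : K) : K :=
  br q B * br q (q * T / B) * cu (μ * B) * cu (μ * B / (q * S))

variable {q : K}

theorem gam_one (S T μ : K) : gam q S T μ 1 = 0 := by simp [gam, br]

theorem del_one (S T μ : K) : del q S T μ 1 = 0 := by simp [del, br]

/-- With $A=q^m$ and $B=q^n$ this is the coefficient of $v_{m,n}$ in the relation for $[B_1,B_{-1}]$
applied to $v_{m,n}$. -/
theorem gam_del_identity (h0 : q ≠ 0) (h2 : q ^ 2 - 1 ≠ 0) {S T μ A B : K} (hS : S ≠ 0)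
    (hT : T ≠ 0) (hμ : μ ≠ 0) (hA : A ≠ 0) (hB : B ≠ 0) :
    (gam q S T μ (q * A) - del q S T μ B) * cu (q * (μ * B / A)) +
      (del q S T μ (q * B) - gam q S T μ A) * cu (q⁻¹ * (μ * B / A)) =
    br q (S * T / (A * B) ^ 2) * cu (μ * B / A) * cu (q * (μ * B / A)) *
      cu (q⁻¹ * (μ * B / A)) := by
  unfold gam del br cu
  field_simp
  ring

variable (q) in
/-- The relations between `B_0`, `B_{±1}` used below. -/
structure IsLadder (T b c : M →ₗ[K] M) : Prop where
  Tb : ∀ w, T (T (b w)) - (q + q⁻¹) • T (b (T w)) + b (T (T w)) = b w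
  Tc : ∀ w, T (T (c w)) - (q + q⁻¹) • T (c (T w)) + c (T (T w)) = c w
  bT : ∀ w, b (b (T w)) - (q + q⁻¹) • b (T (b w)) + T (b (b w)) = 0

variable (q) in
/-- The operator `Y = [T, b]_{q⁻¹}`. -/
def opY (T b : M →ₗ[K] M) (w : M) : M := T (b w) - q⁻¹ • b (T w)

variable (q) in
/-- The first ladder operator on eigenvectors with parameter `x`. -/
def opP (T b : M →ₗ[K] M) (x : K) (w : M) : M := x • b w - opY q T b w

variable (q) in
/-- The second ladder operator on eigenvectors with parameter `x`. -/
def opQ (T b : M →ₗ[K] M) (x : K) (w : M) : M := x⁻¹ • b w + opY q T b w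

variable (q) in
/-- The vectors obtained from `v` by the two ladder operators. -/
def vv (T b : M →ₗ[K] M) (μ : K) (v : M) : ℕ → ℕ → M
  | 0, 0 => v
  | 0, n + 1 => opQ q T b (xx q μ 0 n) (vv T b μ v 0 n)
  | m + 1, n => opP q T b (xx q μ m n) (vv T b μ v m n)

variable {T b c : M →ₗ[K] M}

/-- On an eigenvector the operator `opP` is $[qx]-T$ applied to $bw$, so it removes the
$[qx]$-component and keeps the $[q^{-1}x]$-component; `opQ` does the opposite. -/
theorem opP_eq (h0 : q ≠ 0) (h2 : q ^ 2 - 1 ≠ 0) {x : K} (hx : x ≠ 0) {w : M}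
    (hw : T w = br q x • w) : opP q T b x w = br q (q * x) • b w - T (b w) := by
  rw [opP, opY, hw, map_smul, br_mul_q h0 h2 hx]
  module

theorem opQ_eq (h0 : q ≠ 0) (h2 : q ^ 2 - 1 ≠ 0) {x : K} (hx : x ≠ 0) {w : M}
    (hw : T w = br q x • w) : opQ q T b x w = T (b w) - br q (q⁻¹ * x) • b w := by
  have h := br_mul_q' (x := q⁻¹ * x) h0 h2 (mul_ne_zero (inv_ne_zero h0) hx)
  rw [mul_inv_cancel_left₀ h0] at h
  rw [opQ, opY, hw, map_smul, h]
  match_scalars <;> field_simp <;> ring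

theorem br_add_br (h0 : q ≠ 0) (h2 : q ^ 2 - 1 ≠ 0) {x : K} (hx : x ≠ 0) :
    br q (q * x) + br q (q⁻¹ * x) = (q + q⁻¹) * br q x := by
  unfold br; field_simp; ring

theorem br_mul_br (h0 : q ≠ 0) (h2 : q ^ 2 - 1 ≠ 0) {x : K} (hx : x ≠ 0) :
    br q (q * x) * br q (q⁻¹ * x) = br q x ^ 2 - 1 := by
  unfold br; field_simp; ring

/-- The cubic relation, applied to an eigenvector, is quadratic in $T$ and has the two neighbouring
eigenvalues as its roots. It serves for `c` as well as for `b`. -/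
theorem ladder_quadratic (h0 : q ≠ 0) (h2 : q ^ 2 - 1 ≠ 0) {x : K} (hx : x ≠ 0) {w : M}
    (hT : ∀ w, T (T (b w)) - (q + q⁻¹) • T (b (T w)) + b (T (T w)) = b w)
    (hw : T w = br q x • w) : T (T (b w)) =
      (br q (q * x) + br q (q⁻¹ * x)) • T (b w) - (br q (q * x) * br q (q⁻¹ * x)) • b w := by
  have h := hT w
  simp only [hw, map_smul, smul_smul] at h
  rw [br_add_br h0 h2 hx, br_mul_br h0 h2 hx]
  linear_combination (norm := module) h

theorem opP_eigen (h0 : q ≠ 0) (h2 : q ^ 2 - 1 ≠ 0) (hL : IsLadder q T b c) {x : K} (hx : x ≠ 0)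
    {w : M} (hw : T w = br q x • w) :
    T (opP q T b x w) = br q (q⁻¹ * x) • opP q T b x w := by
  rw [opP_eq h0 h2 hx hw, map_sub, map_smul, ladder_quadratic h0 h2 hx hL.Tb hw]
  module

theorem opQ_eigen (h0 : q ≠ 0) (h2 : q ^ 2 - 1 ≠ 0) (hL : IsLadder q T b c) {x : K} (hx : x ≠ 0)
    {w : M} (hw : T w = br q x • w) :
    T (opQ q T b x w) = br q (q * x) • opQ q T b x w := by
  rw [opQ_eq h0 h2 hx hw, map_sub, map_smul, ladder_quadratic h0 h2 hx hL.Tb hw]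
  module

/-- The difference of the two sides is $-(x+x^{-1})$ times the Serre relation `bT`. Commutativity
makes the ladder vectors a grid, independent of the path. -/
theorem opP_opQ (h0 : q ≠ 0) (h2 : q ^ 2 - 1 ≠ 0) (hL : IsLadder q T b c) {x : K} (hx : x ≠ 0)
    {w : M} (hw : T w = br q x • w) :
    opP q T b (q * x) (opQ q T b x w) = opQ q T b (q⁻¹ * x) (opP q T b x w) := by
  have hqx : q * x ≠ 0 := mul_ne_zero h0 hx
  have hqx' : q⁻¹ * x ≠ 0 := mul_ne_zero (inv_ne_zero h0) hx
  rw [opP_eq h0 h2 hqx (opQ_eigen h0 h2 hL hx hw), opQ_eq h0 h2 hqx' (opP_eigen h0 h2 hL hx hw),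
    opP_eq h0 h2 hx hw, opQ_eq h0 h2 hx hw]
  have h := hL.bT w
  simp only [hw, map_smul, map_sub] at h ⊢
  linear_combination (norm := skip) (-(x + x⁻¹)) • h
  match_scalars <;> (try unfold br) <;> field_simp <;> ring

theorem xx_ne_zero (h0 : q ≠ 0) {μ : K} (hμ : μ ≠ 0) (m n : ℕ) : xx q μ m n ≠ 0 :=
  div_ne_zero (mul_ne_zero hμ (pow_ne_zero _ h0)) (pow_ne_zero _ h0)

theorem xx_succ_left (q μ : K) (m n : ℕ) : xx q μ (m + 1) n = q⁻¹ * xx q μ m n := by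
  rw [xx, xx, pow_succ, ← div_div]
  ring

theorem xx_succ_right (q μ : K) (m n : ℕ) : xx q μ m (n + 1) = q * xx q μ m n := by
  rw [xx, xx, pow_succ]
  ring

/-! ### The grid of ladder vectors. -/

variable {μ : K} {v : M}

theorem T_vv (h0 : q ≠ 0) (h2 : q ^ 2 - 1 ≠ 0) (hL : IsLadder q T b c) (hμ : μ ≠ 0)
    (hv : T v = br q μ • v) (m n : ℕ) :
    T (vv q T b μ v m n) = br q (xx q μ m n) • vv q T b μ v m n := by
  induction m with
  | zero =>
    induction n with
    | zero => simpa [vv, xx] using hv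
    | succ n ih =>
      rw [vv, opQ_eigen h0 h2 hL (xx_ne_zero h0 hμ _ _) ih, xx_succ_right]
  | succ m ih => rw [vv, opP_eigen h0 h2 hL (xx_ne_zero h0 hμ _ _) ih, xx_succ_left]

theorem opQ_vv (h0 : q ≠ 0) (h2 : q ^ 2 - 1 ≠ 0) (hL : IsLadder q T b c) (hμ : μ ≠ 0)
    (hv : T v = br q μ • v) (m n : ℕ) :
    opQ q T b (xx q μ m n) (vv q T b μ v m n) = vv q T b μ v m (n + 1) := by
  induction m with
  | zero => rw [vv]
  | succ m ih =>
    rw [vv, xx_succ_left, ← opP_opQ h0 h2 hL (xx_ne_zero h0 hμ _ _) (T_vv h0 h2 hL hμ hv _ _), ih,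
      vv, xx_succ_right]

/-- The sum of the two ladder operators is $(x+x^{-1})\,b$, so `b` is recovered exactly when
$x+x^{-1}\ne0$. -/
theorem b_vv (h0 : q ≠ 0) (h2 : q ^ 2 - 1 ≠ 0) (hL : IsLadder q T b c) (hμ : μ ≠ 0)
    (hv : T v = br q μ • v) {m n : ℕ} (hg : cu (xx q μ m n) ≠ 0) :
    b (vv q T b μ v m n) =
      (cu (xx q μ m n))⁻¹ • (vv q T b μ v (m + 1) n + vv q T b μ v m (n + 1)) := by
  rw [eq_inv_smul_iff₀ hg, ← opQ_vv h0 h2 hL hμ hv, vv, opP, opQ, cu]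
  module

theorem opY_vv (h0 : q ≠ 0) (h2 : q ^ 2 - 1 ≠ 0) (hL : IsLadder q T b c) (hμ : μ ≠ 0)
    (hv : T v = br q μ • v) {m n : ℕ} (hg : cu (xx q μ m n) ≠ 0) :
    opY q T b (vv q T b μ v m n) = (cu (xx q μ m n))⁻¹ •
      (xx q μ m n • vv q T b μ v m (n + 1) - (xx q μ m n)⁻¹ • vv q T b μ v (m + 1) n) := by
  have hx := xx_ne_zero h0 hμ m n
  rw [eq_inv_smul_iff₀ hg, ← opQ_vv h0 h2 hL hμ hv, vv, opP, opQ, cu]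
  match_scalars <;> field_simp <;> ring

/-- The expected value of `c (vv m n)`. -/
def lower (q S T' : K) (T b : M →ₗ[K] M) (μ : K) (v : M) (m n : ℕ) : M :=
  (cu (xx q μ m n))⁻¹ • (gam q S T' μ (q ^ m) • vv q T b μ v (m - 1) n +
    del q S T' μ (q ^ n) • vv q T b μ v m (n - 1))

/-! ### The lowering operator on the grid. -/

section Lowering

variable {S T' : K} (h0 : q ≠ 0) (hq : ∀ n : ℕ, n ≠ 0 → q ^ n ≠ 1) (hL : IsLadder q T b c)
  (hμ : μ ≠ 0) (hv : T v = br q μ • v) (hg : ∀ l : ℤ, cu (q ^ l * μ) ≠ 0)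

theorem sq_sub_one_ne_zero (hq : ∀ n : ℕ, n ≠ 0 → q ^ n ≠ 1) : q ^ 2 - 1 ≠ 0 := fun h =>
  hq 2 two_ne_zero (sub_eq_zero.mp h)

include h0 in
theorem xx_eq_zpow (m n : ℕ) : xx q μ m n = q ^ ((n : ℤ) - m) * μ := by
  rw [xx, zpow_sub₀ h0, zpow_natCast, zpow_natCast]
  ring

include h0 hg in
theorem cu_xx_ne_zero (m n : ℕ) : cu (xx q μ m n) ≠ 0 := by
  rw [xx_eq_zpow h0]; exact hg _

include h0 hq hL hμ hv hg in
-- The truncated index `m - 1` is harmless, since the coefficient vanishes at `m = 0`. The same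
-- device is used in the next three statements.
theorem gam_smul_b_vv (m n : ℕ) : gam q S T' μ (q ^ m) • b (vv q T b μ v (m - 1) n) =
    (gam q S T' μ (q ^ m) * (cu (q * xx q μ m n))⁻¹) •
      (vv q T b μ v m n + vv q T b μ v (m - 1) (n + 1)) := by
  cases m with
  | zero => simp [gam_one]
  | succ m =>
    rw [xx_succ_left, mul_inv_cancel_left₀ h0, Nat.add_sub_cancel,
      b_vv h0 (sq_sub_one_ne_zero hq) hL hμ hv (cu_xx_ne_zero h0 hg _ _), smul_smul]

include h0 hq hL hμ hv hg in
theorem del_smul_b_vv (m n : ℕ) : del q S T' μ (q ^ n) • b (vv q T b μ v m (n - 1)) =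
    (del q S T' μ (q ^ n) * (cu (q⁻¹ * xx q μ m n))⁻¹) •
      (vv q T b μ v (m + 1) (n - 1) + vv q T b μ v m n) := by
  cases n with
  | zero => simp [del_one]
  | succ n =>
    rw [xx_succ_right, inv_mul_cancel_left₀ h0, Nat.add_sub_cancel,
      b_vv h0 (sq_sub_one_ne_zero hq) hL hμ hv (cu_xx_ne_zero h0 hg _ _), smul_smul]

include h0 hq hL hμ hv in
theorem T_gam_smul (m n : ℕ) : T (gam q S T' μ (q ^ m) • vv q T b μ v (m - 1) n) =
    br q (q * xx q μ m n) • (gam q S T' μ (q ^ m) • vv q T b μ v (m - 1) n) := by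
  cases m with
  | zero => simp [gam_one]
  | succ m =>
    rw [xx_succ_left, mul_inv_cancel_left₀ h0, Nat.add_sub_cancel, map_smul,
      T_vv h0 (sq_sub_one_ne_zero hq) hL hμ hv, smul_comm]

include h0 hq hL hμ hv in
theorem T_del_smul (m n : ℕ) : T (del q S T' μ (q ^ n) • vv q T b μ v m (n - 1)) =
    br q (q⁻¹ * xx q μ m n) • (del q S T' μ (q ^ n) • vv q T b μ v m (n - 1)) := by
  cases n with
  | zero => simp [del_one]
  | succ n =>
    rw [xx_succ_right, inv_mul_cancel_left₀ h0, Nat.add_sub_cancel, map_smul,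
      T_vv h0 (sq_sub_one_ne_zero hq) hL hμ hv, smul_comm]

include h0 hq hL hμ hv hg in
-- The proposed values satisfy the recursion that the commutator of `c` and `b` imposes on `c`. Only
-- the coefficient of $v_{m,n}$ is not immediate, and there `gam_del_identity` is needed.
theorem lower_add_lower (hS : S ≠ 0) (hT' : T' ≠ 0) (m n : ℕ) :
    lower q S T' T b μ v (m + 1) n + lower q S T' T b μ v m (n + 1) =
      cu (xx q μ m n) • (b (lower q S T' T b μ v m n) +
        br q (S * T' / (q ^ (m + n)) ^ 2) • vv q T b μ v m n) := by
  have h1 := cu_xx_ne_zero h0 hg m n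
  have h2 : cu (q * xx q μ m n) ≠ 0 := by
    rw [← xx_succ_right]; exact cu_xx_ne_zero h0 hg _ _
  have h3 : cu (q⁻¹ * xx q μ m n) ≠ 0 := by
    rw [← xx_succ_left]; exact cu_xx_ne_zero h0 hg _ _
  have key := gam_del_identity h0 (sq_sub_one_ne_zero hq) hS hT' hμ (pow_ne_zero m h0)
    (pow_ne_zero n h0)
  rw [← pow_add, ← pow_succ', ← pow_succ'] at key
  change _ * cu (q * xx q μ m n) + _ * cu (q⁻¹ * xx q μ m n) =
    _ * cu (xx q μ m n) * cu (q * xx q μ m n) * cu (q⁻¹ * xx q μ m n) at key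
  rw [lower, lower, lower, map_smul, map_add, map_smul, map_smul,
    gam_smul_b_vv h0 hq hL hμ hv hg, del_smul_b_vv h0 hq hL hμ hv hg, Nat.add_sub_cancel,
    Nat.add_sub_cancel, xx_succ_left, xx_succ_right]
  generalize cu (xx q μ m n) = y1 at *
  generalize cu (q * xx q μ m n) = y2 at *
  generalize cu (q⁻¹ * xx q μ m n) = y3 at *
  match_scalars
  · field_simp
    linear_combination key
  · field_simp
  · field_simp

include h0 hq hL hμ hv in
-- The two summands of `lower` have $T$-eigenvalues $[qx]$ and $[q^{-1}x]$, so they satisfy the same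
-- quadratic equation as $c\,v_{m,n}$ does by `ladder_quadratic`.
theorem lower_killed (m n : ℕ) :
    T (T (lower q S T' T b μ v m n)) =
      (br q (q * xx q μ m n) + br q (q⁻¹ * xx q μ m n)) • T (lower q S T' T b μ v m n) -
      (br q (q * xx q μ m n) * br q (q⁻¹ * xx q μ m n)) • lower q S T' T b μ v m n := by
  have hG := T_gam_smul (S := S) (T' := T') h0 hq hL hμ hv m n
  have hD := T_del_smul (S := S) (T' := T') h0 hq hL hμ hv m n
  rw [lower]
  generalize gam q S T' μ (q ^ m) • vv q T b μ v (m - 1) n = G at *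
  generalize del q S T' μ (q ^ n) • vv q T b μ v m (n - 1) = D at *
  simp only [map_smul, map_add, hG, hD]
  module

/-- Two quadratic polynomials in $T$ without a common root are coprime, so no nonzero vector is
killed by both. -/
theorem eq_zero_of_killed {w : M} {a₁ a₂ b₁ b₂ : K}
    (h1 : T (T w) = (a₁ + a₂) • T w - (a₁ * a₂) • w)
    (h2 : T (T w) = (b₁ + b₂) • T w - (b₁ * b₂) • w)
    (h11 : a₁ ≠ b₁) (h12 : a₁ ≠ b₂) (h21 : a₂ ≠ b₁) (h22 : a₂ ≠ b₂) : w = 0 := by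
  have e : ∀ (z : M) (a : K), T (T z) = (b₁ + b₂) • T z - (b₁ * b₂) • z → T z = a • z →
      a ≠ b₁ → a ≠ b₂ → z = 0 := by
    intro z a hz ha h1 h2
    rw [ha, map_smul, ha] at hz
    have : ((a - b₁) * (a - b₂)) • z = 0 := by
      linear_combination (norm := module) hz
    exact (smul_eq_zero.mp this).resolve_left
      (mul_ne_zero (sub_ne_zero.mpr h1) (sub_ne_zero.mpr h2))
  have hy : T w - a₂ • w = 0 := by
    apply e _ a₁ _ _ h11 h12
    · have := congrArg T h2
      simp only [map_sub, map_smul] at this ⊢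
      linear_combination (norm := module) this - a₂ • h2
    · simp only [map_sub, map_smul]
      linear_combination (norm := module) h1
  exact e w a₂ h2 (sub_eq_zero.mp hy) h21 h22

include h0 hq hμ hg in
-- Equal brackets mean either a trivial power of $q$ or $\mu^2q^{j-i}=-1$. Since $j-i$ is even, the
-- latter says $(q^k\mu)^2=-1$, which goodness excludes.
theorem br_ne_br {i j : ℕ} {k : ℤ} (hk : (j : ℤ) - i = 2 * k) (hij : i + j ≠ 0) :
    br q (μ / q ^ i) ≠ br q (μ * q ^ j) := by
  intro h
  have hi : q ^ i ≠ 0 := pow_ne_zero _ h0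
  have hj : q ^ j ≠ 0 := pow_ne_zero _ h0
  rcases mul_eq_zero.mp (br_inj h0 (sq_sub_one_ne_zero hq) (div_ne_zero hμ hi)
    (mul_ne_zero hμ hj) h) with h | h
  · apply hq _ hij
    rw [div_sub' hi, div_eq_zero_iff, or_iff_left hi] at h
    rw [pow_add]
    apply mul_left_cancel₀ hμ
    linear_combination -h
  · apply hg k
    have h' : μ / q ^ i * (μ * q ^ j) = (q ^ k * μ) ^ 2 := by
      rw [mul_pow, ← zpow_natCast (q ^ k), ← zpow_mul, mul_comm k, Nat.cast_two, ← hk,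
        zpow_sub₀ h0, zpow_natCast, zpow_natCast]
      ring
    rw [h'] at h
    have hne : q ^ k * μ ≠ 0 := mul_ne_zero (zpow_ne_zero _ h0) hμ
    rw [cu]
    field_simp at h ⊢
    linear_combination h

include h0 hq hL hμ hv hg in
/-- The action of the lowering operator on the vectors `vv m n`. -/
theorem c_vv (hS : S ≠ 0) (hT' : T' ≠ 0) (hcv : c v = 0)
    (hcb : ∀ m n, c (b (vv q T b μ v m n)) = b (c (vv q T b μ v m n)) +
      br q (S * T' / (q ^ (m + n)) ^ 2) • vv q T b μ v m n)
    (hz : c (opY q T b v) = (br q (T' / S * μ) - (S * T')⁻¹ * br q μ) • v) (m n : ℕ) :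
    c (vv q T b μ v m n) = lower q S T' T b μ v m n := by
  have h2 := sq_sub_one_ne_zero hq
  induction hN : m + n generalizing m n with
  | zero =>
    obtain ⟨rfl, rfl⟩ : m = 0 ∧ n = 0 := by omega
    simp [vv, lower, hcv, gam_one, del_one]
  | succ N ih =>
    set err : ℕ → ℕ → M := fun m n => c (vv q T b μ v m n) - lower q S T' T b μ v m n with herr
    -- The recursion coming from $b\,v_{m,n}$ determines only a sum of two neighbours, so along an
    -- antidiagonal all errors agree up to sign.
    have hsum : ∀ m n, m + n = N → err (m + 1) n = -err m (n + 1) := by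
      intro m n hmn
      have e1 := hcb m n
      rw [b_vv h0 h2 hL hμ hv (cu_xx_ne_zero h0 hg _ _), map_smul, map_add, ih m n hmn,
        inv_smul_eq_iff₀ (cu_xx_ne_zero h0 hg _ _),
        ← lower_add_lower h0 hq hL hμ hv hg hS hT'] at e1
      simp only [herr]
      linear_combination (norm := module) e1
    have hkill : ∀ m n, T (T (err m n)) =
        (br q (q * xx q μ m n) + br q (q⁻¹ * xx q μ m n)) • T (err m n) -
        (br q (q * xx q μ m n) * br q (q⁻¹ * xx q μ m n)) • err m n := by
      intro m n
      simp only [herr, map_sub, lower_killed h0 hq hL hμ hv,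
        ladder_quadratic h0 h2 (xx_ne_zero h0 hμ m n) hL.Tc (T_vv h0 h2 hL hμ hv m n)]
      module
    have hzero : err 0 (N + 1) = 0 := by
      rcases Nat.eq_zero_or_pos N with rfl | hpos
      -- On the first antidiagonal the two quadratics share the root $[\mu]$, so coprimality fails.
      -- The eigenvalue of $Z$ supplies a second linear equation, leading to
      -- $(\mu+\mu^{-1})\,\mathrm{err}_{0,1}=0$.
      · have e1 : err 1 0 = -err 0 1 := hsum 0 0 rfl
        have hy := opY_vv h0 h2 hL hμ hv (cu_xx_ne_zero h0 hg 0 0)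
        have hcu := cu_xx_ne_zero h0 hg 0 0
        have hx : xx q μ 0 0 = μ := by simp [xx]
        have hvv : vv q T b μ v 0 0 = v := by rw [vv]
        rw [hx] at hcu hy
        rw [hvv] at hy
        rw [hy, map_smul, map_sub, map_smul, map_smul, inv_smul_eq_iff₀ hcu] at hz
        have hz' : μ • lower q S T' T b μ v 0 1 - μ⁻¹ • lower q S T' T b μ v 1 0 =
            cu μ • (br q (T' / S * μ) - (S * T')⁻¹ * br q μ) • v := by
          have c1 : cu (q * μ) ≠ 0 := by simpa using hg 1
          have c2 : cu (q⁻¹ * μ) ≠ 0 := by simpa using hg (-1)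
          have x1 : xx q μ 0 1 = q * μ := by simp [xx, mul_comm]
          have x2 : xx q μ 1 0 = q⁻¹ * μ := by simp [xx, div_eq_inv_mul]
          rw [lower, lower, x1, x2]
          simp only [pow_zero, pow_one, gam_one, del_one, zero_smul, zero_add, add_zero, hvv,
            Nat.sub_self, smul_smul, ← sub_smul]
          congr 1
          have key : μ * del q S T' μ q * cu (q⁻¹ * μ) - μ⁻¹ * gam q S T' μ q * cu (q * μ) =
              cu μ * (br q (T' / S * μ) - (S * T')⁻¹ * br q μ) * cu (q * μ) * cu (q⁻¹ * μ) := by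
            unfold gam del br cu
            field_simp
            ring
          generalize cu (q * μ) = y₁ at *
          generalize cu (q⁻¹ * μ) = y₂ at *
          field_simp at key ⊢
          linear_combination key
        have e2 : cu μ • err 0 1 = 0 := by
          simp only [herr] at e1 ⊢
          rw [cu]
          linear_combination (norm := module) hz - hz' + μ⁻¹ • e1
        exact (smul_eq_zero.mp e2).resolve_left hcu
      -- Being equal up to sign, all errors satisfy the quadratic of the end $(0,N+1)$. At the
      -- opposite end $(N+1,0)$ this meets a quadratic with disjoint roots, so the error is zero.
      · have hall : ∀ k n, k + n = N + 1 → T (T (err k n)) =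
            (br q (μ * q ^ (N + 2)) + br q (μ * q ^ N)) • T (err k n) -
            (br q (μ * q ^ (N + 2)) * br q (μ * q ^ N)) • err k n := by
          intro k
          induction k with
          | zero =>
            intro n hn
            obtain rfl : n = N + 1 := by omega
            have := hkill 0 (N + 1)
            rw [← xx_succ_right q μ 0 (N + 1), xx_succ_right q μ 0 N,
              inv_mul_cancel_left₀ h0] at this
            simpa [xx] using this
          | succ k ih =>
            intro n hn
            have := ih (n + 1) (by omega)
            rw [hsum k n (by omega), map_neg, map_neg, this]
            module
        have hlast := hkill (N + 1) 0
        rw [← xx_succ_left, xx_succ_left, mul_inv_cancel_left₀ h0] at hlast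
        simp only [xx, pow_zero, mul_one] at hlast
        have hlast0 : err (N + 1) 0 = 0 := by
          refine eq_zero_of_killed hlast (hall (N + 1) 0 rfl) ?_ ?_ ?_ ?_
          · exact br_ne_br h0 hq hμ hg (k := 1) (by push_cast; ring) (by omega)
          · exact br_ne_br h0 hq hμ hg (k := 0) (by push_cast; ring) (by omega)
          · exact br_ne_br h0 hq hμ hg (k := 0) (by push_cast; ring) (by omega)
          · exact br_ne_br h0 hq hμ hg (k := -1) (by push_cast; ring) (by omega)
        have hback : ∀ k n, k + n = N + 1 → err k n = 0 → err 0 (N + 1) = 0 := by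
          intro k
          induction k with
          | zero =>
            intro n hn h
            obtain rfl : n = N + 1 := by omega
            exact h
          | succ k ih =>
            intro n hn h
            rw [hsum k n (by omega), neg_eq_zero] at h
            exact ih (n + 1) (by omega) h
        exact hback (N + 1) 0 rfl hlast0
    have hfin : ∀ k n, k + n = N + 1 → err k n = 0 := by
      intro k
      induction k with
      | zero =>
        intro n hn
        obtain rfl : n = N + 1 := by omega
        exact hzero
      | succ k ih =>
        intro n hn
        rw [hsum k n (by omega), ih (n + 1) (by omega), neg_zero]
    exact sub_eq_zero.mp (hfin m n hN)

end Lowering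

end Ladder

/-! ### Ladders from highest weight vectors -/

theorem q_pow_ne_one' : ∀ n : ℕ, n ≠ 0 → q ^ n ≠ 1 := fun _ => q_pow_ne_one

section HighestWeight

variable {M : Type} [AddCommGroup M] [Module Kq M] {ρ : Uq' →ₐ[Kq] Module.End Kq M}

theorem serreExpr_apply (x y : Uq') (w : M) : ρ (serreExpr q x y) w =
    ρ x (ρ x (ρ y w)) - (q + q⁻¹) • ρ x (ρ y (ρ x w)) + ρ y (ρ x (ρ x w)) := by
  simp only [serreExpr, map_add, map_sub, map_smul, map_mul, LinearMap.add_apply,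
    LinearMap.sub_apply, LinearMap.smul_apply, Module.End.mul_apply]

theorem isLadder : IsLadder q (ρ Uq'.B0) (ρ Uq'.Bm1) (ρ Uq'.B1) where
  Tb w := by rw [← serreExpr_apply, Uq'.serreExpr_B0_Bm1]
  Tc w := by rw [← serreExpr_apply, Uq'.serreExpr_B0_B1]
  bT w := by
    rw [← serreExpr_apply, Uq'.serreExpr_Bm1_B0, map_zero, LinearMap.zero_apply]

theorem opY_eq (w : M) : opY q (ρ Uq'.B0) (ρ Uq'.Bm1) w = ρ Uq'.Y w := by
  simp [opY, Uq'.Y, Uq'.comm]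

variable (ρ) in
/-- The vectors `v_{m,n}` obtained from `v` by the ladder operators. -/
def wv (μ : Kq) (v : M) (m n : ℕ) : M := vv q (ρ Uq'.B0) (ρ Uq'.Bm1) μ v m n

theorem skew_comm_apply {x y : Uq'} {r : Kq} (h : x * y = r • (y * x)) {w : M} {a : Kq}
    (hw : ρ x w = a • w) : ρ x (ρ y w) = (a * r) • ρ y w := by
  rw [← Module.End.mul_apply, ← map_mul, h, map_smul, map_mul, LinearMap.smul_apply,
    Module.End.mul_apply, hw, map_smul, smul_smul, mul_comm]

theorem opY_weight {x : Uq'} {r : Kq} (h : x * Uq'.Bm1 = r • (Uq'.Bm1 * x))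
    (h' : x * Uq'.B0 = Uq'.B0 * x) {w : M} {a : Kq} (hw : ρ x w = a • w) :
    ρ x (opY q (ρ Uq'.B0) (ρ Uq'.Bm1) w) =
      (a * r) • opY q (ρ Uq'.B0) (ρ Uq'.Bm1) w := by
  have h'' : x * Uq'.B0 = (1 : Kq) • (Uq'.B0 * x) := by rw [h', one_smul]
  have e1 := skew_comm_apply h'' (skew_comm_apply h hw)
  have e2 := skew_comm_apply h (skew_comm_apply h'' hw)
  rw [mul_one] at e1 e2
  rw [opY, map_sub, map_smul, e1, e2, smul_sub, smul_comm]

theorem wv_weight {x : Uq'} {r : Kq} (h : x * Uq'.Bm1 = r • (Uq'.Bm1 * x))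
    (h' : x * Uq'.B0 = Uq'.B0 * x) {v : M} {a : Kq} (hv : ρ x v = a • v) (μ : Kq) (m n : ℕ) :
    ρ x (wv ρ μ v m n) = (a * r ^ (m + n)) • wv ρ μ v m n := by
  induction m with
  | zero =>
    induction n with
    | zero => simpa [wv, vv] using hv
    | succ n ih =>
      rw [wv] at ih ⊢
      rw [vv, opQ, map_add, map_smul, skew_comm_apply h ih, opY_weight h h' ih, smul_comm,
        ← smul_add, mul_assoc, ← pow_succ, add_assoc]
  | succ m ih =>
    rw [wv] at ih ⊢
    rw [vv, opP, map_sub, map_smul, skew_comm_apply h ih, opY_weight h h' ih, smul_comm,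
      ← smul_sub, mul_assoc, ← pow_succ, add_right_comm]

namespace IsHW

variable {v : M} {k1 s t : ℤ} {μ : Kq} (h : IsHW ρ v k1 s t μ) (hμ : μ ≠ 0)
  (hg : ∀ l : ℤ, cu (q ^ l * μ) ≠ 0)

include h in
theorem Ddia_wv (m n : ℕ) : ρ Uq'.Ddia (wv ρ μ v m n) =
    q ^ (k1 + s + t - (m + n)) • wv ρ μ v m n := by
  rw [wv_weight Uq'.Ddia_mul_Bm1 Uq'.Ddia_mul_B0 h.Ddia, inv_pow, ← zpow_natCast,
    ← zpow_neg, ← zpow_add₀ q_ne_zero]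
  push_cast
  rfl

include h in
theorem D1_wv (m n : ℕ) : ρ Uq'.D1 (wv ρ μ v m n) = q ^ (k1 + (m + n)) • wv ρ μ v m n := by
  rw [wv_weight Uq'.D1_mul_Bm1 Uq'.D1_mul_B0 h.D1, ← zpow_natCast, ← zpow_add₀ q_ne_zero]
  push_cast
  rfl

include h in
theorem DdiaInv_wv (m n : ℕ) : ρ Uq'.DdiaInv (wv ρ μ v m n) =
    (q ^ (k1 + s + t - (m + n)))⁻¹ • wv ρ μ v m n :=
  inv_eigen Uq'.DdiaInv_mul_Ddia (zpow_ne_zero _ q_ne_zero) (h.Ddia_wv m n)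

include h in
theorem D1Inv_wv (m n : ℕ) : ρ Uq'.D1Inv (wv ρ μ v m n) =
    (q ^ (k1 + (m + n)))⁻¹ • wv ρ μ v m n :=
  inv_eigen Uq'.D1Inv_mul_D1 (zpow_ne_zero _ q_ne_zero) (h.D1_wv m n)

include h hμ in
theorem B0_wv (m n : ℕ) : ρ Uq'.B0 (wv ρ μ v m n) = br q (xx q μ m n) • wv ρ μ v m n :=
  T_vv q_ne_zero q_sq_sub_one_ne_zero isLadder hμ h.B0 m n

include h hμ hg in
theorem Bm1_wv (m n : ℕ) : ρ Uq'.Bm1 (wv ρ μ v m n) =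
    (cu (xx q μ m n))⁻¹ • (wv ρ μ v (m + 1) n + wv ρ μ v m (n + 1)) :=
  b_vv q_ne_zero q_sq_sub_one_ne_zero isLadder hμ h.B0 (cu_xx_ne_zero q_ne_zero hg m n)

include h hμ hg in
theorem B1_wv (m n : ℕ) : ρ Uq'.B1 (wv ρ μ v m n) = (cu (xx q μ m n))⁻¹ •
    (gam q (q ^ s) (q ^ t) μ (q ^ m) • wv ρ μ v (m - 1) n +
      del q (q ^ s) (q ^ t) μ (q ^ n) • wv ρ μ v m (n - 1)) := by
  have h0 := q_ne_zero
  refine c_vv h0 q_pow_ne_one' isLadder hμ h.B0 hg (zpow_ne_zero s h0) (zpow_ne_zero t h0) h.B1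
    (fun m n => ?_) ?_ m n
  · have := B1_Bm1_apply (h.Ddia_wv m n) (h.D1_wv m n)
    rw [← wv, this, show k1 + s + t - ((m : ℤ) + n) - (k1 + (m + n)) =
      s + t - ((m + n : ℕ) : ℤ) * (2 : ℕ) by push_cast; ring, zpow_sub₀ h0, zpow_add₀ h0,
      zpow_mul, zpow_natCast, zpow_natCast]
  · rw [opY_eq, ← Z_apply h.B1, h.Z, zetaST, zpow_sub₀ h0, mul_inv, ← zpow_neg, ← zpow_neg,
      ← zpow_add₀ h0]
    rfl

end IsHW

end HighestWeight

/-! ### Diagonal operators separate the basis vectors -/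

/-- On an antidiagonal the exponents $n-m$ all have the same parity, so a coincidence
$[x]=[-x^{-1}]$ would again give $(q^k\mu)^2=-1$. -/
theorem br_xx_ne {μ : Kq} (hμ : μ ≠ 0) (hg : ∀ l : ℤ, cu (q ^ l * μ) ≠ 0) {m n m' n' : ℕ}
    (hs : m + n = m' + n') (hne : (m, n) ≠ (m', n')) :
    br q (xx q μ m n) ≠ br q (xx q μ m' n') := by
  intro h
  have h0 := q_ne_zero
  rw [xx_eq_zpow h0, xx_eq_zpow h0] at h
  rcases mul_eq_zero.mp (br_inj h0 q_sq_sub_one_ne_zero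
    (mul_ne_zero (zpow_ne_zero _ h0) hμ) (mul_ne_zero (zpow_ne_zero _ h0) hμ) h) with h | h
  · have := q_zpow_injective (mul_right_cancel₀ hμ (sub_eq_zero.mp h))
    apply hne
    ext <;> simp <;> omega
  · obtain ⟨k, hk⟩ : ∃ k : ℤ, ((n : ℤ) - m) + (n' - m') = 2 * k := ⟨n - m', by omega⟩
    apply hg k
    have hkμ : q ^ k * μ ≠ 0 := mul_ne_zero (zpow_ne_zero _ h0) hμ
    have h' : q ^ ((n : ℤ) - m) * μ * (q ^ ((n' : ℤ) - m') * μ) = (q ^ k * μ) ^ 2 := by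
      rw [mul_mul_mul_comm, ← zpow_add₀ h0, hk, two_mul, zpow_add₀ h0]
      ring
    rw [h'] at h
    rw [cu]
    generalize q ^ k * μ = z at *
    field_simp
    linear_combination h

/-- A subspace of `ℕ × ℕ →₀ F` which is stable under diagonal operators separating the points
contains the basis vectors which occur in its elements. -/
theorem single_mem_of_separated {F ι J : Type*} [Field F] (W : Submodule F (ι →₀ F))
    (d : J → ι → F) (hsep : ∀ i i', i ≠ i' → ∃ j, d j i ≠ d j i')
    (D : J → (ι →₀ F) →ₗ[F] (ι →₀ F)) (hD : ∀ j x i, D j x i = d j i * x i)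
    (hW : ∀ j, ∀ x ∈ W, D j x ∈ W) {x : ι →₀ F} (hx : x ∈ W) {i : ι} (hi : x i ≠ 0) :
    Finsupp.single i 1 ∈ W := by
  classical
  induction hn : x.support.card using Nat.strong_induction_on generalizing x with
  | _ n ih =>
    by_cases hex : ∃ i' ∈ x.support, i' ≠ i
    · obtain ⟨i', hi', hne⟩ := hex
      obtain ⟨j, hj⟩ := hsep i i' hne.symm
      -- This kills the coordinate `i'`, keeps a nonzero coordinate at `i` and creates no new
      -- support.
      have hy : D j x - d j i' • x ∈ W := W.sub_mem (hW j x hx) (W.smul_mem _ hx)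
      have hval : ∀ k, (D j x - d j i' • x) k = (d j k - d j i') * x k := fun k => by
        simp [hD, sub_mul]
      refine ih _ ?_ hy ?_ rfl
      · rw [← hn]
        apply Finset.card_lt_card
        refine ⟨fun k hk => ?_, fun hsub => ?_⟩
        · rw [Finsupp.mem_support_iff, hval] at hk
          exact Finsupp.mem_support_iff.mpr (right_ne_zero_of_mul hk)
        · have := hsub hi'
          rw [Finsupp.mem_support_iff, hval, sub_self, zero_mul] at this
          exact this rfl
      · rw [hval]
        exact mul_ne_zero (sub_ne_zero.mpr hj) hi
    · push Not at hex
      have : x = x i • Finsupp.single i 1 := by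
        ext k
        by_cases hk : k = i
        · simp [hk]
        · have : x k = 0 := by
            by_contra hne
            exact hk (hex k (Finsupp.mem_support_iff.mpr hne))
          simp [this, Ne.symm hk]
      rw [this] at hx
      exact (W.smul_mem_iff hi).mp hx

/-! ### The Fock space -/

section Fock

variable {R : Type} [CommRing R] [Algebra Kq R]

/-- The space with basis indexed by pairs of natural numbers. -/
abbrev Fock (R : Type) [CommRing R] : Type := (ℕ × ℕ) →₀ R

/-- The coefficient `gam`, with `c = (S, S⁻¹, T, T⁻¹)` in an arbitrary algebra. -/
def gamR (μ : Kq) (c : Fin 4 → R) (A : Kq) : R :=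
  (br q A * cu (μ / A)) • (((q - q⁻¹)⁻¹ • ((q / A) • c 0 - (q / A)⁻¹ • c 1)) *
    ((q * μ / A) • c 2 + (q * μ / A)⁻¹ • c 3))

/-- The coefficient `del`, with `c = (S, S⁻¹, T, T⁻¹)` in an arbitrary algebra. -/
def delR (μ : Kq) (c : Fin 4 → R) (B : Kq) : R :=
  (br q B * cu (μ * B)) • (((q - q⁻¹)⁻¹ • ((q / B) • c 2 - (q / B)⁻¹ • c 3)) *
    ((μ * B / q) • c 1 + (μ * B / q)⁻¹ • c 0))

/-- The action of the generators of `U_q'` on the basis of the Fock space. -/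
def fockGen (k1 : ℤ) (μ : Kq) (c : Fin 4 → R) : Uq'.CGen → ℕ × ℕ → Fock R
  | .B1, p => Finsupp.single (p.1 - 1, p.2) ((cu (xx q μ p.1 p.2))⁻¹ • gamR μ c (q ^ p.1)) +
      Finsupp.single (p.1, p.2 - 1) ((cu (xx q μ p.1 p.2))⁻¹ • delR μ c (q ^ p.2))
  | .Bm1, p => Finsupp.single (p.1 + 1, p.2) ((cu (xx q μ p.1 p.2))⁻¹ • 1) +
      Finsupp.single (p.1, p.2 + 1) ((cu (xx q μ p.1 p.2))⁻¹ • 1)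
  | .B0, p => Finsupp.single p (br q (xx q μ p.1 p.2) • 1)
  | .Ddia, p => Finsupp.single p (q ^ (k1 - (p.1 + p.2)) • (c 0 * c 2))
  | .DdiaInv, p => Finsupp.single p ((q ^ (k1 - (p.1 + p.2)))⁻¹ • (c 1 * c 3))
  | .D1, p => Finsupp.single p (q ^ (k1 + (p.1 + p.2)) • 1)
  | .D1Inv, p => Finsupp.single p ((q ^ (k1 + (p.1 + p.2)))⁻¹ • 1)

/-- The action of the free algebra on the Fock space. -/
def fockRep (k1 : ℤ) (μ : Kq) (c : Fin 4 → R) :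
    FreeAlgebra Kq Uq'.CGen →ₐ[Kq] Module.End R (Fock R) :=
  FreeAlgebra.lift Kq fun g => Finsupp.linearCombination R (fockGen k1 μ c g)

theorem fockRep_ι_single (k1 : ℤ) (μ : Kq) (c : Fin 4 → R) (g : Uq'.CGen) (p : ℕ × ℕ) (r : R) :
    fockRep k1 μ c (FreeAlgebra.ι Kq g) (Finsupp.single p r) = r • fockGen k1 μ c g p := by
  simp [fockRep]

variable {R' : Type} [CommRing R'] [Algebra Kq R']

theorem map_gamR (f : R →ₐ[Kq] R') (μ : Kq) (c : Fin 4 → R) (A : Kq) :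
    f (gamR μ c A) = gamR μ (f ∘ c) A := by
  simp [gamR]

theorem map_delR (f : R →ₐ[Kq] R') (μ : Kq) (c : Fin 4 → R) (A : Kq) :
    f (delR μ c A) = delR μ (f ∘ c) A := by
  simp [delR]

/-- Base change of the Fock space. -/
def fockMap (f : R →ₐ[Kq] R') : Fock R →+ Fock R' :=
  Finsupp.mapRange.addMonoidHom (f : R →+ R')

theorem fockMap_single (f : R →ₐ[Kq] R') (p : ℕ × ℕ) (r : R) :
    fockMap f (Finsupp.single p r) = Finsupp.single p (f r) := by
  simp [fockMap]

theorem fockMap_apply (f : R →ₐ[Kq] R') (x : Fock R) (p : ℕ × ℕ) :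
    fockMap f x p = f (x p) := rfl

theorem fockMap_smul (f : R →ₐ[Kq] R') (r : R) (x : Fock R) :
    fockMap f (r • x) = f r • fockMap f x := by
  ext p
  simp [fockMap_apply]

theorem fockMap_fockGen (f : R →ₐ[Kq] R') (k1 : ℤ) (μ : Kq) (c : Fin 4 → R) (g : Uq'.CGen)
    (p : ℕ × ℕ) : fockMap f (fockGen k1 μ c g p) = fockGen k1 μ (f ∘ c) g p := by
  cases g <;> simp [fockGen, fockMap_single, map_gamR, map_delR]

/-- All matrix coefficients are polynomial expressions in the four parameters `c`, so they can be
computed once with indeterminates and then specialised. -/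
theorem fockMap_fockRep (f : R →ₐ[Kq] R') (k1 : ℤ) (μ : Kq) (c : Fin 4 → R)
    (x : FreeAlgebra Kq Uq'.CGen) (y : Fock R) :
    fockMap f (fockRep k1 μ c x y) = fockRep k1 μ (f ∘ c) x (fockMap f y) := by
  induction x using FreeAlgebra.induction generalizing y with
  | grade0 r =>
    ext p
    simp [AlgHom.commutes, Module.algebraMap_end_apply, fockMap_apply]
  | grade1 g =>
    induction y using Finsupp.induction_linear with
    | zero => simp
    | add y z hy hz => simp [hy, hz]
    | single p r =>
      rw [fockRep_ι_single, fockMap_smul, fockMap_fockGen, fockMap_single, fockRep_ι_single]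
  | mul a b ha hb => simp [ha, hb]
  | add a b ha hb => simp [ha, hb]

end Fock

/-- The parameters `(q^s, q^{-s}, q^t, q^{-t})`. -/
def stParam (s t : ℤ) : Fin 4 → Kq := ![q ^ s, (q ^ s)⁻¹, q ^ t, (q ^ t)⁻¹]

theorem gamR_stParam (μ : Kq) (s t : ℤ) (A : Kq) :
    gamR μ (stParam s t) A = gam q (q ^ s) (q ^ t) μ A := by
  simp only [gamR, gam, stParam, smul_eq_mul, br, cu, Matrix.cons_val]
  simp only [mul_inv, div_eq_mul_inv, inv_inv]
  ring

theorem delR_stParam (μ : Kq) (s t : ℤ) (A : Kq) :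
    delR μ (stParam s t) A = del q (q ^ s) (q ^ t) μ A := by
  simp only [delR, del, stParam, smul_eq_mul, br, cu, Matrix.cons_val]
  simp only [mul_inv, div_eq_mul_inv, inv_inv]
  ring

/-! ### Comparison of the Fock space with a given highest weight module. -/

section Intertwine

variable {M : Type} [AddCommGroup M] [Module Kq M] (ρ : Uq' →ₐ[Kq] Module.End Kq M)

/-- The linear map from the Fock space sending basis vectors to the vectors `wv`. -/
def fockTo (μ : Kq) (v : M) : Fock Kq →ₗ[Kq] M :=
  Finsupp.linearCombination Kq fun p : ℕ × ℕ => wv ρ μ v p.1 p.2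

theorem fockTo_single (μ : Kq) (v : M) (p : ℕ × ℕ) (r : Kq) :
    fockTo ρ μ v (Finsupp.single p r) = r • wv ρ μ v p.1 p.2 := by
  simp [fockTo]

variable {ρ}

/-- The Fock formulas were read off from the action on the ladder vectors of any highest weight
vector. At this stage only the free algebra acts on the Fock space, so its kernel can be used to
test relations. -/
theorem IsHW.fockTo_fockRep {v : M} {k1 s t : ℤ} {μ : Kq} (h : IsHW ρ v k1 s t μ) (hμ : μ ≠ 0)
    (hg : ∀ l : ℤ, cu (q ^ l * μ) ≠ 0) (x : FreeAlgebra Kq Uq'.CGen) (y : Fock Kq) :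
    fockTo ρ μ v (fockRep k1 μ (stParam s t) x y) = ρ (Uq'.proj x) (fockTo ρ μ v y) := by
  have h0 := q_ne_zero
  induction x using FreeAlgebra.induction generalizing y with
  | grade0 r => simp [AlgHom.commutes, Module.algebraMap_end_apply]
  | grade1 g =>
    induction y using Finsupp.induction_linear with
    | zero => simp
    | add y z hy hz => simp only [map_add, hy, hz]
    | single p r =>
      rw [fockRep_ι_single, map_smul, fockTo_single, map_smul, Uq'.proj_ι]
      congr 1
      cases g with
      | B1 =>
        simp only [fockGen, map_add, fockTo_single, Uq'.cgen, h.B1_wv hμ hg, gamR_stParam,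
          delR_stParam, smul_eq_mul, smul_add, smul_smul]
      | Bm1 =>
        simp only [fockGen, map_add, fockTo_single, Uq'.cgen, h.Bm1_wv hμ hg, smul_eq_mul,
          smul_add, mul_one]
      | B0 => simp only [fockGen, fockTo_single, Uq'.cgen, h.B0_wv hμ, smul_eq_mul, mul_one]
      | Ddia =>
        simp only [fockGen, fockTo_single, Uq'.cgen, h.Ddia_wv, smul_eq_mul, stParam,
          Matrix.cons_val]
        rw [← zpow_add₀ h0, ← zpow_add₀ h0]
        congr 2
        ring
      | DdiaInv =>
        simp only [fockGen, fockTo_single, Uq'.cgen, h.DdiaInv_wv, smul_eq_mul, stParam,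
          Matrix.cons_val]
        rw [← mul_inv, ← mul_inv, ← zpow_add₀ h0, ← zpow_add₀ h0]
        congr 3
        ring
      | D1 => simp only [fockGen, fockTo_single, Uq'.cgen, h.D1_wv, smul_eq_mul, mul_one]
      | D1Inv => simp only [fockGen, fockTo_single, Uq'.cgen, h.D1Inv_wv, smul_eq_mul, mul_one]
  | mul a b ha hb => simp [ha, hb]
  | add a b ha hb => simp [ha, hb]

end Intertwine

/-- The diagonal generators. -/
def diagGen : Bool → Uq'.CGen
  | true => .B0
  | false => .Ddia

/-- The eigenvalues of the diagonal generators. -/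
def diagEig (k1 s t : ℤ) (μ : Kq) : Bool → ℕ × ℕ → Kq
  | true, p => br q (xx q μ p.1 p.2)
  | false, p => q ^ (k1 + s + t - (p.1 + p.2))

/-- $\hat D_\diamondsuit$ detects the antidiagonal $m+n$, and $B_0$ separates the points on it. -/
theorem diagEig_separates {k1 s t : ℤ} {μ : Kq} (hμ : μ ≠ 0)
    (hg : ∀ l : ℤ, cu (q ^ l * μ) ≠ 0) (p p' : ℕ × ℕ) (hne : p ≠ p') :
    ∃ j, diagEig k1 s t μ j p ≠ diagEig k1 s t μ j p' := by
  by_cases hs : p.1 + p.2 = p'.1 + p'.2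
  · exact ⟨true, br_xx_ne hμ hg hs hne⟩
  · refine ⟨false, fun h => hs ?_⟩
    have := q_zpow_injective h
    omega

theorem fockRep_diagGen (k1 s t : ℤ) (μ : Kq) (j : Bool) (x : Fock Kq) (p : ℕ × ℕ) :
    fockRep k1 μ (stParam s t) (FreeAlgebra.ι Kq (diagGen j)) x p =
      diagEig k1 s t μ j p * x p := by
  induction x using Finsupp.induction_linear with
  | zero => simp
  | add y z hy hz => simp [hy, hz, mul_add]
  | single p' r =>
    rw [fockRep_ι_single]
    cases j
    · by_cases h : p' = p
      · subst h
        simp only [diagGen, fockGen, Finsupp.smul_single, Finsupp.single_eq_same, smul_eq_mul,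
          stParam, Matrix.cons_val, diagEig]
        rw [← zpow_add₀ q_ne_zero, ← zpow_add₀ q_ne_zero, mul_comm]
        congr 2
        ring
      · simp [diagGen, fockGen, h]
    · by_cases h : p' = p
      · subst h
        simp [diagGen, fockGen, diagEig, mul_comm]
      · simp [diagGen, fockGen, h]

theorem single_mem_of_stable {k1 s t : ℤ} {μ : Kq} (hμ : μ ≠ 0)
    (hg : ∀ l : ℤ, cu (q ^ l * μ) ≠ 0) (W : Submodule Kq (Fock Kq))
    (hW : ∀ g, ∀ x ∈ W, fockRep k1 μ (stParam s t) (FreeAlgebra.ι Kq g) x ∈ W) {x : Fock Kq}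
    (hx : x ∈ W) {p : ℕ × ℕ} (hp : x p ≠ 0) : Finsupp.single p 1 ∈ W :=
  single_mem_of_separated W (diagEig k1 s t μ) (diagEig_separates hμ hg)
    (fun j => fockRep k1 μ (stParam s t) (FreeAlgebra.ι Kq (diagGen j)))
    (fockRep_diagGen k1 s t μ) (fun j => hW (diagGen j)) hx hp

/-! ### Functions of `s` that are Laurent polynomials in `q^s` -/

/-- A function of an integer `s` which is a Laurent polynomial in `q^s`. -/
def LaurentFn (g : ℤ → Kq) : Prop :=
  ∃ (N : ℕ) (p : Polynomial Kq), ∀ s, (q ^ s) ^ N * g s = p.eval (q ^ s)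

namespace LaurentFn

theorem const (a : Kq) : LaurentFn fun _ => a := ⟨0, .C a, by simp⟩

theorem zpow : LaurentFn fun s => q ^ s := ⟨0, .X, by simp⟩

theorem zpow_inv : LaurentFn fun s => (q ^ s)⁻¹ :=
  ⟨1, 1, fun s => by simp [zpow_ne_zero s q_ne_zero]⟩

theorem add {g h : ℤ → Kq} (hg : LaurentFn g) (hh : LaurentFn h) :
    LaurentFn fun s => g s + h s := by
  obtain ⟨N, p, hp⟩ := hg
  obtain ⟨N', p', hp'⟩ := hh
  refine ⟨N + N', p * .X ^ N' + p' * .X ^ N, fun s => ?_⟩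
  simp only [Polynomial.eval_add, Polynomial.eval_mul, Polynomial.eval_pow, Polynomial.eval_X,
    ← hp, ← hp']
  ring

theorem mul {g h : ℤ → Kq} (hg : LaurentFn g) (hh : LaurentFn h) :
    LaurentFn fun s => g s * h s := by
  obtain ⟨N, p, hp⟩ := hg
  obtain ⟨N', p', hp'⟩ := hh
  refine ⟨N + N', p * p', fun s => ?_⟩
  rw [Polynomial.eval_mul, ← hp, ← hp']
  ring

/-- After clearing denominators the function is a polynomial with infinitely many roots $q^s$. -/
theorem eq_zero {g : ℤ → Kq} (hg : LaurentFn g) (s₀ : ℕ) (h : ∀ s : ℕ, s₀ ≤ s → g s = 0)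
    (s : ℤ) : g s = 0 := by
  obtain ⟨N, p, hp⟩ := hg
  have : p = 0 := by
    refine Polynomial.eq_zero_of_infinite_isRoot p (Set.infinite_of_injective_forall_mem
      (f := fun k : ℕ => q ^ ((s₀ + k : ℕ) : ℤ)) (fun a b hab => ?_) fun k => ?_)
    · have := q_zpow_injective hab
      omega
    · rw [Set.mem_ofPred_eq, Polynomial.IsRoot, ← hp, h _ (Nat.le_add_right _ _), mul_zero]
  have h' := hp s
  rw [this, Polynomial.eval_zero] at h'
  exact (mul_eq_zero.mp h').resolve_left (pow_ne_zero _ (zpow_ne_zero _ q_ne_zero))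

end LaurentFn

theorem laurentFn_aeval_left (t : ℤ) (F : MvPolynomial (Fin 4) Kq) :
    LaurentFn fun s => MvPolynomial.aeval (stParam s t) F := by
  induction F using MvPolynomial.induction_on with
  | C a => simpa using LaurentFn.const a
  | add f g hf hg => simpa using hf.add hg
  | mul_X f j hf =>
    simp only [map_mul, MvPolynomial.aeval_X]
    refine hf.mul ?_
    fin_cases j
    exacts [.zpow, .zpow_inv, .const (q ^ t), .const (q ^ t)⁻¹]

theorem laurentFn_aeval_right (s : ℤ) (F : MvPolynomial (Fin 4) Kq) :
    LaurentFn fun t => MvPolynomial.aeval (stParam s t) F := by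
  induction F using MvPolynomial.induction_on with
  | C a => simpa using LaurentFn.const a
  | add f g hf hg => simpa using hf.add hg
  | mul_X f j hf =>
    simp only [map_mul, MvPolynomial.aeval_X]
    refine hf.mul ?_
    fin_cases j
    exacts [.const (q ^ s), .const (q ^ s)⁻¹, .zpow, .zpow_inv]

/-- The points $(q^s,q^t)$ with $s,t$ large are Zariski dense: extend to all $t$ for each fixed
large $s$, and then to all $s$. -/
theorem aeval_stParam_eq_zero (F : MvPolynomial (Fin 4) Kq) (s₀ t₀ : ℕ)
    (h : ∀ s t : ℕ, s₀ ≤ s → t₀ ≤ t → MvPolynomial.aeval (stParam s t) F = 0) (s t : ℤ) :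
    MvPolynomial.aeval (stParam s t) F = 0 :=
  (laurentFn_aeval_left t F).eq_zero s₀
    (fun s hs => (laurentFn_aeval_right s F).eq_zero t₀ (fun t ht => h s t hs ht) t) s

/-! ### Stable subspaces of the Fock space -/

theorem br_q_zpow_ne_zero {k : ℤ} (hk : k ≠ 0) : br q (q ^ k) ≠ 0 := by
  refine div_ne_zero (fun h => hk ?_) q_sub_inv_ne_zero
  rw [← zpow_neg, sub_eq_zero] at h
  have := q_zpow_injective h
  omega

section Stable

variable {k1 s t : ℤ} {μ : Kq} (hμ : μ ≠ 0) (hg : ∀ l : ℤ, cu (q ^ l * μ) ≠ 0)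

include hg in
-- Goodness keeps both `cu` factors nonzero, and the quantum integers vanish only at the two
-- excluded values of `m`.
theorem gam_ne_zero {m : ℕ} (h : m ≠ 0) (h' : (m : ℤ) ≠ s + 1) :
    gam q (q ^ s) (q ^ t) μ (q ^ m) ≠ 0 := by
  have h0 := q_ne_zero
  have e1 : q * q ^ s / q ^ m = q ^ (s + 1 - m) := by
    rw [zpow_sub₀ h0, zpow_add_one₀ h0, zpow_natCast, mul_comm q]
  have e2 : μ / q ^ m = q ^ (-m : ℤ) * μ := by
    rw [zpow_neg, zpow_natCast, div_eq_inv_mul]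
  have e3 : q * q ^ t * μ / q ^ m = q ^ (t + 1 - m) * μ := by
    rw [zpow_sub₀ h0, zpow_add_one₀ h0, zpow_natCast]
    ring
  rw [gam, e1, e2, e3, ← zpow_natCast]
  exact mul_ne_zero (mul_ne_zero (mul_ne_zero (br_q_zpow_ne_zero (by omega))
    (br_q_zpow_ne_zero (by omega))) (hg _)) (hg _)

include hg in
theorem del_ne_zero {n : ℕ} (h : n ≠ 0) (h' : (n : ℤ) ≠ t + 1) :
    del q (q ^ s) (q ^ t) μ (q ^ n) ≠ 0 := by
  have h0 := q_ne_zero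
  have e1 : q * q ^ t / q ^ n = q ^ (t + 1 - n) := by
    rw [zpow_sub₀ h0, zpow_add_one₀ h0, zpow_natCast, mul_comm q]
  have e2 : μ * q ^ n = q ^ (n : ℤ) * μ := by rw [zpow_natCast, mul_comm]
  have e3 : μ * q ^ n / (q * q ^ s) = q ^ (n - (s + 1)) * μ := by
    rw [zpow_sub₀ h0, zpow_add_one₀ h0, zpow_natCast]
    ring
  rw [del, e1, e3, e2, ← zpow_natCast]
  exact mul_ne_zero (mul_ne_zero (mul_ne_zero (br_q_zpow_ne_zero (by omega))
    (br_q_zpow_ne_zero (by omega))) (hg _)) (hg _)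

variable (W : Submodule Kq (Fock Kq))
  (hW : ∀ g, ∀ x ∈ W, fockRep k1 μ (stParam s t) (FreeAlgebra.ι Kq g) x ∈ W)

include hμ hg hW in
-- $B_1$ sends the basis vector to at most two neighbours. The left one has a nonzero coefficient,
-- and the diagonal operators isolate it.
theorem single_left_mem {m n : ℕ} (h : (m : ℤ) + 1 ≠ s + 1)
    (hm : Finsupp.single (m + 1, n) 1 ∈ W) : Finsupp.single (m, n) 1 ∈ W := by
  refine single_mem_of_stable hμ hg W hW (hW .B1 _ hm) ?_
  have : gam q (q ^ s) (q ^ t) μ (q ^ (m + 1)) ≠ 0 :=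
    gam_ne_zero hg (Nat.succ_ne_zero m) (by push_cast; exact h)
  simp [fockRep_ι_single, fockGen, gamR_stParam, this, cu_xx_ne_zero q_ne_zero hg]

include hμ hg hW in
theorem single_right_mem {m n : ℕ} (h : (n : ℤ) + 1 ≠ t + 1)
    (hm : Finsupp.single (m, n + 1) 1 ∈ W) : Finsupp.single (m, n) 1 ∈ W := by
  refine single_mem_of_stable hμ hg W hW (hW .B1 _ hm) ?_
  have : del q (q ^ s) (q ^ t) μ (q ^ (n + 1)) ≠ 0 :=
    del_ne_zero hg (Nat.succ_ne_zero n) (by push_cast; exact h)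
  simp [fockRep_ι_single, fockGen, delR_stParam, this, cu_xx_ne_zero q_ne_zero hg]

include hμ hg hW in
-- Inside the box neither wall $m=s+1$ nor $n=t+1$ is crossed on the way down, so the vacuum is
-- reached.
theorem single_zero_mem {m n : ℕ} (hm : (m : ℤ) ≤ s) (hn : (n : ℤ) ≤ t)
    (h : Finsupp.single (m, n) 1 ∈ W) : Finsupp.single (0, 0) 1 ∈ W := by
  induction m with
  | zero =>
    induction n with
    | zero => exact h
    | succ n ih =>
      push_cast at hn
      exact ih (by omega) (single_right_mem hμ hg W hW (by omega) h)
  | succ m ih =>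
    push_cast at hm
    exact ih (by omega) (single_left_mem hμ hg W hW (by omega) h)

include hμ hg hW in
theorem single_succ_left_mem {m n : ℕ} (h : Finsupp.single (m, n) 1 ∈ W) :
    Finsupp.single (m + 1, n) 1 ∈ W := by
  refine single_mem_of_stable hμ hg W hW (hW .Bm1 _ h) ?_
  simp [fockRep_ι_single, fockGen, cu_xx_ne_zero q_ne_zero hg]

include hμ hg hW in
theorem single_succ_right_mem {m n : ℕ} (h : Finsupp.single (m, n) 1 ∈ W) :
    Finsupp.single (m, n + 1) 1 ∈ W := by
  refine single_mem_of_stable hμ hg W hW (hW .Bm1 _ h) ?_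
  simp [fockRep_ι_single, fockGen, cu_xx_ne_zero q_ne_zero hg]

include hμ hg hW in
theorem single_add_mem {m n : ℕ} (a b : ℕ) (h : Finsupp.single (m, n) 1 ∈ W) :
    Finsupp.single (m + a, n + b) 1 ∈ W := by
  induction a with
  | zero =>
    induction b with
    | zero => exact h
    | succ b ih => exact single_succ_right_mem hμ hg W hW ih
  | succ a ih => exact single_succ_left_mem hμ hg W hW ih

include hμ hg hW in
theorem eq_top_of_single_zero_mem (h : Finsupp.single (0, 0) 1 ∈ W) : W = ⊤ := by
  refine eq_top_iff.mpr fun x _ => ?_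
  induction x using Finsupp.induction_linear with
  | zero => exact W.zero_mem
  | add x y hx hy => exact W.add_mem (hx trivial) (hy trivial)
  | single p r =>
    have := W.smul_mem r (single_add_mem hμ hg W hW p.1 p.2 h)
    simpa using this

end Stable

/-! ### The Fock space as a module over `U_q'` -/

section FockMod

variable {μ : Kq} (hμ : μ ≠ 0) (hg : ∀ l : ℤ, cu (q ^ l * μ) ≠ 0)

include hμ hg in
-- For natural `s`, `t` there is a module with a suitable nonzero highest weight vector. A relation
-- maps into the stable kernel of `fockTo`; a nonzero coefficient in the box would pull the vacuum
-- into this kernel, although it maps to the highest weight vector.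
theorem fockRep_apply_eq_zero_of_le (k1 : ℤ) (s t : ℕ) {x : FreeAlgebra Kq Uq'.CGen}
    (hx : Uq'.proj x = 0) (p p' : ℕ × ℕ) (hs : p'.1 ≤ s) (ht : p'.2 ≤ t) :
    fockRep k1 μ (stParam s t) x (Finsupp.single p 1) p' = 0 := by
  obtain ⟨M, _, _, ρ, v, hv, h⟩ := hasHW k1 s t hμ
  by_contra hne
  apply hv
  set W := LinearMap.ker (fockTo ρ μ v) with hWdef
  have hW : ∀ g, ∀ x ∈ W, fockRep k1 μ (stParam s t) (FreeAlgebra.ι Kq g) x ∈ W := by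
    intro g x hx
    rw [hWdef, LinearMap.mem_ker] at hx ⊢
    rw [h.fockTo_fockRep hμ hg, hx, map_zero]
  have hy : fockRep k1 μ (stParam s t) x (Finsupp.single p 1) ∈ W := by
    rw [hWdef, LinearMap.mem_ker, h.fockTo_fockRep hμ hg, hx, map_zero, LinearMap.zero_apply]
  have := single_zero_mem hμ hg W hW (Int.ofNat_le.mpr hs) (Int.ofNat_le.mpr ht)
    (single_mem_of_stable hμ hg W hW hy hne)
  rw [hWdef, LinearMap.mem_ker, fockTo_single, one_smul] at this
  simpa [wv, vv] using this

include hμ hg in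
theorem fockRep_eq_zero (k1 s t : ℤ) {x : FreeAlgebra Kq Uq'.CGen} (hx : Uq'.proj x = 0) :
    fockRep k1 μ (stParam s t) x = 0 := by
  refine Finsupp.lhom_ext fun p r => ?_
  have hr : Finsupp.single p r = r • Finsupp.single p (1 : Kq) := by simp
  rw [hr, map_smul]
  have : fockRep k1 μ (stParam s t) x (Finsupp.single p 1) = 0 := by
    ext p'
    -- The four parameters become independent variables. Inverse pairs need not multiply to $1$
    -- before specialisation, since only values at `stParam s t` are used.
    have key : ∀ s t : ℤ, fockRep k1 μ (stParam s t) x (Finsupp.single p 1) p' =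
        MvPolynomial.aeval (stParam s t)
          (fockRep k1 μ (MvPolynomial.X : Fin 4 → MvPolynomial (Fin 4) Kq) x
            (Finsupp.single p 1) p') := by
      intro s t
      rw [← fockMap_apply, fockMap_fockRep, fockMap_single, map_one]
      congr 4
      ext j
      simp
    rw [key, aeval_stParam_eq_zero _ p'.1 p'.2, Finsupp.zero_apply]
    intro s t hs ht
    rw [← key]
    exact fockRep_apply_eq_zero_of_le hμ hg k1 s t hx p p' hs ht
  rw [this, smul_zero, LinearMap.zero_apply]

/-- The representation of `U_q'` on the Fock space. -/
def fockMod (k1 s t : ℤ) : Uq' →ₐ[Kq] Module.End Kq (Fock Kq) :=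
  Uq'.descend (fockRep k1 μ (stParam s t)) fun _ hx => fockRep_eq_zero hμ hg k1 s t hx

theorem fockMod_cgen (k1 s t : ℤ) (g : Uq'.CGen) :
    fockMod hμ hg k1 s t (Uq'.cgen g) = fockRep k1 μ (stParam s t) (FreeAlgebra.ι Kq g) :=
  Uq'.descend_cgen _ _ g

theorem fockMod_proj (k1 s t : ℤ) (x : FreeAlgebra Kq Uq'.CGen) :
    fockMod hμ hg k1 s t (Uq'.proj x) = fockRep k1 μ (stParam s t) x := by
  have : (fockMod hμ hg k1 s t).comp Uq'.proj = fockRep k1 μ (stParam s t) := by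
    ext1
    funext g
    simp only [Function.comp_apply, Uq'.proj_ι, fockMod_cgen, AlgHom.coe_comp]
  exact DFunLike.congr_fun this x

end FockMod

/-! ### Singular vectors in the Fock space -/

section Identities

variable {K : Type*} [Field K] {q : K}

theorem br_inv_mul_sub (h0 : q ≠ 0) (h2 : q ^ 2 - 1 ≠ 0) {x : K} (hx : x ≠ 0) :
    br q (q⁻¹ * x) - q⁻¹ * br q x = -x⁻¹ := by
  unfold br
  field_simp
  ring

/-- The eigenvalue of `Z` on a singular vector. -/
theorem zeta_of_singular (h0 : q ≠ 0) (h2 : q ^ 2 - 1 ≠ 0) {S T μ A B S' T' : K} (hS : S ≠ 0)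
    (hT : T ≠ 0) (hμ : μ ≠ 0) (hA : A = 1 ∧ S' = S ∨ A = q * S ∧ S' = (q ^ 2 * S)⁻¹)
    (hB : B = 1 ∧ T' = T ∨ B = q * T ∧ T' = (q ^ 2 * T)⁻¹) {x : K} (hx : x = μ * B / A) :
    x * del q S T μ (q * B) * cu (q⁻¹ * x) - x⁻¹ * gam q S T μ (q * A) * cu (q * x) =
      cu x * (br q (T' / S' * x) - (S' * T')⁻¹ * br q x) * cu (q * x) * cu (q⁻¹ * x) := by
  rcases hA with ⟨rfl, rfl⟩ | ⟨rfl, rfl⟩ <;> rcases hB with ⟨rfl, rfl⟩ | ⟨rfl, rfl⟩ <;>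
  · subst hx
    unfold gam del br cu
    field_simp
    ring

end Identities

section

variable {μ : Kq} (hμ : μ ≠ 0) (hg : ∀ l : ℤ, cu (q ^ l * μ) ≠ 0) (k1 s t : ℤ) (m n : ℕ)

theorem fockMod_B1 : fockMod hμ hg k1 s t Uq'.B1 (Finsupp.single (m, n) 1) =
    (cu (xx q μ m n))⁻¹ •
      (gam q (q ^ s) (q ^ t) μ (q ^ m) • Finsupp.single (m - 1, n) 1 +
        del q (q ^ s) (q ^ t) μ (q ^ n) • Finsupp.single (m, n - 1) 1) := by
  have := fockMod_cgen hμ hg k1 s t .B1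
  rw [Uq'.cgen] at this
  rw [this, fockRep_ι_single]
  simp [fockGen, gamR_stParam, delR_stParam]

theorem fockMod_Bm1 : fockMod hμ hg k1 s t Uq'.Bm1 (Finsupp.single (m, n) 1) =
    (cu (xx q μ m n))⁻¹ • (Finsupp.single (m + 1, n) 1 + Finsupp.single (m, n + 1) 1) := by
  have := fockMod_cgen hμ hg k1 s t .Bm1
  rw [Uq'.cgen] at this
  rw [this, fockRep_ι_single]
  simp [fockGen]

theorem fockMod_B0 : fockMod hμ hg k1 s t Uq'.B0 (Finsupp.single (m, n) 1) =
    br q (xx q μ m n) • Finsupp.single (m, n) 1 := by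
  have := fockMod_cgen hμ hg k1 s t .B0
  rw [Uq'.cgen] at this
  rw [this, fockRep_ι_single]
  simp [fockGen]

theorem fockMod_Ddia : fockMod hμ hg k1 s t Uq'.Ddia (Finsupp.single (m, n) 1) =
    q ^ (k1 + s + t - (m + n)) • Finsupp.single (m, n) 1 := by
  have := fockMod_cgen hμ hg k1 s t .Ddia
  rw [Uq'.cgen] at this
  rw [this, fockRep_ι_single]
  simp only [fockGen, stParam, Matrix.cons_val, smul_eq_mul, Finsupp.smul_single, mul_one, one_mul]
  rw [← zpow_add₀ q_ne_zero, ← zpow_add₀ q_ne_zero]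
  congr 2
  ring

theorem fockMod_D1 : fockMod hμ hg k1 s t Uq'.D1 (Finsupp.single (m, n) 1) =
    q ^ (k1 + (m + n)) • Finsupp.single (m, n) 1 := by
  have := fockMod_cgen hμ hg k1 s t .D1
  rw [Uq'.cgen] at this
  rw [this, fockRep_ι_single]
  simp [fockGen]

theorem fockMod_opY : opY q (fockMod hμ hg k1 s t Uq'.B0) (fockMod hμ hg k1 s t Uq'.Bm1)
      (Finsupp.single (m, n) 1) = (cu (xx q μ m n))⁻¹ •
    (xx q μ m n • Finsupp.single (m, n + 1) 1 - (xx q μ m n)⁻¹ • Finsupp.single (m + 1, n) 1) := by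
  have hx := xx_ne_zero q_ne_zero hμ m n
  have e1 : br q (q⁻¹ * xx q μ m n) - q⁻¹ * br q (xx q μ m n) = -(xx q μ m n)⁻¹ :=
    br_inv_mul_sub q_ne_zero q_sq_sub_one_ne_zero hx
  have e2 : br q (q * xx q μ m n) - q⁻¹ * br q (xx q μ m n) = xx q μ m n := by
    rw [br_mul_q q_ne_zero q_sq_sub_one_ne_zero hx]; ring
  rw [opY, fockMod_B0, fockMod_Bm1, map_smul, map_smul, map_add, fockMod_B0, fockMod_B0,
    fockMod_Bm1, xx_succ_left, xx_succ_right, smul_comm (br q _) (cu _)⁻¹,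
    smul_comm q⁻¹ (cu _)⁻¹, ← smul_sub]
  congr 1
  rw [smul_smul, smul_add, add_sub_add_comm, ← sub_smul, ← sub_smul, e1, e2, neg_smul,
    neg_add_eq_sub]

/-- A vector at the boundary of the box is a highest weight vector. -/
theorem fockMod_isHW {k1' s' t' : ℤ} (hk : k1' = k1 + m + n)
    (hm : m = 0 ∧ s' = s ∨ (m : ℤ) = s + 1 ∧ s' = -s - 2)
    (hn : n = 0 ∧ t' = t ∨ (n : ℤ) = t + 1 ∧ t' = -t - 2) :
    IsHW (fockMod hμ hg k1 s t) (Finsupp.single (m, n) 1) k1' s' t' (xx q μ m n) := by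
  have h0 := q_ne_zero
  have hgam : gam q (q ^ s) (q ^ t) μ (q ^ m) = 0 := by
    rcases hm with ⟨rfl, -⟩ | ⟨hm, -⟩
    · rw [pow_zero, gam_one]
    · rw [← zpow_natCast, hm, gam, zpow_add_one₀ h0, mul_comm q, div_self (by
        simp [zpow_ne_zero, h0])]
      simp [br]
  have hdel : del q (q ^ s) (q ^ t) μ (q ^ n) = 0 := by
    rcases hn with ⟨rfl, -⟩ | ⟨hn, -⟩
    · rw [pow_zero, del_one]
    · rw [← zpow_natCast, hn, del, zpow_add_one₀ h0, mul_comm q, div_self (by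
        simp [zpow_ne_zero, h0])]
      simp [br]
  have hB1 : fockMod hμ hg k1 s t Uq'.B1 (Finsupp.single (m, n) 1) = 0 := by
    rw [fockMod_B1, hgam, hdel, zero_smul, zero_smul, add_zero, smul_zero]
  refine ⟨hB1, fockMod_B0 .., ?_, ?_, ?_⟩
  · rw [fockMod_Ddia]
    congr 2
    rcases hm with ⟨rfl, rfl⟩ | ⟨hm, rfl⟩ <;> rcases hn with ⟨rfl, rfl⟩ | ⟨hn, rfl⟩ <;>
      push_cast at * <;> omega
  · rw [fockMod_D1, hk, add_assoc]
  · rw [Z_apply hB1, ← opY_eq, fockMod_opY, map_smul, map_sub, map_smul, map_smul, fockMod_B1,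
      fockMod_B1, hgam, hdel, xx_succ_left, xx_succ_right, zero_smul, zero_smul, zero_add,
      add_zero, Nat.add_sub_cancel, Nat.add_sub_cancel, smul_smul, smul_smul, smul_smul,
      smul_smul, ← sub_smul, smul_smul]
    congr 1
    have key := zeta_of_singular (S := q ^ s) (T := q ^ t) (A := q ^ m) (B := q ^ n) (S' := q ^ s')
      (T' := q ^ t') h0 q_sq_sub_one_ne_zero (zpow_ne_zero _ h0) (zpow_ne_zero _ h0) hμ ?_ ?_ rfl
    · have c0 := cu_xx_ne_zero h0 hg m n
      have c1 := cu_xx_ne_zero h0 hg m (n + 1)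
      have c2 := cu_xx_ne_zero h0 hg (m + 1) n
      rw [xx_succ_right] at c1
      rw [xx_succ_left] at c2
      rw [← xx] at key
      rw [zetaST, zpow_sub₀ h0, zpow_sub₀ h0, zpow_neg, pow_succ', pow_succ']
      rw [mul_inv] at key
      rw [div_eq_mul_inv (q ^ s')⁻¹]
      generalize cu (xx q μ m n) = y at *
      generalize cu (q * xx q μ m n) = y₁ at *
      generalize cu (q⁻¹ * xx q μ m n) = y₂ at *
      generalize br q _ - _ * br q _ = z at *
      field_simp at key ⊢
      linear_combination key
    · rcases hm with ⟨rfl, rfl⟩ | ⟨hm, rfl⟩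
      · exact .inl ⟨pow_zero _, rfl⟩
      · refine .inr ⟨by rw [← zpow_natCast, hm, zpow_add_one₀ h0, mul_comm], ?_⟩
        rw [zpow_sub₀ h0, zpow_neg, mul_inv, div_eq_inv_mul]
        rfl
    · rcases hn with ⟨rfl, rfl⟩ | ⟨hn, rfl⟩
      · exact .inl ⟨pow_zero _, rfl⟩
      · refine .inr ⟨by rw [← zpow_natCast, hn, zpow_add_one₀ h0, mul_comm], ?_⟩
        rw [zpow_sub₀ h0, zpow_neg, mul_inv, div_eq_inv_mul]
        rfl

end

/-! ### Verma modules and the Fock space -/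

section Verma

variable {μ : Kq} (hμ : μ ≠ 0) (hg : ∀ l : ℤ, cu (q ^ l * μ) ≠ 0)

local instance (kd k1 : ℤ) (β ζ : Kq) : SMul Uq' (Verma kd k1 β ζ) :=
  (Submodule.Quotient.module (vermaIdeal kd k1 β ζ)).toSMul

local instance (kd k1 : ℤ) (β ζ : Kq) : IsScalarTower Kq Uq' (Verma kd k1 β ζ) :=
  ⟨fun a u x => by
    obtain ⟨x, rfl⟩ := Submodule.Quotient.mk_surjective _ x
    exact congrArg Submodule.Quotient.mk (smul_assoc a u x)⟩

local instance (kd k1 : ℤ) (β ζ : Kq) : SMulCommClass Uq' Kq (Verma kd k1 β ζ) :=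
  ⟨fun u a x => by
    obtain ⟨x, rfl⟩ := Submodule.Quotient.mk_surjective _ x
    exact congrArg Submodule.Quotient.mk (mul_smul_comm a u x)⟩

theorem verma_isHW {kd k1 s t : ℤ} {β ζ μ : Kq} (hk : kd = k1 + s + t) (hβ : β = br q μ)
    (hζ : ζ = zetaST s t μ) :
    IsHW (Algebra.lsmul Kq Kq (Verma kd k1 β ζ)) (Submodule.Quotient.mk 1) k1 s t μ := by
  have key : ∀ (a : Kq) (x : Uq'), x - algebraMap Kq Uq' a ∈ vermaIdeal kd k1 β ζ →
      x • (Submodule.Quotient.mk 1 : Verma kd k1 β ζ) = a • Submodule.Quotient.mk 1 := by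
    intro a x hx
    rw [← algebraMap_smul Uq' a, ← Submodule.Quotient.mk_smul, ← Submodule.Quotient.mk_smul,
      Submodule.Quotient.eq, smul_eq_mul, smul_eq_mul, mul_one, mul_one]
    exact hx
  subst hk hβ hζ
  refine ⟨?_, ?_, ?_, ?_, ?_⟩
  · refine (key 0 _ ?_).trans (zero_smul _ _)
    rw [map_zero, sub_zero]
    exact Submodule.subset_span (by simp)
  all_goals
    rw [Algebra.lsmul_coe]
    exact key _ _ (Submodule.subset_span (by simp))

/-- The vacuum vector is a highest weight vector. -/
theorem fockMod_vacuum (k1 s t : ℤ) :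
    IsHW (fockMod hμ hg k1 s t) (Finsupp.single (0, 0) 1) k1 s t μ := by
  have := fockMod_isHW hμ hg k1 s t 0 0 (k1' := k1) (by simp) (.inl ⟨rfl, rfl⟩) (.inl ⟨rfl, rfl⟩)
  rwa [xx, pow_zero, div_one, mul_one] at this

/-- The vacuum is cyclic for every choice of `s`, `t`, because both coefficients of $B_{-1}$ are
always nonzero. -/
theorem fockMod_vacuum_surjective (k1 s t : ℤ) (y : Fock Kq) :
    ∃ u, fockMod hμ hg k1 s t u (Finsupp.single (0, 0) 1) = y := by
  set W : Submodule Kq (Fock Kq) := LinearMap.range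
    ((LinearMap.applyₗ (Finsupp.single (0, 0) 1)).comp (fockMod hμ hg k1 s t).toLinearMap) with hW
  have : W = ⊤ := by
    refine eq_top_of_single_zero_mem hμ hg (k1 := k1) (s := s) (t := t) W ?_ ?_
    · rintro g _ ⟨u, rfl⟩
      refine ⟨Uq'.cgen g * u, ?_⟩
      rw [← fockMod_cgen hμ hg]
      simp
    · exact ⟨1, by simp⟩
  obtain ⟨u, hu⟩ : y ∈ W := this ▸ Submodule.mem_top
  exact ⟨u, by simpa using hu⟩

theorem fockMod_vacuum_eq_zero {kd k1 s t : ℤ} {β ζ : Kq} (hk : kd = k1 + s + t)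
    (hβ : β = br q μ) (hζ : ζ = zetaST s t μ) {u : Uq'} (hu : u ∈ vermaIdeal kd k1 β ζ) :
    fockMod hμ hg k1 s t u (Finsupp.single (0, 0) 1) = 0 := by
  have h := fockMod_vacuum hμ hg k1 s t
  subst hk hβ hζ
  induction hu using Submodule.span_induction with
  | mem x hx =>
    rcases hx with rfl | rfl | rfl | rfl | rfl | rfl
    · exact h.B1
    · rw [Uq'.X, Uq'.comm, map_sub, map_smul, map_mul, map_mul, LinearMap.sub_apply,
        LinearMap.smul_apply, Module.End.mul_apply, Module.End.mul_apply, h.B1, h.B0, map_smul,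
        h.B1, map_zero, smul_zero, smul_zero, sub_zero]
    · rw [map_sub, LinearMap.sub_apply, h.Ddia, AlgHom.commutes, Module.algebraMap_end_apply,
        sub_self]
    · rw [map_sub, LinearMap.sub_apply, h.D1, AlgHom.commutes, Module.algebraMap_end_apply,
        sub_self]
    · rw [map_sub, LinearMap.sub_apply, h.B0, AlgHom.commutes, Module.algebraMap_end_apply,
        sub_self]
    · rw [map_sub, LinearMap.sub_apply, h.Z, AlgHom.commutes, Module.algebraMap_end_apply,
        sub_self]
  | zero => simp
  | add x y _ _ hx hy => rw [map_add, LinearMap.add_apply, hx, hy, add_zero]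
  | smul a x _ hx => rw [smul_eq_mul, map_mul, Module.End.mul_apply, hx, map_zero]

/-- The Verma module is isomorphic to the Fock space. -/
theorem exists_vermaEquiv {kd k1 s t : ℤ} {β ζ : Kq} (hk : kd = k1 + s + t)
    (hβ : β = br q μ) (hζ : ζ = zetaST s t μ) :
    ∃ e : Fock Kq ≃ₗ[Kq] Verma kd k1 β ζ, ∀ u y, e (fockMod hμ hg k1 s t u y) = u • e y := by
  have h := verma_isHW hk hβ hζ
  set φ := fockTo (Algebra.lsmul Kq Kq (Verma kd k1 β ζ)) μ (Submodule.Quotient.mk 1) with hφ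
  have comm : ∀ u y, φ (fockMod hμ hg k1 s t u y) = u • φ y := by
    intro u y
    obtain ⟨x, rfl⟩ := Uq'.proj_surjective u
    rw [fockMod_proj, hφ, h.fockTo_fockRep hμ hg, Algebra.lsmul_coe]
  have hvac : φ (Finsupp.single (0, 0) 1) = Submodule.Quotient.mk 1 := by
    rw [hφ, fockTo_single, one_smul, wv, vv]
  have hu : ∀ u : Uq', φ (fockMod hμ hg k1 s t u (Finsupp.single (0, 0) 1)) =
      Submodule.Quotient.mk u := by
    intro u
    rw [comm, hvac, ← Submodule.Quotient.mk_smul, smul_eq_mul, mul_one]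
  refine ⟨LinearEquiv.ofBijective φ ⟨?_, fun z => ?_⟩, comm⟩
  -- Each Fock vector is `u` applied to the vacuum and maps to the class of `u`. If this class is
  -- zero, then `u` lies in the Verma ideal, which annihilates the vacuum.
  · rw [← LinearMap.ker_eq_bot, LinearMap.ker_eq_bot']
    intro y hy
    obtain ⟨u, rfl⟩ := fockMod_vacuum_surjective hμ hg k1 s t y
    rw [hu, Submodule.Quotient.mk_eq_zero] at hy
    exact fockMod_vacuum_eq_zero hμ hg hk hβ hζ hy
  · obtain ⟨u, rfl⟩ := Submodule.Quotient.mk_surjective _ z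
    exact ⟨_, hu u⟩

end Verma

/-! ### Embeddings of Fock spaces -/

/-- The shift of the basis vectors of the Fock space. -/
def fockShift (m n : ℕ) : Fock Kq →ₗ[Kq] Fock Kq :=
  Finsupp.lmapDomain Kq Kq fun p => (m + p.1, n + p.2)

theorem shift_injective (m n : ℕ) :
    Function.Injective fun p : ℕ × ℕ => (m + p.1, n + p.2) := by
  rintro ⟨a, b⟩ ⟨c, d⟩ h
  simpa using h

theorem fockShift_injective (m n : ℕ) : Function.Injective (fockShift m n) :=
  Finsupp.mapDomain_injective (shift_injective m n)

theorem fockShift_single (m n : ℕ) (p : ℕ × ℕ) (r : Kq) :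
    fockShift m n (Finsupp.single p r) = Finsupp.single (m + p.1, n + p.2) r :=
  Finsupp.mapDomain_single

theorem fockShift_fockShift (m n m' n' : ℕ) (y : Fock Kq) :
    fockShift m n (fockShift m' n' y) = fockShift (m + m') (n + n') y := by
  induction y using Finsupp.induction_linear with
  | zero => simp
  | add y z hy hz => simp [hy, hz]
  | single p r => simp [fockShift_single, add_assoc]

theorem mem_range_fockShift (m n : ℕ) (y : Fock Kq) :
    (∃ z, fockShift m n z = y) ↔ ∀ p, y p ≠ 0 → m ≤ p.1 ∧ n ≤ p.2 := by
  constructor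
  · rintro ⟨z, rfl⟩ p hp
    by_contra hne
    refine hp (Finsupp.mapDomain_of_notMem_range _ _ ?_)
    rintro ⟨p', rfl⟩
    exact hne ⟨Nat.le_add_right _ _, Nat.le_add_right _ _⟩
  · intro h
    refine ⟨_, Finsupp.mapDomain_comapDomain _ (shift_injective m n) y fun p hp => ?_⟩
    obtain ⟨h1, h2⟩ := h p (Finsupp.mem_support_iff.mp hp)
    exact ⟨(p.1 - m, p.2 - n), by ext <;> simp <;> omega⟩

section Shift

variable {μ : Kq} (hμ : μ ≠ 0) (hg : ∀ l : ℤ, cu (q ^ l * μ) ≠ 0)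

/-- Ladders started at a basis vector run through the quadrant above it with all coefficients equal
to one, so the embedding of a Fock space generated by a singular vector is a plain index shift. -/
theorem wv_fockMod (k1 s t : ℤ) (m n m' n' : ℕ) :
    wv (fockMod hμ hg k1 s t) (xx q μ m n) (Finsupp.single (m, n) 1) m' n' =
      Finsupp.single (m + m', n + n') 1 := by
  have hxx : ∀ a b, xx q (xx q μ m n) a b = xx q μ (m + a) (n + b) := by
    intro a b
    rw [xx, xx, xx, pow_add, pow_add, ← div_div]
    ring
  induction m' with
  | zero =>
    induction n' with
    | zero => rw [wv, vv]; rfl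
    | succ n' ih =>
      rw [wv] at ih ⊢
      rw [vv, ih, opQ, fockMod_opY, fockMod_Bm1, hxx, ← add_assoc n]
      set x := xx q μ (m + 0) (n + n') with hx
      have hc : cu x ≠ 0 := cu_xx_ne_zero q_ne_zero hg _ _
      rw [smul_comm x⁻¹, ← smul_add, inv_smul_eq_iff₀ hc, cu, smul_add, add_comm x,
        add_smul]
      abel
  | succ m' ih =>
    rw [wv] at ih ⊢
    rw [vv, ih, opP, fockMod_opY, fockMod_Bm1, hxx, ← add_assoc m]
    set x := xx q μ (m + m') (n + n') with hx
    have hc : cu x ≠ 0 := cu_xx_ne_zero q_ne_zero hg _ _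
    rw [smul_comm x, ← smul_sub, inv_smul_eq_iff₀ hc, cu, smul_add, add_smul]
    abel

/-- The shift intertwines the actions of `U_q'` on Fock spaces of suitable parameters. -/
theorem fockShift_fockMod {μ' : Kq} (hμ' : μ' ≠ 0) (hg' : ∀ l : ℤ, cu (q ^ l * μ') ≠ 0)
    {k1 s t k1' s' t' : ℤ} {m n : ℕ} (hk : k1' = k1 + m + n)
    (hm : m = 0 ∧ s' = s ∨ (m : ℤ) = s + 1 ∧ s' = -s - 2)
    (hn : n = 0 ∧ t' = t ∨ (n : ℤ) = t + 1 ∧ t' = -t - 2) (hx : μ' = xx q μ m n) (u : Uq')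
    (y : Fock Kq) : fockShift m n (fockMod hμ' hg' k1' s' t' u y) =
      fockMod hμ hg k1 s t u (fockShift m n y) := by
  obtain ⟨x, rfl⟩ := Uq'.proj_surjective u
  have h := fockMod_isHW hμ hg k1 s t m n hk hm hn
  rw [← hx] at h
  -- The shift is the canonical map attached to the singular vector at the corner, so it intertwines
  -- the two actions.
  have e : fockShift m n = fockTo (fockMod hμ hg k1 s t) μ' (Finsupp.single (m, n) 1) := by
    refine Finsupp.lhom_ext fun p r => ?_
    rw [fockShift_single, fockTo_single, hx, wv_fockMod]
    simp
  rw [fockMod_proj, e, h.fockTo_fockRep hμ' hg']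

end Shift

/-! ### Combinatorics of the exact sequence -/

/-- Two vectors cancel only on the intersection of the two quadrants, which is the doubly shifted
quadrant; the minus sign is that of the map $M_3\to M_1\oplus M_2$. -/
theorem exists_of_fockShift_add_eq_zero {a b : ℕ} {y₁ y₂ : Fock Kq}
    (h : fockShift a 0 y₁ + fockShift 0 b y₂ = 0) :
    ∃ z, fockShift 0 b z = y₁ ∧ -fockShift a 0 z = y₂ := by
  obtain ⟨z, hz⟩ := (mem_range_fockShift 0 b y₁).mpr fun p hp => by
    refine ⟨Nat.zero_le _, ?_⟩
    by_contra hlt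
    apply hp
    have h1 := DFunLike.congr_fun h (a + p.1, 0 + p.2)
    have h2 : fockShift a 0 y₁ (a + p.1, 0 + p.2) = y₁ p :=
      Finsupp.mapDomain_apply (shift_injective a 0) y₁ p
    have h3 : fockShift 0 b y₂ (a + p.1, 0 + p.2) = 0 := by
      by_contra hne
      have := ((mem_range_fockShift 0 b _).mp ⟨y₂, rfl⟩ _ hne).2
      simp only at this
      omega
    rw [Finsupp.add_apply, h2, h3, add_zero] at h1
    exact h1
  refine ⟨z, hz, fockShift_injective 0 b ?_⟩
  rw [map_neg, fockShift_fockShift, eq_neg_of_add_eq_zero_right h, ← hz, fockShift_fockShift]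
  simp

theorem mem_range_fockShift_add (a b : ℕ) (y : Fock Kq) :
    (∃ y₁ y₂, fockShift a 0 y₁ + fockShift 0 b y₂ = y) ↔ ∀ p, y p ≠ 0 → a ≤ p.1 ∨ b ≤ p.2 := by
  constructor
  · rintro ⟨y₁, y₂, rfl⟩ p hp
    by_contra! hlt
    apply hp
    rw [Finsupp.add_apply]
    have h1 : fockShift a 0 y₁ p = 0 := by
      by_contra hne
      exact absurd ((mem_range_fockShift a 0 _).mp ⟨y₁, rfl⟩ _ hne).1 (by omega)
    have h2 : fockShift 0 b y₂ p = 0 := by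
      by_contra hne
      exact absurd ((mem_range_fockShift 0 b _).mp ⟨y₂, rfl⟩ _ hne).2 (by omega)
    rw [h1, h2, add_zero]
  · intro h
    classical
    -- Points lying in both quadrants are assigned to the first.
    obtain ⟨y₁, h₁⟩ := (mem_range_fockShift a 0 (y.filter fun p => a ≤ p.1)).mpr fun p hp => by
      by_contra hne
      exact hp (Finsupp.filter_apply_neg _ _ fun h => hne ⟨h, Nat.zero_le _⟩)
    obtain ⟨y₂, h₂⟩ := (mem_range_fockShift 0 b (y.filter fun p => ¬ a ≤ p.1)).mpr fun p hp => by
      by_cases hp' : a ≤ p.1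
      · exact absurd (Finsupp.filter_apply_neg (fun p : ℕ × ℕ => ¬ a ≤ p.1) _ (not_not.mpr hp')) hp
      · rw [Finsupp.filter_apply_pos (fun p : ℕ × ℕ => ¬ a ≤ p.1) _ hp'] at hp
        exact ⟨Nat.zero_le _, (h p hp).resolve_left hp'⟩
    exact ⟨y₁, y₂, by rw [h₁, h₂, Finsupp.filter_add_filter_not]⟩

/-! ### Resolutions of modules isomorphic to Fock spaces -/

section Resolution

/-- An identification of a `U_q'`-module with a representation on the Fock space. -/
def IsFock {V : Type} [AddCommGroup V] [Module Kq V] [Module Uq' V]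
    (ρ : Uq' →ₐ[Kq] Module.End Kq (Fock Kq)) (e : Fock Kq ≃ₗ[Kq] V) : Prop :=
  ∀ u y, e (ρ u y) = u • e y

/-- The `U_q'`-linear map given by an intertwiner of Fock spaces. -/
def IsFock.hom {V V' : Type} [AddCommGroup V] [Module Kq V] [Module Uq' V] [AddCommGroup V']
    [Module Kq V'] [Module Uq' V'] {ρ ρ' : Uq' →ₐ[Kq] Module.End Kq (Fock Kq)}
    {e : Fock Kq ≃ₗ[Kq] V} {e' : Fock Kq ≃ₗ[Kq] V'} (he : IsFock ρ e) (he' : IsFock ρ' e')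
    (φ : Fock Kq →ₗ[Kq] Fock Kq) (hφ : ∀ u y, φ (ρ u y) = ρ' u (φ y)) : V →ₗ[Uq'] V' where
  toFun x := e' (φ (e.symm x))
  map_add' x y := by simp
  map_smul' u x := by
    obtain ⟨y, rfl⟩ := e.surjective x
    rw [← he, e.symm_apply_apply, e.symm_apply_apply, hφ, he', RingHom.id_apply]

theorem IsFock.hom_apply {V V' : Type} [AddCommGroup V] [Module Kq V] [Module Uq' V]
    [AddCommGroup V'] [Module Kq V'] [Module Uq' V'] {ρ ρ' : Uq' →ₐ[Kq] Module.End Kq (Fock Kq)}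
    {e : Fock Kq ≃ₗ[Kq] V} {e' : Fock Kq ≃ₗ[Kq] V'} (he : IsFock ρ e) (he' : IsFock ρ' e')
    (φ : Fock Kq →ₗ[Kq] Fock Kq) (hφ : ∀ u y, φ (ρ u y) = ρ' u (φ y)) (y : Fock Kq) :
    he.hom he' φ hφ (e y) = e' (φ y) := by
  simp [IsFock.hom]

variable {V V₁ V₂ V₃ : Type} [AddCommGroup V] [Module Kq V] [Module Uq' V] [IsScalarTower Kq Uq' V]
  [AddCommGroup V₁] [Module Kq V₁] [Module Uq' V₁] [AddCommGroup V₂] [Module Kq V₂] [Module Uq' V₂]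
  [AddCommGroup V₃] [Module Kq V₃] [Module Uq' V₃]
  {μ : Kq} (hμ : μ ≠ 0) (hg : ∀ l : ℤ, cu (q ^ l * μ) ≠ 0) {k1 : ℤ} {s t : ℕ}
  {e : Fock Kq ≃ₗ[Kq] V} (he : IsFock (fockMod hμ hg k1 s t) e)

include he in
/-- A proper submodule contains no vector with a component inside the box. -/
theorem IsFock.apply_eq_zero {N : Submodule Uq' V} (hN : N ≠ ⊤) {y : Fock Kq} (hy : e y ∈ N)
    (p : ℕ × ℕ) (hs : p.1 ≤ s) (ht : p.2 ≤ t) : y p = 0 := by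
  by_contra hp
  apply hN
  set W := (N.restrictScalars Kq).comap e.toLinearMap with hWdef
  have hW : ∀ g, ∀ x ∈ W, fockRep k1 μ (stParam s t) (FreeAlgebra.ι Kq g) x ∈ W := by
    intro g x hx
    change e _ ∈ N
    rw [← fockMod_cgen hμ hg, he]
    exact N.smul_mem _ hx
  have htop := eq_top_of_single_zero_mem hμ hg W hW (single_zero_mem hμ hg W hW
    (Int.ofNat_le.mpr hs) (Int.ofNat_le.mpr ht) (single_mem_of_stable hμ hg W hW hy hp))
  refine eq_top_iff.mpr fun x _ => ?_
  obtain ⟨y, rfl⟩ := e.surjective x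
  have : y ∈ W := htop ▸ Submodule.mem_top
  exact this

/-- The images of the basis vectors in the `a` by `b` box span the quotient. -/
theorem finite_quotient (N : Submodule Uq' V) (a b : ℕ)
    (h : ∀ p : ℕ × ℕ, a ≤ p.1 ∨ b ≤ p.2 → e (Finsupp.single p 1) ∈ N) :
    FiniteDimensional Kq (V ⧸ N) := by
  classical
  refine ⟨⟨(Finset.range a ×ˢ Finset.range b).image
    fun p => N.mkQ (e (Finsupp.single p 1)), ?_⟩⟩
  refine eq_top_iff.mpr fun x _ => ?_
  obtain ⟨x, rfl⟩ := N.mkQ_surjective x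
  obtain ⟨y, rfl⟩ := e.surjective x
  induction y using Finsupp.induction_linear with
  | zero => simp
  | add y z hy hz =>
    rw [map_add, map_add]
    exact Submodule.add_mem _ (hy trivial) (hz trivial)
  | single p r =>
    have hr : N.mkQ (e (Finsupp.single p r)) = r • N.mkQ (e (Finsupp.single p 1)) := by
      have : Finsupp.single p r = r • Finsupp.single p (1 : Kq) := by simp
      rw [this, map_smul]
      rfl
    rw [hr]
    refine Submodule.smul_mem _ _ ?_
    by_cases hp : a ≤ p.1 ∨ b ≤ p.2
    · rw [Submodule.mkQ_apply, (Submodule.Quotient.mk_eq_zero N).mpr (h p hp)]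
      exact Submodule.zero_mem _
    · push Not at hp
      refine Submodule.subset_span ?_
      rw [Finset.coe_image]
      exact ⟨p, by simpa using hp, rfl⟩

include he in
-- The image of `g` consists of the vectors supported outside the box. By `IsFock.apply_eq_zero` it
-- contains every proper submodule, so it is the only maximal one, and it must be the kernel of any
-- simple quotient.
theorem IsFock.resolution {ρ₁ ρ₂ ρ₃ : Uq' →ₐ[Kq] Module.End Kq (Fock Kq)}
    {e₁ : Fock Kq ≃ₗ[Kq] V₁} {e₂ : Fock Kq ≃ₗ[Kq] V₂} {e₃ : Fock Kq ≃ₗ[Kq] V₃}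
    (he₁ : IsFock ρ₁ e₁) (he₂ : IsFock ρ₂ e₂) (he₃ : IsFock ρ₃ e₃)
    (h₁ : ∀ u y, fockShift (s + 1) 0 (ρ₁ u y) = fockMod hμ hg k1 s t u (fockShift (s + 1) 0 y))
    (h₂ : ∀ u y, fockShift 0 (t + 1) (ρ₂ u y) = fockMod hμ hg k1 s t u (fockShift 0 (t + 1) y))
    (h₃₁ : ∀ u y, fockShift 0 (t + 1) (ρ₃ u y) = ρ₁ u (fockShift 0 (t + 1) y))
    (h₃₂ : ∀ u y, fockShift (s + 1) 0 (ρ₃ u y) = ρ₂ u (fockShift (s + 1) 0 y)) :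
    (∃! N : Submodule Uq' V, IsSimpleModule Uq' (V ⧸ N)) ∧
      ∀ N : Submodule Uq' V, IsSimpleModule Uq' (V ⧸ N) → FiniteDimensional Kq (V ⧸ N) ∧
        ∃ (f : V₃ →ₗ[Uq'] V₁ × V₂) (g : V₁ × V₂ →ₗ[Uq'] V),
          Function.Injective f ∧ Function.Exact f g ∧ Function.Exact g N.mkQ ∧
            Function.Surjective N.mkQ := by
  set g : V₁ × V₂ →ₗ[Uq'] V := (he₁.hom he _ h₁).coprod (he₂.hom he _ h₂) with hgdef
  set f : V₃ →ₗ[Uq'] V₁ × V₂ := (he₃.hom he₁ _ h₃₁).prod (-(he₃.hom he₂ _ h₃₂)) with hfdef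
  have g_apply : ∀ y₁ y₂, g (e₁ y₁, e₂ y₂) =
      e (fockShift (s + 1) 0 y₁ + fockShift 0 (t + 1) y₂) := by
    intro y₁ y₂
    rw [hgdef, LinearMap.coprod_apply, IsFock.hom_apply, IsFock.hom_apply, map_add]
  have f_apply : ∀ y, f (e₃ y) = (e₁ (fockShift 0 (t + 1) y), e₂ (-fockShift (s + 1) 0 y)) := by
    intro y
    rw [map_neg, ← IsFock.hom_apply he₃ he₁ _ h₃₁, ← IsFock.hom_apply he₃ he₂ _ h₃₂]
    rfl
  have mem_range : ∀ y, e y ∈ LinearMap.range g ↔ ∀ p, y p ≠ 0 → s + 1 ≤ p.1 ∨ t + 1 ≤ p.2 := by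
    intro y
    rw [← mem_range_fockShift_add]
    constructor
    · rintro ⟨⟨x₁, x₂⟩, hx⟩
      obtain ⟨y₁, rfl⟩ := e₁.surjective x₁
      obtain ⟨y₂, rfl⟩ := e₂.surjective x₂
      rw [g_apply] at hx
      exact ⟨y₁, y₂, e.injective hx⟩
    · rintro ⟨y₁, y₂, rfl⟩
      exact ⟨_, g_apply y₁ y₂⟩
  have le_range : ∀ N : Submodule Uq' V, N ≠ ⊤ → N ≤ LinearMap.range g := by
    intro N hN x hx
    obtain ⟨y, rfl⟩ := e.surjective x
    rw [mem_range]
    intro p hp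
    by_contra! hlt
    exact hp (he.apply_eq_zero hμ hg hN hx p (by omega) (by omega))
  have hne : LinearMap.range g ≠ ⊤ := by
    intro h
    have := (mem_range (Finsupp.single (0, 0) 1)).mp (h ▸ Submodule.mem_top) (0, 0) (by simp)
    simp at this
  have hcoatom : ∀ N : Submodule Uq' V, IsCoatom N ↔ N = LinearMap.range g := by
    intro N
    constructor
    · intro hN
      by_contra hNe
      exact hne (hN.2 _ (lt_of_le_of_ne (le_range N hN.1) hNe))
    · rintro rfl
      refine ⟨hne, fun N hN => ?_⟩
      by_contra hN'
      exact absurd (le_range N hN') (not_le_of_gt hN)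
  simp only [isSimpleModule_iff_isCoatom, hcoatom]
  refine ⟨⟨_, rfl, fun _ h => h⟩, ?_⟩
  rintro N rfl
  refine ⟨finite_quotient (e := e) _ (s + 1) (t + 1) fun p hp => ?_, f, g, ?_, ?_, ?_,
    Submodule.mkQ_surjective _⟩
  · rw [mem_range]
    intro p' hp'
    rw [Finsupp.single_apply_ne_zero] at hp'
    exact hp'.1 ▸ hp
  · intro x x' hx
    obtain ⟨y, rfl⟩ := e₃.surjective x
    obtain ⟨y', rfl⟩ := e₃.surjective x'
    rw [f_apply, f_apply, Prod.mk.injEq] at hx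
    rw [fockShift_injective _ _ (e₁.injective hx.1)]
  · rintro ⟨x₁, x₂⟩
    obtain ⟨y₁, rfl⟩ := e₁.surjective x₁
    obtain ⟨y₂, rfl⟩ := e₂.surjective x₂
    rw [g_apply]
    constructor
    · intro h
      obtain ⟨z, rfl, rfl⟩ := exists_of_fockShift_add_eq_zero (e.map_eq_zero_iff.mp h)
      exact ⟨e₃ z, f_apply z⟩
    · rintro ⟨x, hx⟩
      obtain ⟨z, rfl⟩ := e₃.surjective x
      rw [f_apply, Prod.mk.injEq] at hx
      rw [← e₁.injective hx.1, ← e₂.injective hx.2, map_neg, fockShift_fockShift,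
        fockShift_fockShift]
      simp
  · intro x
    rw [Submodule.mkQ_apply, Submodule.Quotient.mk_eq_zero]
    rfl

end Resolution

/-! ### The parameters of the resolution -/

/-- $z+z^{-1}=0$ means $z^2=-1$, that is $z=\pm\iota$. -/
theorem IsGood.cu_ne_zero {μ : Kq} (h : IsGood μ) (l : ℤ) (hμ : μ ≠ 0) :
    cu (q ^ l * μ) ≠ 0 := by
  intro h'
  have h0 := q_ne_zero
  have hz : q ^ l * μ ≠ 0 := mul_ne_zero (zpow_ne_zero _ h0) hμ
  have hi : iota ^ 2 = -1 := by
    rw [iota, ← map_pow, Complex.I_sq, map_neg, map_one]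
  have hm : ∀ y, q ^ l * μ = y → μ = q ^ (-l) * y := by
    rintro y rfl
    rw [zpow_neg, inv_mul_cancel_left₀ (zpow_ne_zero _ h0)]
  have hsq : (q ^ l * μ) ^ 2 = iota ^ 2 := by
    rw [hi]
    rw [cu] at h'
    generalize q ^ l * μ = z at *
    field_simp at h'
    linear_combination h'
  rcases sq_eq_sq_iff_eq_or_eq_neg.mp hsq with h1 | h1
  · exact (h (-l)).1 (hm _ h1)
  · exact (h (-l)).2 (by rw [← mul_neg]; exact hm _ h1)

section Zeta

variable {K : Type*} [Field K] {q : K}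

theorem zeta1_identity (h0 : q ≠ 0) (h2 : q ^ 2 - 1 ≠ 0) {S T μ : K} (hS : S ≠ 0)
    (hT : T ≠ 0) (hμ : μ ≠ 0) :
    μ * q * br q T + μ⁻¹ * (S * q / T) * br q (S * q ^ 2) =
      br q (T * (S * q ^ 2) * ((S * q)⁻¹ * μ)) - S * q ^ 2 / T * br q ((S * q)⁻¹ * μ) := by
  unfold br
  field_simp
  ring

theorem zeta2_identity (h0 : q ≠ 0) (h2 : q ^ 2 - 1 ≠ 0) {S T μ : K} (hS : S ≠ 0)
    (hT : T ≠ 0) (hμ : μ ≠ 0) :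
    -(μ * (T * q / S) * br q (T * q ^ 2)) - μ⁻¹ * q * br q S =
      br q ((T * (S * q ^ 2))⁻¹ * (T * q * μ)) - T * q ^ 2 / S * br q (T * q * μ) := by
  unfold br
  field_simp
  ring

theorem zeta3_identity (h0 : q ≠ 0) (h2 : q ^ 2 - 1 ≠ 0) {S T μ : K} (hS : S ≠ 0)
    (hT : T ≠ 0) (hμ : μ ≠ 0) :
    S * T * q ^ 2 * (μ⁻¹ * T⁻¹ * br q (S * q ^ 2) - μ * S⁻¹ * br q (T * q ^ 2)) =
      br q (S / T * (T / S * μ)) - S * T * q ^ 4 * br q (T / S * μ) := by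
  unfold br
  field_simp
  ring

end Zeta

section Zeta

/-- The weight $\zeta'_1$ is the dominant formula after the reflection $s\mapsto-s-2$ with $\mu$
shifted to the corner. The next two treat the reflection in $t$ and the reflection in both. -/
theorem zeta1_eq (s t : ℤ) {μ : Kq} (hμ : μ ≠ 0) :
    zeta1 (s + t) μ s = zetaST (-s - 2) t (q ^ (-(s + 1)) * μ) := by
  have h0 := q_ne_zero
  have := zeta1_identity h0 q_sq_sub_one_ne_zero (zpow_ne_zero s h0) (zpow_ne_zero t h0) hμ
  rw [zeta1, zetaST, qint_eq_br, qint_eq_br, show s + t - s = t by ring,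
    show q ^ (2 * s + 1 - (s + t)) = q ^ s * q / q ^ t by
      rw [← zpow_add_one₀ h0, ← zpow_sub₀ h0]; ring_nf,
    show q ^ (s + 2) = q ^ s * q ^ 2 by rw [zpow_add₀ h0]; rfl,
    show q ^ (t - (-s - 2)) = q ^ t * (q ^ s * q ^ 2) by
      rw [← zpow_natCast q 2, ← zpow_add₀ h0, ← zpow_add₀ h0]; push_cast; ring_nf,
    show q ^ (-(s + 1)) = (q ^ s * q)⁻¹ by rw [← zpow_add_one₀ h0, zpow_neg],
    show q ^ (-(-s - 2) - t) = q ^ s * q ^ 2 / q ^ t by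
      rw [← zpow_natCast q 2, ← zpow_add₀ h0, ← zpow_sub₀ h0]; push_cast; ring_nf]
  exact this

theorem zeta2_eq (s t : ℤ) {μ : Kq} (hμ : μ ≠ 0) :
    zeta2 (s + t) μ t = zetaST s (-t - 2) (q ^ (t + 1) * μ) := by
  have h0 := q_ne_zero
  have := zeta2_identity h0 q_sq_sub_one_ne_zero (zpow_ne_zero s h0) (zpow_ne_zero t h0) hμ
  rw [zeta2, zetaST, qint_eq_br, qint_eq_br, show s + t - t = s by ring,
    show q ^ (2 * t + 1 - (s + t)) = q ^ t * q / q ^ s by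
      rw [← zpow_add_one₀ h0, ← zpow_sub₀ h0]; ring_nf,
    show q ^ (t + 2) = q ^ t * q ^ 2 by rw [zpow_add₀ h0]; rfl,
    show q ^ (-t - 2 - s) = (q ^ t * (q ^ s * q ^ 2))⁻¹ by
      rw [← zpow_natCast q 2, ← zpow_add₀ h0, ← zpow_add₀ h0, ← zpow_neg]; push_cast; ring_nf,
    show q ^ (t + 1) = q ^ t * q by rw [← zpow_add_one₀ h0],
    show q ^ (-s - (-t - 2)) = q ^ t * q ^ 2 / q ^ s by
      rw [← zpow_natCast q 2, ← zpow_add₀ h0, ← zpow_sub₀ h0]; push_cast; ring_nf]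
  exact this

theorem zeta3_eq (s t : ℤ) {μ : Kq} (hμ : μ ≠ 0) :
    zeta3 (s + t) μ s = zetaST (-s - 2) (-t - 2) (q ^ (t - s) * μ) := by
  have h0 := q_ne_zero
  have := zeta3_identity h0 q_sq_sub_one_ne_zero (zpow_ne_zero s h0) (zpow_ne_zero t h0) hμ
  rw [zeta3, zetaST, qint_eq_br, qint_eq_br, show s + t - s + 2 = t + 2 by ring,
    show q ^ (s - (s + t)) = (q ^ t)⁻¹ by rw [← zpow_neg]; ring_nf,
    show q ^ (-s) = (q ^ s)⁻¹ from zpow_neg _ _,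
    show q ^ (s + t + 2) = q ^ s * q ^ t * q ^ 2 by rw [zpow_add₀ h0, zpow_add₀ h0]; rfl,
    show q ^ (s + 2) = q ^ s * q ^ 2 by rw [zpow_add₀ h0]; rfl,
    show q ^ (t + 2) = q ^ t * q ^ 2 by rw [zpow_add₀ h0]; rfl,
    show q ^ (t - s) = q ^ t / q ^ s from zpow_sub₀ h0 _ _,
    show q ^ (-t - 2 - (-s - 2)) = q ^ s / q ^ t by rw [← zpow_sub₀ h0]; ring_nf,
    show q ^ (-(-s - 2) - (-t - 2)) = q ^ s * q ^ t * q ^ 4 by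
      rw [← zpow_natCast q 4, ← zpow_add₀ h0, ← zpow_add₀ h0]; push_cast; ring_nf]
  exact this

end Zeta

end QSP

end

theorem corollary4p16 (kd k1 κ : ℤ) (hκ : κ = kd - k1) (μ ζ : QSP.Kq) (hμ : μ ≠ 0)
    (hgood : QSP.IsGood μ) (i : ℤ) (hi0 : 0 ≤ i) (hiκ : i ≤ κ)
    (hζ : ζ = QSP.qbr μ (κ - 2 * i) - QSP.q ^ (-κ) * QSP.qbr μ 0) :
    (∃! N : Submodule QSP.Uq' (QSP.Verma kd k1 (QSP.qbr μ 0) ζ),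
      IsSimpleModule QSP.Uq' (QSP.Verma kd k1 (QSP.qbr μ 0) ζ ⧸ N)) ∧
    ∀ N : Submodule QSP.Uq' (QSP.Verma kd k1 (QSP.qbr μ 0) ζ),
      IsSimpleModule QSP.Uq' (QSP.Verma kd k1 (QSP.qbr μ 0) ζ ⧸ N) →
      FiniteDimensional QSP.Kq (QSP.Verma kd k1 (QSP.qbr μ 0) ζ ⧸ N) ∧
      ∃ (f : QSP.Verma (k1 - 2) (kd + 2) (QSP.qbr μ (κ - 2 * i)) (QSP.zeta3 κ μ i) →ₗ[QSP.Uq']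
            QSP.Verma (kd - i - 1) (k1 + i + 1) (QSP.qbr μ (-(i + 1))) (QSP.zeta1 κ μ i) ×
            QSP.Verma (k1 + i - 1) (kd - i + 1) (QSP.qbr μ (κ - i + 1)) (QSP.zeta2 κ μ (κ - i)))
        (g : QSP.Verma (kd - i - 1) (k1 + i + 1) (QSP.qbr μ (-(i + 1))) (QSP.zeta1 κ μ i) ×
            QSP.Verma (k1 + i - 1) (kd - i + 1) (QSP.qbr μ (κ - i + 1)) (QSP.zeta2 κ μ (κ - i))
            →ₗ[QSP.Uq'] QSP.Verma kd k1 (QSP.qbr μ 0) ζ),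
        Function.Injective f ∧ Function.Exact f g ∧ Function.Exact g N.mkQ ∧
          Function.Surjective N.mkQ := by
  -- Dominance is exactly what makes $s=i$ and $t=\kappa-i$ natural numbers, hence the box finite
  -- and nonempty.
  obtain ⟨s, rfl⟩ := Int.eq_ofNat_of_zero_le hi0
  obtain ⟨t, ht⟩ := Int.eq_ofNat_of_zero_le (sub_nonneg.mpr hiκ)
  obtain rfl : κ = s + t := by omega
  have hkd : kd = k1 + s + t := by omega
  have hg : ∀ l : ℤ, QSP.cu (QSP.q ^ l * μ) ≠ 0 := fun l => hgood.cu_ne_zero l hμ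
  have h0 := QSP.q_ne_zero
  have hμ' : ∀ l : ℤ, QSP.q ^ l * μ ≠ 0 := fun l => mul_ne_zero (zpow_ne_zero l h0) hμ
  have hg' : ∀ k l : ℤ, QSP.cu (QSP.q ^ l * (QSP.q ^ k * μ)) ≠ 0 := fun k l => by
    rw [← mul_assoc, ← zpow_add₀ h0]
    exact hg _
  rw [show (s : ℤ) + t - s = t by ring]
  obtain ⟨e, he⟩ := QSP.exists_vermaEquiv (kd := kd) (β := QSP.qbr μ 0) (ζ := ζ) hμ hg hkd
    (by rw [QSP.qbr_eq_br, zpow_zero, one_mul])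
    (by rw [hζ, QSP.zetaST, QSP.qbr_eq_br, QSP.qbr_eq_br, zpow_zero, one_mul]; ring_nf)
  obtain ⟨e₁, he₁⟩ := QSP.exists_vermaEquiv (kd := kd - s - 1) (k1 := k1 + s + 1)
    (s := -s - 2) (t := t) (β := QSP.qbr μ (-(s + 1))) (ζ := QSP.zeta1 (s + t) μ s)
    (hμ' (-(s + 1))) (hg' _) (by omega) (QSP.qbr_eq_br _ _) (QSP.zeta1_eq _ _ hμ)
  obtain ⟨e₂, he₂⟩ := QSP.exists_vermaEquiv (kd := k1 + s - 1) (k1 := kd - s + 1)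
    (s := s) (t := -t - 2) (β := QSP.qbr μ (t + 1)) (ζ := QSP.zeta2 (s + t) μ t)
    (hμ' (t + 1)) (hg' _) (by omega) (QSP.qbr_eq_br _ _) (QSP.zeta2_eq _ _ hμ)
  obtain ⟨e₃, he₃⟩ := QSP.exists_vermaEquiv (kd := k1 - 2) (k1 := kd + 2)
    (s := -s - 2) (t := -t - 2) (β := QSP.qbr μ (s + t - 2 * s)) (ζ := QSP.zeta3 (s + t) μ s)
    (hμ' (t - s)) (hg' _) (by omega) (by rw [QSP.qbr_eq_br]; ring_nf) (QSP.zeta3_eq _ _ hμ)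
  -- The first two goals embed $M_1$ and $M_2$ in $M$. The last two embed $M_3$ in $M_1$ and $M_2$,
  -- crossing the wall that has not been reflected yet.
  refine QSP.IsFock.resolution hμ hg he he₁ he₂ he₃ ?_ ?_ ?_ ?_
  · refine QSP.fockShift_fockMod _ _ _ _ (by push_cast; ring) (.inr ⟨by push_cast; ring, rfl⟩)
      (.inl ⟨rfl, rfl⟩) ?_
    rw [QSP.xx_eq_zpow h0]
    congr 2
  · refine QSP.fockShift_fockMod _ _ _ _ (by push_cast; omega) (.inl ⟨rfl, rfl⟩)
      (.inr ⟨by push_cast; ring, rfl⟩) ?_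
    rw [QSP.xx_eq_zpow h0]
    congr 2
  · refine QSP.fockShift_fockMod _ _ _ _ (by push_cast; omega) (.inl ⟨rfl, rfl⟩)
      (.inr ⟨by push_cast; ring, rfl⟩) ?_
    rw [QSP.xx_eq_zpow h0, ← mul_assoc, ← zpow_add₀ h0]
    congr 2
    push_cast
    ring
  · refine QSP.fockShift_fockMod _ _ _ _ (by push_cast; omega) (.inr ⟨by push_cast; ring, rfl⟩)
      (.inl ⟨rfl, rfl⟩) ?_
    rw [QSP.xx_eq_zpow h0, ← mul_assoc, ← zpow_add₀ h0]
    congr 2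
    push_cast
    ring
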